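/- Let $B\in\mathbb R$. There is $K_0$ (depending only on $B$) such that the following holds for every $K\ge K_0$, every $M>0$ and every smooth $\tilde\psi:\mathbb R\to\mathbb R$ with $|\tilde\psi|\le B$, $\tilde\psi(r)=1$ for $r<KM/2$ and $\tilde\psi(r)=0$ for $r>KM$ (for instance any such cutoff with values in $[0,1]$, with $B=1$). Put $$h(r)=(1-\tilde\psi(r))\Bigl(1-\frac{2M}{r}\Bigr)^{1/2}+\tilde\psi(r),\qquad r=|x|,\ x\in\mathbb R^3,$$ (with $h(r)=1$ where $\tilde\psi(r)=1$), and $$P_1=-h\,r^{-2}\partial_r\,r^2h^2\,\partial_r\,h-h^2r^{-2}\Delta_\omega,$$ where $\Delta_\omega$ is the Laplace--Beltrami operator of the unit sphere; $P_1$ is regarded as an operator in $L^2(\mathbb R^3;\mathbb C)$ with domain $\{u\in H^1(\mathbb R^3): P_1u\in L^2(\mathbb R^3)\}$, $P_1u$ being taken in the sense of distributions. Then $P_1$ is self-adjoint, and there is a constant $C>0$ (depending on $M$ and $\tilde\psi$ only) such that the following estimates hold, where the powers $P_1^{s/2}$ are those of the spectral theorem. (i) Every $v\in H^1(\mathbb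 R^3)$ lies in the domain of $P_1^{1/2}$, and $$\|P_1^{1/2}v\|_{l^{-1/2}_\infty(L^2)}\le C\Bigl(\|\nabla v\|_{l^{-1/2}_\infty(L^2)}+\|v\|_{l^{-3/2}_\infty(L^2)}\Bigr).$$ Here $\|f\|_{l^{\sigma}_\infty(L^2)}=\sup_{j\ge0}2^{j\sigma}\|\phi_jf\|_{L^2(\mathbb R^3)}$, and $1=\sum_{j\ge0}\phi_j^2$ is any partition of unity by measurable (for example smooth) real functions subordinate to the dyadic annuli, that is, $\phi_0$ vanishes outside $\{|x|\le2\}$ and $\phi_j$ vanishes outside $\{2^{j-1}\le|x|\le2^{j+1}\}$ for $j\ge1$. (ii) For every $s\in[-1,1]$ and every $u\in L^2(\mathbb R^3)$: $u$ lies in the domain of $P_1^{s/2}$ if and only if $\|u\|_{\dot H^s}<\infty$, and in this case $$C^{-1}\|u\|_{\dot H^s}\le\|P_1^{s/2}u\|_{L^2}\le C\|u\|_{\dot H^s}.$$ Here $\|u\|_{\dot H^s}=\bigl\|\,|2\pi\xi|^s\hat u(\xi)\bigr\|_{L^2_\xi}\in[0,\infty]$ with $\hat u(\xi)=\int e^{-2\pi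 i x\cdot\xi}u(x)\,dx$. -/

import Mathlib

open MeasureTheory Filter Topology
open scoped ContDiff SchwartzMap LineDeriv FourierTransform ENNReal

noncomputable section

/-- Euclidean space `ℝ³`. -/
abbrev R3 : Type := EuclideanSpace ℝ (Fin 3)

/-- The complex Hilbert space `L²(ℝ³)`. -/
abbrev L2R3 : Type := Lp ℂ 2 (volume : Measure R3)

/-! ### Fractional powers of an unbounded self-adjoint operator -/

section FractionalPowers

variable {H : Type*} [NormedAddCommGroup H] [InnerProductSpace ℂ H] [CompleteSpace H]

/-- `R` is a bounded everywhere defined inverse of `1 + A`. -/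
def IsResolventNegOne (A : H →ₗ.[ℂ] H) (R : H →L[ℂ] H) : Prop :=
  (∀ x : H, ∃ hx : R x ∈ A.domain, R x + A ⟨R x, hx⟩ = x) ∧
    ∀ u : A.domain, R ((u : H) + A u) = u

open Classical in
/-- The bounded operator `(1 + A)⁻¹`; it exists whenever `A` is self-adjoint and nonnegative. -/
def resolventNegOne (A : H →ₗ.[ℂ] H) : H →L[ℂ] H :=
  if h : ∃ R : H →L[ℂ] H, IsResolventNegOne A R then h.choose else 0

/-- The bounded operator `f_ε(A)`, where `f_ε(l) = ((l + ε (1 + l)) / (1 + ε (1 + l))) ^ α` is a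
bounded continuous function of `l ≥ 0` for each `ε > 0`, and `f_ε(l) → l ^ α` as `ε → 0`. In terms
of `x = (1 + l)⁻¹`, that is, of `R = (1 + A)⁻¹` (whose spectrum lies in `[0, 1]` if `A ≥ 0`), this
is `((1 - x + ε) / (x + ε)) ^ α`, evaluated by the continuous functional calculus of `R`. -/
def regPow (A : H →ₗ.[ℂ] H) (α ε : ℝ) : H →L[ℂ] H :=
  cfc (fun x : ℝ => ((1 - x + ε) / (x + ε)) ^ α) (resolventNegOne A)

/-- The graph of `A ^ α`: all pairs `(u, w)` such that `f_ε(A) u → w` as `ε ↓ 0`. -/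
def fracPowGraph (A : H →ₗ.[ℂ] H) (α : ℝ) : Submodule ℂ (H × H) where
  carrier := {p | Tendsto (fun ε : ℝ => regPow A α ε p.1) (𝓝[>] 0) (𝓝 p.2)}
  add_mem' := by
    intro p q hp hq
    simpa using hp.add hq
  zero_mem' := by simp
  smul_mem' := by
    intro c p hp
    simpa using hp.const_smul c

/-- The power `A ^ α` (`α` real) of a nonnegative self-adjoint injective operator `A`, as an
unbounded operator: `A ^ α u = lim_{ε ↓ 0} f_ε(A) u`, with domain the set of all `u` for which the
limit exists in `H`. If `E` is the spectral measure of `A`, then `f_ε(A) u` converges if and only if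
`∫ l ^ (2 α) d⟪E_l u, u⟫ < ∞`, and the limit is `∫ l ^ α dE_l u`; so this is the power of the
spectral theorem. -/
def fracPow (A : H →ₗ.[ℂ] H) (α : ℝ) : H →ₗ.[ℂ] H :=
  (fracPowGraph A α).toLinearPMap

theorem mem_fracPow_domain {A : H →ₗ.[ℂ] H} {α : ℝ} {u : H} :
    u ∈ (fracPow A α).domain ↔
      ∃ w, Tendsto (fun ε : ℝ => regPow A α ε u) (𝓝[>] 0) (𝓝 w) := by
  simp [fracPow, Submodule.toLinearPMap_domain, fracPowGraph]

theorem tendsto_fracPow (A : H →ₗ.[ℂ] H) (α : ℝ) (u : (fracPow A α).domain) :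
    Tendsto (fun ε : ℝ => regPow A α ε (u : H)) (𝓝[>] 0) (𝓝 (fracPow A α u)) := by
  have hg : ∀ (x : H × H) (_ : x ∈ fracPowGraph A α) (_ : x.fst = 0), x.snd = 0 := by
    rintro ⟨x, y⟩ hx h0
    have h0' : x = 0 := h0
    subst h0'
    have h1 : Tendsto (fun ε : ℝ => regPow A α ε (0 : H)) (𝓝[>] 0) (𝓝 y) := hx
    simp only [map_zero] at h1
    exact tendsto_nhds_unique h1 tendsto_const_nhds
  exact Submodule.mem_graph_toLinearPMap hg u

end FractionalPowers

/-! ### The operator `P₁` -/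

/-- The radial function `h = (1 - ψ) (1 - 2M/r)^{1/2} + ψ`. -/
def hFun (M : ℝ) (ψ : ℝ → ℝ) (r : ℝ) : ℝ :=
  (1 - ψ r) * Real.sqrt (1 - 2 * M / r) + ψ r

/-- The radial derivative `∂_r f (x) = (x / |x|) · ∇f (x)`. -/
def radialDeriv (f : R3 → ℂ) (x : R3) : ℂ := fderiv ℝ f x (‖x‖⁻¹ • x)

/-- The rotational derivative `Ω_{ij} f = x_i ∂_j f - x_j ∂_i f`. -/
def rotDeriv (i j : Fin 3) (f : R3 → ℂ) (x : R3) : ℂ :=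
  fderiv ℝ f x (x i • EuclideanSpace.single j 1 - x j • EuclideanSpace.single i 1)

/-- The Laplace-Beltrami operator of the unit sphere acting in the angular variable,
`Δ_ω = Ω_{01}² + Ω_{12}² + Ω_{20}²`. -/
def sphereLaplacian (f : R3 → ℂ) (x : R3) : ℂ :=
  rotDeriv 0 1 (rotDeriv 0 1 f) x + rotDeriv 1 2 (rotDeriv 1 2 f) x +
    rotDeriv 2 0 (rotDeriv 2 0 f) x

/-- The differential expression `- h r⁻² ∂_r (r² h² ∂_r (h f)) - h² r⁻² Δ_ω f`, `r = |x|`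
(meaningful for `x ≠ 0`). -/
def P1Expr (h : ℝ → ℝ) (f : R3 → ℂ) (x : R3) : ℂ :=
  -((h ‖x‖ * (‖x‖ ^ 2)⁻¹ : ℝ) : ℂ) *
      radialDeriv (fun y => ((‖y‖ ^ 2 * h ‖y‖ ^ 2 : ℝ) : ℂ) *
        radialDeriv (fun z => ((h ‖z‖ : ℝ) : ℂ) * f z) y) x
    - ((h ‖x‖ ^ 2 * (‖x‖ ^ 2)⁻¹ : ℝ) : ℂ) * sphereLaplacian f x

/-- `G = (G₀, G₁, G₂) ∈ L²` is the weak (distributional) gradient of `u ∈ L²`. Thus `u` belongs to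
the Sobolev space `H¹(ℝ³)` if and only if some such `G` exists. -/
def IsWeakGrad (u : L2R3) (G : Fin 3 → L2R3) : Prop :=
  ∀ i : Fin 3, ∂_{(EuclideanSpace.single i 1 : R3)} (u : 𝓢'(R3, ℂ)) = (G i : 𝓢'(R3, ℂ))

/-- The graph of `P₁` in `L²(ℝ³)`: all pairs `(u, f)` with `u ∈ H¹` such that `P₁ u = f` in the sense
of distributions, i.e. `⟨P₁ φ, u⟩ = ⟨φ, f⟩` for all test functions `φ ∈ C_c^∞(ℝ³)`. Here `Φ` and `Ψ`
are the classes of `φ` and `P₁ φ` in `L²` (for the functions `h` of interest, `P₁ φ` is bounded with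
compact support). -/
def P1Graph (h : ℝ → ℝ) : Submodule ℂ (L2R3 × L2R3) where
  carrier := {p | (∃ G : Fin 3 → L2R3, IsWeakGrad p.1 G) ∧
    ∀ φ : R3 → ℂ, ContDiff ℝ ∞ φ → HasCompactSupport φ →
      ∀ Φ Ψ : L2R3, (Φ : R3 → ℂ) =ᵐ[volume] φ → (Ψ : R3 → ℂ) =ᵐ[volume] P1Expr h φ →
        inner ℂ Ψ p.1 = inner ℂ Φ p.2}
  add_mem' := by
    rintro p q ⟨⟨G, hG⟩, hp⟩ ⟨⟨G', hG'⟩, hq⟩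
    refine ⟨⟨G + G', fun i => ?_⟩, fun φ h1 h2 Φ Ψ h3 h4 => ?_⟩
    · have e1 := hG i
      have e2 := hG' i
      simp only [← Lp.toTemperedDistributionCLM_apply, Prod.fst_add, Pi.add_apply, map_add,
        LineDeriv.lineDerivOp_add] at e1 e2 ⊢
      rw [e1, e2]
    · simp only [Prod.fst_add, Prod.snd_add, inner_add_right]
      rw [hp φ h1 h2 Φ Ψ h3 h4, hq φ h1 h2 Φ Ψ h3 h4]
  zero_mem' := by
    refine ⟨⟨0, fun i => ?_⟩, fun φ h1 h2 Φ Ψ h3 h4 => ?_⟩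
    · simp only [← Lp.toTemperedDistributionCLM_apply, Prod.fst_zero, Pi.zero_apply, map_zero,
        LineDeriv.lineDerivOp_zero]
    · simp
  smul_mem' := by
    rintro c p ⟨⟨G, hG⟩, hp⟩
    refine ⟨⟨c • G, fun i => ?_⟩, fun φ h1 h2 Φ Ψ h3 h4 => ?_⟩
    · have e1 := hG i
      simp only [← Lp.toTemperedDistributionCLM_apply, Prod.smul_fst, Pi.smul_apply, map_smul,
        LineDeriv.lineDerivOp_smul] at e1 ⊢
      rw [e1]
    · simp only [Prod.smul_fst, Prod.smul_snd, inner_smul_right]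
      rw [hp φ h1 h2 Φ Ψ h3 h4]

/-- The operator `P₁ = - h r⁻² ∂_r r² h² ∂_r h - h² r⁻² Δ_ω` in `L²(ℝ³)`, with domain
`{u ∈ H¹ : P₁ u ∈ L²}`. -/
def P1 (h : ℝ → ℝ) : L2R3 →ₗ.[ℂ] L2R3 := (P1Graph h).toLinearPMap

/-! ### The norms -/

/-- `1 = ∑_{j ≥ 0} φ_j²` is a partition of unity subordinate to the dyadic annuli
`|x| ≤ 2` (`j = 0`) and `2^{j-1} ≤ |x| ≤ 2^{j+1}` (`j ≥ 1`). The functions `φ_j` may be smooth, but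
only measurability is asked for. -/
structure IsDyadicPartition (φ : ℕ → R3 → ℝ) : Prop where
  measurable : ∀ j, Measurable (φ j)
  hasSum : ∀ x, HasSum (fun j => φ j x ^ 2) 1
  support_zero : ∀ x, φ 0 x ≠ 0 → ‖x‖ ≤ 2
  support_succ : ∀ j x, φ (j + 1) x ≠ 0 → 2 ^ j ≤ ‖x‖ ∧ ‖x‖ ≤ 2 ^ (j + 2)

/-- The norm of `l^s_∞(L²)`: `sup_{j ≥ 0} 2^{js} ‖φ_j f‖_{L²}`. -/
def locNorm {F : Type*} [NormedAddCommGroup F] [NormedSpace ℝ F]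
    (φ : ℕ → R3 → ℝ) (s : ℝ) (f : R3 → F) : ℝ≥0∞ :=
  ⨆ j : ℕ, ENNReal.ofReal ((2 : ℝ) ^ ((j : ℝ) * s)) *
    eLpNorm (fun x => φ j x • f x) 2 volume

/-- The homogeneous Sobolev norm `‖u‖_{Ḣ^s} = ‖ |2πξ|^s û ‖_{L²} ∈ [0, ∞]` of `u ∈ L²`, where
`û(ξ) = ∫ e^{-2πi x·ξ} u(x) dx`; so it is the `L²` norm of `(-Δ)^{s/2} u`. -/
def hDotNorm (s : ℝ) (u : L2R3) : ℝ≥0∞ :=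
  eLpNorm (fun ξ : R3 => (((2 * Real.pi * ‖ξ‖) ^ s : ℝ) : ℂ) * (𝓕 u : L2R3) ξ) 2 volume

end

/-! In Cartesian coordinates `P₁ u = -h div (S² ∇ (h u))` with `S = 1 + (h - 1) x xᵀ / |x|²`, so
`P₁` is the operator of the form `‖S ∇ (h u)‖²`. If `K` is large then `|h - 1| ≤ 1/2`, and `h'`
decays like `1 / (1 + r)`. Hardy's inequality therefore absorbs the terms in which a derivative
falls on `h` or `1 / h`, and the form is comparable to `‖∇ u‖²` with no lower order term
(`exists_formMap_bounds`). Lax-Milgram gives the resolvent `R = (1 + P₁)⁻¹`. Integration by parts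
(`inner_P1Expr`) and density of test functions show that its graph is that of the distributional
operator (`isGraphResolvent_P1`), and self-adjointness follows.

For (ii), `(f_ε(A) x, x)` is the minimum of a functional in which the form of `A` enters
monotonically. Hence comparable forms give comparable operators `f_ε(P₁)` and `f_ε(-Δ)`, uniformly
in `ε`. The Löwner-Heinz inequality carries this to the powers `0 ≤ s ≤ 1`, and inversion to `-1 ≤ s
≤ 0`. As `ε → 0`, dominated convergence in a spectral measure shows that bounded regularizations
converge; for `-Δ` the Fourier transform identifies the limit with the homogeneous Sobolev norm.

For (i), cut `v` at the scales `2 ^ k`. The part near the shell `j` is controlled by `‖A ^ (1/2) u‖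
≤ ‖S ∇ (h u)‖`. For the far part, write `A ^ (1/2) = (2 / π) ∫ (1 - t² (t² + A)⁻¹) dt`. Away from
the support of `w` the `1` drops out. An iterated Caccioppoli estimate bounds the energy of `(t² +
A)⁻¹ w` at distance `ρ` with a factor `(1 + (ρ t)²)⁻¹`, and Hardy's inequality on a ball of radius
`r` gains a factor `r`. Integration in `t` gives off-diagonal decay `r / ρ²`
(`exists_norm_rmul_half_le`). A dyadic piece of `v` at scale `2 ^ k` has size `2 ^ (3k/2)`, so its
contribution is `2 ^ j * 2 ^ (-2k) * 2 ^ (3k/2) = 2 ^ j * 2 ^ (-k/2)`. Summed over `k > j` this is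
of order `2 ^ (j/2)`, as required by the weight. -/

noncomputable section

set_option linter.unusedSectionVars false

section Abstract

variable {H V K : Type*} [NormedAddCommGroup H] [InnerProductSpace ℂ H] [CompleteSpace H]
  [NormedAddCommGroup V] [InnerProductSpace ℂ V] [CompleteSpace V]
  [NormedAddCommGroup K] [InnerProductSpace ℂ K] [CompleteSpace K]

/-! ### Self-adjoint operators from their resolvent -/

/-- `R = (1 + A)⁻¹` on the level of graphs. -/
def IsGraphResolvent (A : H →ₗ.[ℂ] H) (R : H →L[ℂ] H) : Prop :=
  ∀ u f : H, (u, f) ∈ A.graph ↔ R (u + f) = u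

theorem IsGraphResolvent.isResolventNegOne {A : H →ₗ.[ℂ] H} {R : H →L[ℂ] H}
    (h : IsGraphResolvent A R) : IsResolventNegOne A R := by
  constructor
  · intro x
    have hm : (R x, x - R x) ∈ A.graph := (h _ _).2 (by simp)
    obtain ⟨y, h1, h2⟩ := (LinearPMap.mem_graph_iff A).1 hm
    have hy : R x ∈ A.domain := (show (y : H) = R x from h1) ▸ y.2
    refine ⟨hy, ?_⟩
    have : (⟨R x, hy⟩ : A.domain) = y := Subtype.ext h1.symm
    rw [this, h2]; simp
  · intro u
    exact (h _ _).1 (A.mem_graph u)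

/-- An inverse of `1 + A` is unique, so the choice made in `resolventNegOne` is immaterial, and
every regularized power becomes a continuous function of the concrete operator `R`. -/
theorem IsGraphResolvent.resolventNegOne_eq {A : H →ₗ.[ℂ] H} {R : H →L[ℂ] H}
    (h : IsGraphResolvent A R) : resolventNegOne A = R := by
  have hex : ∃ R : H →L[ℂ] H, IsResolventNegOne A R := ⟨R, h.isResolventNegOne⟩
  have h' : IsResolventNegOne A (resolventNegOne A) := by
    rw [resolventNegOne, dif_pos hex]; exact hex.choose_spec
  ext x
  obtain ⟨hx, e⟩ := h'.1 x
  have := h.isResolventNegOne.2 ⟨_, hx⟩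
  rw [e] at this
  exact this.symm

/-- The domain is the range of `R`, and `A` acts on it as `R⁻¹ - 1`, so `A` inherits symmetry from
`R`. Surjectivity of `1 + A` leaves no room for a larger adjoint. -/
theorem IsGraphResolvent.isSelfAdjoint {A : H →ₗ.[ℂ] H} {R : H →L[ℂ] H}
    (h : IsGraphResolvent A R) (hR : IsSelfAdjoint R) (hd : DenseRange R) : IsSelfAdjoint A := by
  have hsym : ∀ x y, inner ℂ (R x) y = inner ℂ x (R y) :=
    fun x y => (ContinuousLinearMap.isSelfAdjoint_iff_isSymmetric.1 hR) x y
  have hres := h.isResolventNegOne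
  have hdom : (A.domain : Set H) = Set.range R := by
    ext u; constructor
    · intro hu; exact ⟨_, hres.2 ⟨u, hu⟩⟩
    · rintro ⟨x, rfl⟩; exact (hres.1 x).1
  have hdense : Dense (A.domain : Set H) := by rw [hdom]; exact hd
  have hA : ∀ x : H, ∀ hx : R x ∈ A.domain, A ⟨R x, hx⟩ = x - R x := by
    intro x hx
    obtain ⟨hx', e⟩ := hres.1 x
    rw [eq_sub_iff_add_eq, add_comm]; exact e
  have hformal : A.IsFormalAdjoint A := by
    intro u v
    obtain ⟨x, hx⟩ : (u : H) ∈ Set.range R := hdom ▸ u.2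
    obtain ⟨y, hy⟩ : (v : H) ∈ Set.range R := hdom ▸ v.2
    have hu : A u = x - R x := by
      rw [← hA x (hx ▸ u.2)]; congr 1; exact Subtype.ext hx.symm
    have hv : A v = y - R y := by
      rw [← hA y (hy ▸ v.2)]; congr 1; exact Subtype.ext hy.symm
    rw [hu, hv, ← hx, ← hy, inner_sub_left, inner_sub_right, hsym x y, hsym x (R y)]
  rw [LinearPMap.isSelfAdjoint_def]
  refine le_antisymm ?_ (hformal.le_adjoint hdense)
  -- Pairing `y` with `x = (1 + A) R x` gives `R (y + A* y) = y`, the equation that characterizes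
  -- the graph of `A`.
  have key : ∀ y : (A.adjoint).domain, ((y : H), A.adjoint y) ∈ A.graph := by
    intro y
    rw [h]
    refine ext_inner_left ℂ fun x => ?_
    obtain ⟨hx, e⟩ := hres.1 x
    have h1 := A.adjoint_isFormalAdjoint hdense y ⟨R x, hx⟩
    rw [← hsym, inner_add_right, ← inner_conj_symm (R x) (A.adjoint y), h1, inner_conj_symm,
      ← inner_add_left, e]
  exact LinearPMap.le_of_le_graph fun p hp => by
    obtain ⟨y, h1, h2⟩ := (LinearPMap.mem_graph_iff _).1 hp
    have := key y
    rw [h1, h2] at this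
    exact this

/-! ### Resolvents of forms -/

/-- `R = (1 + L* L)⁻¹` in the weak form, where `L` is the operator `ι v ↦ ℓ v`. -/
def IsFormResolvent (ι : V →L[ℂ] H) (ℓ : V →L[ℂ] K) (R : H →L[ℂ] H) : Prop :=
  ∀ x, ∃ v, ι v = R x ∧ ∀ w, inner ℂ (ι w) (ι v) + inner ℂ (ℓ w) (ℓ v) = inner ℂ (ι w) x

/-- Lax-Milgram: `Q = ι* ι + ℓ* ℓ` is coercive, hence invertible, and `R = ι Q⁻¹ ι*`. -/
theorem exists_isFormResolvent (ι : V →L[ℂ] H) (ℓ : V →L[ℂ] K) {c : ℝ} (hc : 0 < c)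
    (h : ∀ v, c * ‖v‖ ^ 2 ≤ ‖ι v‖ ^ 2 + ‖ℓ v‖ ^ 2) : ∃ R, IsFormResolvent ι ℓ R := by
  set Q : V →L[ℂ] V := ι.adjoint ∘L ι + ℓ.adjoint ∘L ℓ with hQ
  have hin : ∀ w v, inner ℂ w (Q v) = inner ℂ (ι w) (ι v) + inner ℂ (ℓ w) (ℓ v) := by
    intro w v
    simp [hQ, ContinuousLinearMap.adjoint_inner_right]
  have hu : IsUnit Q := by
    refine ContinuousLinearMap.isUnit_of_forall_le_norm_inner_map Q (c := ⟨c, hc.le⟩) hc fun v => ?_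
    have h1 : inner ℂ v (Q v) = ((‖ι v‖ ^ 2 + ‖ℓ v‖ ^ 2 : ℝ) : ℂ) := by
      rw [hin, inner_self_eq_norm_sq_to_K, inner_self_eq_norm_sq_to_K]; push_cast; rfl
    rw [← norm_inner_symm, h1, Complex.norm_real, Real.norm_of_nonneg (by positivity)]
    have := h v
    change ‖v‖ ^ 2 * c ≤ _
    linarith
  obtain ⟨q, hq⟩ := hu
  refine ⟨ι ∘L (↑q⁻¹ : V →L[ℂ] V) ∘L ι.adjoint, fun x => ⟨(↑q⁻¹ : V →L[ℂ] V) (ι.adjoint x), rfl, ?_⟩⟩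
  intro w
  rw [← hin]
  have : Q ((↑q⁻¹ : V →L[ℂ] V) (ι.adjoint x)) = ι.adjoint x := by
    rw [← hq]
    have := q.mul_inv
    exact congrArg (fun T : V →L[ℂ] V => T (ι.adjoint x)) this
  rw [this, ContinuousLinearMap.adjoint_inner_right]

namespace IsFormResolvent

variable {ι : V →L[ℂ] H} {ℓ : V →L[ℂ] K} {R : H →L[ℂ] H}

theorem isSelfAdjoint (h : IsFormResolvent ι ℓ R) : IsSelfAdjoint R := by
  refine ContinuousLinearMap.isSelfAdjoint_iff_isSymmetric.2 fun x y => ?_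
  obtain ⟨v, hv, h1⟩ := h x
  obtain ⟨w, hw, h2⟩ := h y
  change inner ℂ (R x) y = inner ℂ x (R y)
  rw [← hv, ← h2, ← inner_conj_symm x, ← hw, ← h1, map_add, inner_conj_symm, inner_conj_symm]

/-- Testing with the solution itself gives the energy identity behind positivity and contractivity
of `R`. -/
theorem re_inner (h : IsFormResolvent ι ℓ R) (x : H) :
    ∃ v, ι v = R x ∧ (inner ℂ (R x) x).re = ‖ι v‖ ^ 2 + ‖ℓ v‖ ^ 2 := by
  obtain ⟨v, hv, h1⟩ := h x
  refine ⟨v, hv, ?_⟩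
  rw [← hv, ← h1, inner_self_eq_norm_sq_to_K, inner_self_eq_norm_sq_to_K]
  norm_cast

theorem nonneg (h : IsFormResolvent ι ℓ R) : 0 ≤ R := by
  rw [ContinuousLinearMap.nonneg_iff_isPositive, ContinuousLinearMap.isPositive_def']
  refine ⟨h.isSelfAdjoint, fun x => ?_⟩
  obtain ⟨v, hv, h1⟩ := h.re_inner x
  change 0 ≤ (inner ℂ (R x) x).re
  rw [h1]; positivity

theorem norm_le (h : IsFormResolvent ι ℓ R) (x : H) : ‖R x‖ ≤ ‖x‖ := by
  obtain ⟨v, hv, h1⟩ := h.re_inner x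
  have h2 : (inner ℂ (R x) x).re ≤ ‖R x‖ * ‖x‖ := re_inner_le_norm (𝕜 := ℂ) _ _
  rw [hv] at h1
  rcases eq_or_lt_of_le (norm_nonneg (R x)) with h0 | h0
  · rw [← h0]; positivity
  · have : ‖R x‖ * ‖R x‖ ≤ ‖R x‖ * ‖x‖ := by nlinarith [sq_nonneg ‖ℓ v‖]
    exact le_of_mul_le_mul_left this h0

theorem le_one (h : IsFormResolvent ι ℓ R) : R ≤ 1 := by
  rw [ContinuousLinearMap.le_def, ContinuousLinearMap.isPositive_def']
  refine ⟨(IsSelfAdjoint.one _).sub h.isSelfAdjoint, fun x => ?_⟩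
  change 0 ≤ (inner ℂ (x - R x) x).re
  rw [inner_sub_left, Complex.sub_re]
  have h2 : (inner ℂ (R x) x).re ≤ ‖R x‖ * ‖x‖ := re_inner_le_norm (𝕜 := ℂ) _ _
  have h3 : (inner ℂ x x).re = ‖x‖ ^ 2 := inner_self_eq_norm_sq (𝕜 := ℂ) x
  nlinarith [h.norm_le x, norm_nonneg x]

theorem spectrum_subset (h : IsFormResolvent ι ℓ R) : spectrum ℝ R ⊆ Set.Icc 0 1 := by
  intro x hx
  refine ⟨spectrum_nonneg_of_nonneg h.nonneg hx, ?_⟩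
  have := (cfc_le_iff (fun x : ℝ => x) (fun _ => (1 : ℝ)) R continuousOn_id continuousOn_const
    h.isSelfAdjoint).1 (by
      rw [cfc_id' ℝ R h.isSelfAdjoint, cfc_const_one ℝ R h.isSelfAdjoint]; exact h.le_one)
  exact this x hx

/-- If `R x = 0`, testing with the solution `v` gives `ℓ v = 0`, so `x` is orthogonal to the dense
range of `ι`. -/
theorem injective (h : IsFormResolvent ι ℓ R) (hι : DenseRange ι) : Function.Injective R := by
  rw [injective_iff_map_eq_zero]
  intro x hx
  obtain ⟨v, hv, h1⟩ := h x
  have hv0 : ‖ι v‖ ^ 2 + ‖ℓ v‖ ^ 2 = 0 := by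
    have h2 := h1 v
    rw [hv, hx, inner_zero_left, inner_zero_left, zero_add, inner_self_eq_norm_sq_to_K] at h2
    have : ‖ℓ v‖ ^ 2 = 0 := Complex.ofReal_injective (by push_cast; exact h2)
    rw [this, hv, hx]; simp
  have hl : ℓ v = 0 := by
    rw [← norm_eq_zero]; nlinarith [sq_nonneg ‖ι v‖, sq_nonneg ‖ℓ v‖]
  refine hι.eq_zero_of_inner_right ℂ fun w => ?_
  rw [← h1 w, hv, hx, hl]; simp

end IsFormResolvent

/-- The orthogonal complement of the range of a self-adjoint operator is its kernel. -/
theorem denseRange_of_injective {R : H →L[ℂ] H} (hR : IsSelfAdjoint R)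
    (hi : Function.Injective R) : DenseRange R := by
  have : (LinearMap.range R.toLinearMap).topologicalClosure = ⊤ := by
    rw [Submodule.topologicalClosure_eq_top_iff, Submodule.eq_bot_iff]
    intro x hx
    apply hi
    rw [map_zero]
    refine ext_inner_left ℂ fun y => ?_
    rw [inner_zero_right]
    exact ((ContinuousLinearMap.isSelfAdjoint_iff_isSymmetric.1 hR) y x).symm.trans (hx _ ⟨y, rfl⟩)
  have h2 := Submodule.dense_iff_topologicalClosure_eq_top.2 this
  exact h2

end Abstract

section Regularization

variable {H V K K' : Type*} [NormedAddCommGroup H] [InnerProductSpace ℂ H] [CompleteSpace H]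
  [NormedAddCommGroup V] [InnerProductSpace ℂ V] [CompleteSpace V]
  [NormedAddCommGroup K] [InnerProductSpace ℂ K] [CompleteSpace K]
  [NormedAddCommGroup K'] [InnerProductSpace ℂ K'] [CompleteSpace K']

/-! ### Regularized powers -/

/-- The function `f_ε ^ α` in terms of the resolvent variable. -/
def regFun (α ε x : ℝ) : ℝ := ((1 - x + ε) / (x + ε)) ^ α

theorem regFun_base_pos {ε x : ℝ} (hε : 0 < ε) (hx : x ∈ Set.Icc (0 : ℝ) 1) :
    0 < (1 - x + ε) / (x + ε) :=
  div_pos (by linarith [hx.2]) (by linarith [hx.1])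

theorem continuousOn_regFun (α : ℝ) {ε : ℝ} (hε : 0 < ε) :
    ContinuousOn (regFun α ε) (Set.Icc 0 1) := by
  unfold regFun
  refine ContinuousOn.rpow_const (ContinuousOn.div (by fun_prop) (by fun_prop) fun x hx => ?_)
    fun x hx => Or.inl (regFun_base_pos hε hx).ne'
  linarith [hx.1]

theorem regFun_pos {α ε x : ℝ} (hε : 0 < ε) (hx : x ∈ Set.Icc (0 : ℝ) 1) : 0 < regFun α ε x :=
  Real.rpow_pos_of_pos (regFun_base_pos hε hx) _

theorem IsSelfAdjoint.inner_apply {T : H →L[ℂ] H} (hT : IsSelfAdjoint T) (x y : H) :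
    inner ℂ (T x) y = inner ℂ x (T y) :=
  ContinuousLinearMap.isSelfAdjoint_iff_isSymmetric.1 hT x y

theorem re_inner_real_smul_left (c : ℝ) (x y : H) :
    (inner ℂ (c • x) y).re = c * (inner ℂ x y).re := by
  rw [← Complex.coe_smul, inner_smul_left]; simp

theorem norm_cfc_apply_sq {R : H →L[ℂ] H} (hR : IsSelfAdjoint R) {f : ℝ → ℝ}
    (hf : ContinuousOn f (spectrum ℝ R)) (u : H) :
    ‖cfc f R u‖ ^ 2 = (inner ℂ (cfc (fun x => f x ^ 2) R u) u).re := by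
  have h1 : cfc (fun x => f x ^ 2) R = cfc f R * cfc f R := by
    rw [← cfc_mul f f R hf hf]; simp only [sq]
  have h2 : IsSelfAdjoint (cfc f R) := cfc_predicate f R
  rw [h1]
  change _ = (inner ℂ (cfc f R (cfc f R u)) u).re
  rw [h2.inner_apply]
  exact (inner_self_eq_norm_sq (𝕜 := ℂ) _).symm

/-- Positivity of `regFun` on `[0, 1]` lets exponents multiply. This turns the exponent of the
scalar function into an operator power, to which Löwner-Heinz applies. -/
theorem cfc_regFun_rpow {R : H →L[ℂ] H} (hR : IsSelfAdjoint R)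
    (hs : spectrum ℝ R ⊆ Set.Icc 0 1) (α p : ℝ) {ε c : ℝ} (hε : 0 < ε) (hc : 0 < c) :
    (c • cfc (regFun α ε) R) ^ p = c ^ p • cfc (regFun (α * p) ε) R := by
  have hcont : ∀ α, ContinuousOn (regFun α ε) (spectrum ℝ R) :=
    fun α => (continuousOn_regFun α hε).mono hs
  rw [← cfc_const_mul c _ R (hcont α), CFC.cfc_rpow, ← cfc_const_mul _ _ R (hcont (α * p))]
  · refine cfc_congr fun x hx => ?_
    have hx := hs hx
    rw [Real.mul_rpow hc.le (regFun_pos hε hx).le]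
    congr 1
    rw [regFun, regFun, Real.rpow_mul (regFun_base_pos hε hx).le]
  · intro x hx
    exact (mul_pos hc (regFun_pos hε (hs hx)))

theorem isStrictlyPositive_cfc_regFun {R : H →L[ℂ] H} (hR : IsSelfAdjoint R)
    (hs : spectrum ℝ R ⊆ Set.Icc 0 1) (α : ℝ) {ε : ℝ} (hε : 0 < ε) :
    IsStrictlyPositive (cfc (regFun α ε) R) := by
  have hcont : ContinuousOn (regFun α ε) (spectrum ℝ R) := (continuousOn_regFun α hε).mono hs
  refine IsStrictlyPositive.iff_of_unital.2 ⟨cfc_nonneg fun x hx => (regFun_pos hε (hs hx)).le, ?_⟩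
  exact (isUnit_cfc_iff (regFun α ε) R hcont hR).2 fun x hx => (regFun_pos hε (hs hx)).ne'

/-- For `s ≥ 0` this is Löwner-Heinz: `t ↦ t ^ s` is operator monotone for `0 ≤ s ≤ 1`. For `s ≤ 0`
the inverses are compared instead; since inversion reverses order, that case starts from `h'`. -/
theorem cfc_regFun_le_of_le {R R' : H →L[ℂ] H} (hR : IsSelfAdjoint R)
    (hs : spectrum ℝ R ⊆ Set.Icc 0 1) (hR' : IsSelfAdjoint R') (hs' : spectrum ℝ R' ⊆ Set.Icc 0 1)
    {ε C : ℝ} (hε : 0 < ε) (hC : 1 ≤ C)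
    (h : cfc (regFun 1 ε) R ≤ C • cfc (regFun 1 ε) R')
    (h' : cfc (regFun 1 ε) R' ≤ C • cfc (regFun 1 ε) R) {s : ℝ} (hs1 : -1 ≤ s) (hs2 : s ≤ 1) :
    cfc (regFun s ε) R ≤ C ^ |s| • cfc (regFun s ε) R' := by
  have hC0 : 0 < C := by linarith
  rcases le_total 0 s with h0 | h0
  · have := CFC.rpow_le_rpow (p := s) ⟨h0, hs2⟩ h
    rw [cfc_regFun_rpow hR' hs' 1 s hε hC0] at this
    have e := cfc_regFun_rpow hR hs 1 s hε one_pos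
    rw [one_smul] at e
    rw [e] at this
    simpa [abs_of_nonneg h0] using this
  · have h1 := CStarAlgebra.rpow_neg_one_le_rpow_neg_one h'
      (isStrictlyPositive_cfc_regFun hR' hs' 1 hε)
    rw [cfc_regFun_rpow hR hs 1 (-1) hε hC0] at h1
    have e := cfc_regFun_rpow hR' hs' 1 (-1) hε one_pos
    rw [one_smul] at e
    rw [e] at h1
    simp only [one_mul, Real.one_rpow, one_smul] at h1
    have h2 : cfc (regFun (-1) ε) R ≤ C • cfc (regFun (-1) ε) R' := by
      have := smul_le_smul_of_nonneg_left h1 hC0.le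
      rwa [smul_smul, Real.rpow_neg_one, mul_inv_cancel₀ hC0.ne', one_smul] at this
    have := CFC.rpow_le_rpow (p := -s) ⟨by linarith, by linarith⟩ h2
    rw [cfc_regFun_rpow hR' hs' (-1) (-s) hε hC0] at this
    have e := cfc_regFun_rpow hR hs (-1) (-s) hε one_pos
    rw [one_smul] at e
    rw [e] at this
    simpa [abs_of_nonpos h0] using this

/-- The squared norm with exponent `s / 2` is the quadratic form with exponent `s`, so Löwner-Heinz
covers exactly the range needed. Weakening `C ^ |s|` to `C ^ 2` makes the constant uniform in `s`.
-/
theorem norm_cfc_regFun_le_of_le {R R' : H →L[ℂ] H} (hR : IsSelfAdjoint R)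
    (hs : spectrum ℝ R ⊆ Set.Icc 0 1) (hR' : IsSelfAdjoint R') (hs' : spectrum ℝ R' ⊆ Set.Icc 0 1)
    {ε C : ℝ} (hε : 0 < ε) (hC : 1 ≤ C)
    (h : cfc (regFun 1 ε) R ≤ C • cfc (regFun 1 ε) R')
    (h' : cfc (regFun 1 ε) R' ≤ C • cfc (regFun 1 ε) R) {s : ℝ} (hs1 : -1 ≤ s) (hs2 : s ≤ 1)
    (u : H) : ‖cfc (regFun (s / 2) ε) R u‖ ≤ C * ‖cfc (regFun (s / 2) ε) R' u‖ := by
  have hsq : ∀ T : H →L[ℂ] H, IsSelfAdjoint T → spectrum ℝ T ⊆ Set.Icc 0 1 →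
      ‖cfc (regFun (s / 2) ε) T u‖ ^ 2 = (inner ℂ (cfc (regFun s ε) T u) u).re := by
    intro T hT hTs
    rw [norm_cfc_apply_sq hT ((continuousOn_regFun _ hε).mono hTs)]
    suffices e : cfc (fun x => regFun (s / 2) ε x ^ 2) T = cfc (regFun s ε) T by rw [e]
    refine cfc_congr fun x hx => ?_
    simp only [regFun]
    rw [← Real.rpow_natCast, ← Real.rpow_mul (regFun_base_pos hε (hTs hx)).le]
    congr 1; push_cast; ring
  have h1 := cfc_regFun_le_of_le hR hs hR' hs' hε hC h h' hs1 hs2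
  rw [ContinuousLinearMap.le_def] at h1
  have h2 := h1.re_inner_nonneg_left u
  have h3 : 0 ≤ C ^ |s| * ‖cfc (regFun (s / 2) ε) R' u‖ ^ 2 - ‖cfc (regFun (s / 2) ε) R u‖ ^ 2 := by
    rw [hsq R hR hs, hsq R' hR' hs']
    have : RCLike.re (inner ℂ ((C ^ |s| • cfc (regFun s ε) R' - cfc (regFun s ε) R) u) u) =
        C ^ |s| * (inner ℂ (cfc (regFun s ε) R' u) u).re - (inner ℂ (cfc (regFun s ε) R u) u).re := by
      simp
    rw [← this]; exact h2
  have h4 : C ^ |s| ≤ C ^ 2 := by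
    rw [← Real.rpow_natCast C 2]
    refine Real.rpow_le_rpow_of_exponent_le hC ?_
    have := abs_le.2 ⟨hs1, hs2⟩
    push_cast; linarith
  refine abs_le_of_sq_le_sq' ?_ (by positivity) |>.2
  nlinarith [sq_nonneg ‖cfc (regFun (s / 2) ε) R' u‖]

namespace IsFormResolvent

variable {ι : V →L[ℂ] H} {ℓ : V →L[ℂ] K} {ℓ' : V →L[ℂ] K'} {R R' : H →L[ℂ] H}

/-- Here `y = (R + ε)⁻¹ x`, and the identity comes from `(1 - t + ε) / (t + ε) = (1 + 2 ε) / (t + ε)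
- 1`. -/
theorem exists_shifted_inverse (h : IsFormResolvent ι ℓ R) {ε : ℝ} (hε : 0 < ε) (x : H) :
    ∃ y, R y + (ε : ℂ) • y = x ∧
      (inner ℂ (cfc (regFun 1 ε) R x) x).re = (1 + 2 * ε) * (inner ℂ y x).re - ‖x‖ ^ 2 := by
  set S := cfc (fun t : ℝ => (t + ε)⁻¹) R with hS
  have hsp := h.spectrum_subset
  have hne : ∀ t ∈ spectrum ℝ R, t + ε ≠ 0 := fun t ht => by linarith [(hsp ht).1]
  have hc1 : ContinuousOn (fun t : ℝ => (t + ε)⁻¹) (spectrum ℝ R) :=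
    ContinuousOn.inv₀ (by fun_prop) hne
  have e1 : (R + (ε : ℂ) • 1) * S = 1 := by
    have : R + (ε : ℂ) • 1 = cfc (fun t : ℝ => t + ε) R := by
      rw [cfc_add_const ε (fun t => t) R continuousOn_id h.isSelfAdjoint, cfc_id' ℝ R h.isSelfAdjoint,
        Algebra.algebraMap_eq_smul_one]
      rfl
    rw [this, hS, ← cfc_mul _ _ R (by fun_prop) hc1, ← cfc_const_one ℝ R h.isSelfAdjoint]
    exact cfc_congr fun t ht => mul_inv_cancel₀ (hne t ht)
  have e2 : cfc (regFun 1 ε) R = (1 + 2 * ε) • S - 1 := by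
    rw [hS, ← cfc_const_mul _ _ R hc1, ← cfc_const_one ℝ R h.isSelfAdjoint,
      ← cfc_sub _ _ R (hc1.const_mul _) continuousOn_const]
    refine cfc_congr fun t ht => ?_
    simp only [regFun, Real.rpow_one]
    field_simp [hne t ht]
    ring
  refine ⟨S x, ?_, ?_⟩
  · exact congrArg (fun T : H →L[ℂ] H => T x) e1
  · rw [e2]
    have : (inner ℂ x x).re = ‖x‖ ^ 2 := inner_self_eq_norm_sq (𝕜 := ℂ) x
    change (inner ℂ ((1 + 2 * ε) • S x - x) x).re = _
    rw [inner_sub_left, Complex.sub_re, re_inner_real_smul_left, this]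

/-- The form of `(R + ε)⁻¹` at `x` is the minimum over `v` of `‖ι v‖² + ‖ℓ v‖² + ε⁻¹ ‖x - ι v‖²`
(the parallel sum of `1 + A` and `ε⁻¹`). This bound and the equality in the next lemma are the two
halves of that formula. It allows operators to be compared through trial vectors of the form domain.
-/
theorem re_inner_cfc_regFun_le (h : IsFormResolvent ι ℓ R) {ε : ℝ} (hε : 0 < ε) (x : H) (v : V) :
    (inner ℂ (cfc (regFun 1 ε) R x) x).re ≤
      (1 + 2 * ε) * (‖ι v‖ ^ 2 + ‖ℓ v‖ ^ 2 + ε⁻¹ * ‖x - ι v‖ ^ 2) - ‖x‖ ^ 2 := by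
  obtain ⟨y, hy, e⟩ := h.exists_shifted_inverse hε x
  rw [e]
  obtain ⟨w, hw, hw2⟩ := h y
  have h1 : (inner ℂ y x).re = ‖ι w‖ ^ 2 + ‖ℓ w‖ ^ 2 + ε * ‖y‖ ^ 2 := by
    have e1 : inner ℂ y (R y) = ((‖ι w‖ ^ 2 + ‖ℓ w‖ ^ 2 : ℝ) : ℂ) := by
      rw [← hw, ← inner_conj_symm, ← hw2 w, inner_self_eq_norm_sq_to_K, inner_self_eq_norm_sq_to_K]
      simp
    rw [← hy, inner_add_right, inner_smul_right, e1, inner_self_eq_norm_sq_to_K]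
    simp [← Complex.ofReal_pow]
  have h2 : (inner ℂ y x).re = (inner ℂ (ι v) (ι w)).re + (inner ℂ (ℓ v) (ℓ w)).re +
      (inner ℂ y (x - ι v)).re := by
    rw [← Complex.add_re, hw2 v, inner_sub_right, Complex.sub_re, ← inner_conj_symm (ι v) y,
      Complex.conj_re]
    ring
  have h3 : (inner ℂ (ι v) (ι w)).re ≤ ‖ι v‖ * ‖ι w‖ := re_inner_le_norm (𝕜 := ℂ) _ _
  have h4 : (inner ℂ (ℓ v) (ℓ w)).re ≤ ‖ℓ v‖ * ‖ℓ w‖ := re_inner_le_norm (𝕜 := ℂ) _ _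
  have h5 : (inner ℂ y (x - ι v)).re ≤ ‖y‖ * ‖x - ι v‖ := re_inner_le_norm (𝕜 := ℂ) _ _
  have h6 : 2 * (‖y‖ * ‖x - ι v‖) ≤ ε * ‖y‖ ^ 2 + ε⁻¹ * ‖x - ι v‖ ^ 2 := by
    have : 0 ≤ ε⁻¹ * (ε * ‖y‖ - ‖x - ι v‖) ^ 2 := by positivity
    have e3 : ε⁻¹ * (ε * ‖y‖ - ‖x - ι v‖) ^ 2 =
        ε * ‖y‖ ^ 2 + ε⁻¹ * ‖x - ι v‖ ^ 2 - 2 * (‖y‖ * ‖x - ι v‖) := by field_simp; ring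
    linarith
  -- By `h2` to `h6`, twice the left side is at most the right side plus `‖ι w‖² + ‖ℓ w‖² + ε ‖y‖²`,
  -- which by `h1` is the left side again.
  have h7 : (inner ℂ y x).re ≤ ‖ι v‖ ^ 2 + ‖ℓ v‖ ^ 2 + ε⁻¹ * ‖x - ι v‖ ^ 2 := by
    nlinarith [sq_nonneg (‖ι v‖ - ‖ι w‖), sq_nonneg (‖ℓ v‖ - ‖ℓ w‖)]
  have := mul_le_mul_of_nonneg_left h7 (by positivity : 0 ≤ 1 + 2 * ε)
  linarith

theorem exists_re_inner_cfc_regFun_eq (h : IsFormResolvent ι ℓ R) {ε : ℝ} (hε : 0 < ε) (x : H) :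
    ∃ v, (inner ℂ (cfc (regFun 1 ε) R x) x).re =
      (1 + 2 * ε) * (‖ι v‖ ^ 2 + ‖ℓ v‖ ^ 2 + ε⁻¹ * ‖x - ι v‖ ^ 2) - ‖x‖ ^ 2 := by
  obtain ⟨y, hy, e⟩ := h.exists_shifted_inverse hε x
  obtain ⟨w, hw, hw2⟩ := h y
  refine ⟨w, ?_⟩
  have e1 : inner ℂ y (R y) = ((‖ι w‖ ^ 2 + ‖ℓ w‖ ^ 2 : ℝ) : ℂ) := by
    rw [← hw, ← inner_conj_symm, ← hw2 w, inner_self_eq_norm_sq_to_K, inner_self_eq_norm_sq_to_K]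
    simp
  have h1 : (inner ℂ y x).re = ‖ι w‖ ^ 2 + ‖ℓ w‖ ^ 2 + ε * ‖y‖ ^ 2 := by
    conv_lhs => rw [← hy]
    rw [inner_add_right, inner_smul_right, e1, inner_self_eq_norm_sq_to_K]
    simp [← Complex.ofReal_pow]
  have h2 : x - ι w = (ε : ℂ) • y := by rw [hw, ← hy]; abel
  rw [e, h1, h2, norm_smul]
  simp only [Complex.norm_real, Real.norm_of_nonneg hε.le]
  field_simp

/-- The minimizer for `R'` serves as trial vector for `R`. Only `‖ℓ v‖²` needs the factor `C`; for
the other terms it costs `C - 1` times a quantity that `hx` shows to be nonnegative. -/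
theorem cfc_regFun_le (h : IsFormResolvent ι ℓ R) (h' : IsFormResolvent ι ℓ' R') {C : ℝ}
    (hC : 1 ≤ C) (hle : ∀ v, ‖ℓ v‖ ^ 2 ≤ C * ‖ℓ' v‖ ^ 2) {ε : ℝ} (hε : 0 < ε) :
    cfc (regFun 1 ε) R ≤ C • cfc (regFun 1 ε) R' := by
  rw [ContinuousLinearMap.le_def, ContinuousLinearMap.isPositive_def']
  refine ⟨((IsSelfAdjoint.all C).smul (cfc_predicate _ R' : IsSelfAdjoint _)).sub (cfc_predicate _ R),
    fun x => ?_⟩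
  have e0 : (C • cfc (regFun 1 ε) R' - cfc (regFun 1 ε) R).reApplyInnerSelf x =
      C * (inner ℂ (cfc (regFun 1 ε) R' x) x).re - (inner ℂ (cfc (regFun 1 ε) R x) x).re := by
    simp [ContinuousLinearMap.reApplyInnerSelf, inner_sub_left, re_inner_real_smul_left]
  rw [e0]
  obtain ⟨v, hv⟩ := h'.exists_re_inner_cfc_regFun_eq hε x
  have h1 := h.re_inner_cfc_regFun_le hε x v
  rw [hv]
  -- This is `(a + b)² ≤ (1 + ε) a² + (1 + ε⁻¹) b²`, somewhat weakened.
  have hx : ‖x‖ ^ 2 ≤ (1 + 2 * ε) * (‖ι v‖ ^ 2 + ε⁻¹ * ‖x - ι v‖ ^ 2) := by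
    have ht : ‖x‖ ≤ ‖ι v‖ + ‖x - ι v‖ := by
      calc ‖x‖ = ‖ι v + (x - ι v)‖ := by congr 1; abel
        _ ≤ _ := norm_add_le _ _
    have h2 : ‖x‖ ^ 2 ≤ (‖ι v‖ + ‖x - ι v‖) ^ 2 := by gcongr
    have h3 : 0 ≤ ε⁻¹ * (ε * ‖ι v‖ - ‖x - ι v‖) ^ 2 := by positivity
    have e3 : ε⁻¹ * (ε * ‖ι v‖ - ‖x - ι v‖) ^ 2 =
        ε * ‖ι v‖ ^ 2 + ε⁻¹ * ‖x - ι v‖ ^ 2 - 2 * (‖ι v‖ * ‖x - ι v‖) := by field_simp; ring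
    have e4 : 2 * ε * (ε⁻¹ * ‖x - ι v‖ ^ 2) = 2 * ‖x - ι v‖ ^ 2 := by field_simp
    nlinarith [sq_nonneg ‖x - ι v‖, sq_nonneg ‖ι v‖]
  have h5 := mul_le_mul_of_nonneg_left (hle v) (by positivity : 0 ≤ 1 + 2 * ε)
  have h6 := mul_le_mul_of_nonneg_left hx (by linarith : 0 ≤ C - 1)
  nlinarith

theorem norm_cfc_regFun_le (h : IsFormResolvent ι ℓ R) (h' : IsFormResolvent ι ℓ' R') {C : ℝ}
    (hC : 1 ≤ C) (hle : ∀ v, ‖ℓ v‖ ^ 2 ≤ C * ‖ℓ' v‖ ^ 2) (hge : ∀ v, ‖ℓ' v‖ ^ 2 ≤ C * ‖ℓ v‖ ^ 2)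
    {ε : ℝ} (hε : 0 < ε) {s : ℝ} (hs1 : -1 ≤ s) (hs2 : s ≤ 1) (u : H) :
    ‖cfc (regFun (s / 2) ε) R u‖ ≤ C * ‖cfc (regFun (s / 2) ε) R' u‖ :=
  norm_cfc_regFun_le_of_le h.isSelfAdjoint h.spectrum_subset h'.isSelfAdjoint h'.spectrum_subset hε hC
    (h.cfc_regFun_le h' hC hle hε) (h'.cfc_regFun_le h hC hge hε) hs1 hs2 u

/-- The trial vector is `v` itself, so the penalty `ε⁻¹ ‖x - ι v‖²` vanishes. -/
theorem norm_cfc_regFun_half_sq_le (h : IsFormResolvent ι ℓ R) {ε : ℝ} (hε : 0 < ε) (v : V) :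
    ‖cfc (regFun (1 / 2) ε) R (ι v)‖ ^ 2 ≤ ‖ℓ v‖ ^ 2 + 2 * ε * (‖ι v‖ ^ 2 + ‖ℓ v‖ ^ 2) := by
  have h1 := h.re_inner_cfc_regFun_le hε (ι v) v
  rw [norm_cfc_apply_sq h.isSelfAdjoint ((continuousOn_regFun _ hε).mono h.spectrum_subset)]
  have e : cfc (fun x => regFun (1 / 2) ε x ^ 2) R = cfc (regFun 1 ε) R := by
    refine cfc_congr fun x hx => ?_
    simp only [regFun]
    rw [← Real.rpow_natCast, ← Real.rpow_mul (regFun_base_pos hε (h.spectrum_subset hx)).le]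
    norm_num
  rw [e]
  simp only [sub_self, norm_zero] at h1
  nlinarith

end IsFormResolvent

end Regularization

section SpectralMeasure

variable {H : Type*} [NormedAddCommGroup H] [InnerProductSpace ℂ H] [CompleteSpace H]

/-! ### Spectral measures -/

theorem re_inner_cfc_mono {R : H →L[ℂ] H} {f g : ℝ → ℝ} (hf : ContinuousOn f (spectrum ℝ R))
    (hg : ContinuousOn g (spectrum ℝ R)) (h : ∀ x ∈ spectrum ℝ R, f x ≤ g x) (u : H) :
    (inner ℂ (cfc f R u) u).re ≤ (inner ℂ (cfc g R u) u).re := by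
  have h1 := cfc_mono h hf hg
  rw [ContinuousLinearMap.le_def] at h1
  have h2 := h1.re_inner_nonneg_left u
  rw [sub_apply, inner_sub_left] at h2
  simpa using h2

/-- Riesz-Markov for the positive functional `f ↦ ⟨f(R) u, u⟩` on continuous functions on `[0, 1]`,
which are extended by constants before entering the functional calculus. -/
theorem exists_spectralMeasure {R : H →L[ℂ] H} (hR : IsSelfAdjoint R)
    (hs : spectrum ℝ R ⊆ Set.Icc 0 1) (u : H) :
    ∃ μ : Measure (Set.Icc (0 : ℝ) 1), IsFiniteMeasure μ ∧
      ∀ f : ℝ → ℝ, ContinuousOn f (Set.Icc 0 1) → ‖cfc f R u‖ ^ 2 = ∫ x, f x ^ 2 ∂μ := by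
  let E : CompactlySupportedContinuousMap (Set.Icc (0 : ℝ) 1) ℝ → ℝ → ℝ :=
    fun f => Set.IccExtend zero_le_one f
  have hE : ∀ f, Continuous (E f) := fun f => f.continuous.Icc_extend'
  let Λ : CompactlySupportedContinuousMap (Set.Icc (0 : ℝ) 1) ℝ →ₚ[ℝ] ℝ :=
    { toFun := fun f => (inner ℂ (cfc (E f) R u) u).re
      map_add' := by
        intro f g
        have : E (f + g) = fun x => E f x + E g x := rfl
        rw [this, cfc_add R _ _ (hE f).continuousOn (hE g).continuousOn,
          add_apply, inner_add_left, Complex.add_re]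
      map_smul' := by
        intro c f
        have : E (c • f) = fun x => c • E f x := rfl
        rw [this, cfc_smul _ _ R (hE f).continuousOn]
        exact re_inner_real_smul_left c _ _
      monotone' := by
        intro f g hfg
        exact re_inner_cfc_mono (hE f).continuousOn (hE g).continuousOn (fun x _ => hfg _) u }
  refine ⟨RealRMK.rieszMeasure Λ, inferInstance, fun f hf => ?_⟩
  let F : CompactlySupportedContinuousMap (Set.Icc (0 : ℝ) 1) ℝ :=
    { toFun := fun x => f x ^ 2
      continuous_toFun := (continuousOn_iff_continuous_domRestrict.1 hf).pow 2
      hasCompactSupport' := HasCompactSupport.of_compactSpace _ }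
  have h1 := RealRMK.integral_rieszMeasure Λ F
  refine Eq.trans ?_ h1.symm
  rw [norm_cfc_apply_sq hR (hf.mono hs)]
  change _ = (inner ℂ (cfc (E F) R u) u).re
  have : cfc (fun x => f x ^ 2) R = cfc (E F) R := by
    refine cfc_congr fun x hx => ?_
    change _ = Set.IccExtend zero_le_one (fun y : Set.Icc (0 : ℝ) 1 => f y ^ 2) x
    rw [Set.IccExtend_of_mem _ _ (hs hx)]
  rw [this]

/-- Dominated convergence in the spectral measure. With two families over two filters, one statement
yields both the Cauchy property of a single family and the equality of limits of two different
approximations. -/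
theorem tendsto_cfc_sub {R : H →L[ℂ] H} {u : H} {μ : Measure (Set.Icc (0 : ℝ) 1)}
    (hμ : ∀ f : ℝ → ℝ, ContinuousOn f (Set.Icc 0 1) → ‖cfc f R u‖ ^ 2 = ∫ x, f x ^ 2 ∂μ)
    (hs : spectrum ℝ R ⊆ Set.Icc 0 1)
    {ι κ : Type*} {l : Filter ι} {l' : Filter κ} [l.IsCountablyGenerated] [l'.IsCountablyGenerated]
    {f : ι → ℝ → ℝ} {g : κ → ℝ → ℝ} {G D : Set.Icc (0 : ℝ) 1 → ℝ}
    (hf : ∀ᶠ i in l, ContinuousOn (f i) (Set.Icc 0 1))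
    (hg : ∀ᶠ i in l', ContinuousOn (g i) (Set.Icc 0 1))
    (hD : Integrable (fun x => (2 * D x) ^ 2) μ)
    (hfD : ∀ᶠ i in l, ∀ᵐ x : Set.Icc (0 : ℝ) 1 ∂μ, |f i x| ≤ D x) (hgD : ∀ᶠ i in l', ∀ᵐ x : Set.Icc (0 : ℝ) 1 ∂μ, |g i x| ≤ D x)
    (hfG : ∀ᵐ x : Set.Icc (0 : ℝ) 1 ∂μ, Tendsto (fun i => f i x) l (𝓝 (G x)))
    (hgG : ∀ᵐ x : Set.Icc (0 : ℝ) 1 ∂μ, Tendsto (fun i => g i x) l' (𝓝 (G x))) :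
    Tendsto (fun p : ι × κ => cfc (f p.1) R u - cfc (g p.2) R u) (l ×ˢ l') (𝓝 0) := by
  have h1 : Tendsto (fun p : ι × κ => ∫ x, (f p.1 x - g p.2 x) ^ 2 ∂μ) (l ×ˢ l') (𝓝 0) := by
    have h0 : (0 : ℝ) = ∫ x : Set.Icc (0 : ℝ) 1, (0 : ℝ) ∂μ := by simp
    refine (congrArg (Tendsto _ _) (congrArg 𝓝 h0)).mpr ?_
    refine tendsto_integral_filter_of_dominated_convergence (fun x => (2 * D x) ^ 2) ?_ ?_ hD ?_
    · filter_upwards [hf.prod_mk hg] with p hp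
      exact (((continuousOn_iff_continuous_domRestrict.1 hp.1).sub
        (continuousOn_iff_continuous_domRestrict.1 hp.2)).pow 2).aestronglyMeasurable
    · filter_upwards [hfD.prod_mk hgD] with p hp
      filter_upwards [hp.1, hp.2] with x h1 h2
      rw [Real.norm_of_nonneg (sq_nonneg _), ← sq_abs]
      have : |f p.1 x - g p.2 x| ≤ 2 * D x := (abs_sub _ _).trans (by linarith)
      gcongr
    · filter_upwards [hfG, hgG] with x h1 h2
      have := ((h1.comp tendsto_fst).sub (h2.comp (tendsto_snd (f := l)))).pow 2
      simpa using this
  rw [tendsto_zero_iff_norm_tendsto_zero]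
  have h2 : Tendsto (fun p : ι × κ => √(∫ x, (f p.1 x - g p.2 x) ^ 2 ∂μ)) (l ×ˢ l') (𝓝 0) := by
    simpa using h1.sqrt
  refine h2.congr' ?_
  filter_upwards [hf.prod_mk hg] with p hp
  rw [← sub_apply, ← cfc_sub _ _ R (hp.1.mono hs) (hp.2.mono hs),
    ← Real.sqrt_sq (norm_nonneg _), hμ (fun x => f p.1 x - g p.2 x) (hp.1.sub hp.2)]

/-- The base is a mediant of `(1 - x) / x` and `1`, so it lies between them. The excluded endpoints
are those where the true value of `((1 - x) / x) ^ α` is infinite while the conventions for division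
and powers make it `0`. -/
theorem regFun_le {α ε x : ℝ} (hε : 0 < ε) (hx : x ∈ Set.Icc (0 : ℝ) 1)
    (h0 : 0 < α → x ≠ 0) (h1 : α < 0 → x ≠ 1) : regFun α ε x ≤ 1 + ((1 - x) / x) ^ α := by
  have hb := regFun_base_pos hε hx
  have hl : 0 ≤ (1 - x) / x := div_nonneg (by linarith [hx.2]) hx.1
  have hnn : 0 ≤ ((1 - x) / x) ^ α := Real.rpow_nonneg hl _
  unfold regFun
  rcases le_total 0 α with hα | hα
  · rcases le_total ((1 - x + ε) / (x + ε)) 1 with h | h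
    · have := Real.rpow_le_one hb.le h hα; linarith
    · rcases hα.eq_or_lt with rfl | hα'
      · simp
      have hx0 : 0 < x := lt_of_le_of_ne hx.1 (Ne.symm (h0 hα'))
      rw [one_le_div (by linarith)] at h
      have : (1 - x + ε) / (x + ε) ≤ (1 - x) / x := by
        rw [div_le_div_iff₀ (by linarith) hx0]; nlinarith
      have := Real.rpow_le_rpow hb.le this hα
      linarith
  · rcases le_total 1 ((1 - x + ε) / (x + ε)) with h | h
    · have := Real.rpow_le_one_of_one_le_of_nonpos h hα; linarith
    · rcases hα.eq_or_lt with rfl | hα'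
      · simp
      rw [div_le_one (by linarith [hx.1])] at h
      have hx0 : 0 < x := by linarith [hx.2]
      have hx1 : x < 1 := lt_of_le_of_ne hx.2 (h1 hα')
      have : (1 - x) / x ≤ (1 - x + ε) / (x + ε) := by
        rw [div_le_div_iff₀ hx0 (by linarith)]; nlinarith
      have := Real.rpow_le_rpow_of_nonpos (div_pos (by linarith) hx0) this hα
      linarith

theorem tendsto_regFun {α x : ℝ} (hx : x ∈ Set.Icc (0 : ℝ) 1)
    (h0 : 0 < α → x ≠ 0) (h1 : α < 0 → x ≠ 1) :
    Tendsto (fun ε => regFun α ε x) (𝓝[>] 0) (𝓝 (((1 - x) / x) ^ α)) := by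
  unfold regFun
  -- At `x = 0` the convention `1 / 0 = 0` turns the claimed limit into `0 ^ α`, which for `α < 0`
  -- is `0` and agrees with the true limit.
  rcases eq_or_ne x 0 with rfl | hx0
  · rcases eq_or_ne α 0 with rfl | hα
    · simp
    have hα : α < 0 := lt_of_le_of_ne (not_lt.1 fun h => h0 h rfl) hα
    simp only [sub_zero, zero_add, div_zero, Real.zero_rpow hα.ne]
    have : Tendsto (fun ε : ℝ => ((1 + ε) / ε)) (𝓝[>] 0) atTop := by
      have h2 : Tendsto (fun ε : ℝ => 1 + ε⁻¹) (𝓝[>] 0) atTop :=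
        tendsto_atTop_add_const_left _ _ tendsto_inv_nhdsGT_zero
      refine tendsto_atTop_mono' _ ?_ h2
      filter_upwards [self_mem_nhdsWithin] with ε hε
      have : (0 : ℝ) < ε := hε
      rw [add_div, div_self this.ne', one_div, add_comm]
    have h3 := (tendsto_rpow_neg_atTop (y := -α) (by linarith)).comp this
    simpa [Function.comp_def] using h3
  · have hb : Tendsto (fun ε : ℝ => (1 - x + ε) / (x + ε)) (𝓝[>] 0) (𝓝 ((1 - x) / x)) := by
      have : ContinuousAt (fun ε : ℝ => (1 - x + ε) / (x + ε)) 0 :=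
        ContinuousAt.div (by fun_prop) (by fun_prop) (by simpa using hx0)
      have h2 := this.tendsto
      simp only [add_zero] at h2
      exact h2.mono_left nhdsWithin_le_nhds
    rcases eq_or_ne x 1 with rfl | hx1
    · refine hb.rpow_const ?_
      exact Or.inr (not_lt.1 fun h => h1 h rfl)
    · refine hb.rpow_const (Or.inl ?_)
      exact div_ne_zero (sub_ne_zero.2 hx1.symm) hx0

theorem tendsto_regFun_atTop_of_pos {α : ℝ} (hα : 0 < α) :
    Tendsto (fun ε => regFun α ε 0) (𝓝[>] 0) atTop := by
  have : Tendsto (fun ε : ℝ => ((1 + ε) / ε)) (𝓝[>] 0) atTop := by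
    have h2 : Tendsto (fun ε : ℝ => 1 + ε⁻¹) (𝓝[>] 0) atTop :=
      tendsto_atTop_add_const_left _ _ tendsto_inv_nhdsGT_zero
    refine tendsto_atTop_mono' _ ?_ h2
    filter_upwards [self_mem_nhdsWithin] with ε hε
    have : (0 : ℝ) < ε := hε
    rw [add_div, div_self this.ne', one_div, add_comm]
  simpa [regFun, Function.comp_def] using (tendsto_rpow_atTop hα).comp this

theorem tendsto_regFun_atTop_of_neg {α : ℝ} (hα : α < 0) :
    Tendsto (fun ε => regFun α ε 1) (𝓝[>] 0) atTop := by
  refine (tendsto_regFun_atTop_of_pos (neg_pos.2 hα)).congr' ?_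
  filter_upwards [self_mem_nhdsWithin] with ε hε
  have : (0 : ℝ) < ε := hε
  simp only [regFun, sub_self, zero_add, sub_zero]
  rw [Real.rpow_neg (by positivity), ← Real.inv_rpow (by positivity), inv_div]

/-- An atom at a blow-up point would force the integrals above `μ {c} * f ε c ^ 2`, hence to
infinity. The cases of interest are `x = 0`, that is `l = ∞`, and `x = 1`, that is `l = 0`. -/
theorem measure_singleton_eq_zero_of_tendsto_atTop {μ : Measure (Set.Icc (0 : ℝ) 1)}
    [IsFiniteMeasure μ] {f : ℝ → ℝ → ℝ} {C : ℝ} (c : Set.Icc (0 : ℝ) 1)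
    (hf : ∀ ε > 0, ContinuousOn (f ε) (Set.Icc 0 1))
    (hC : ∀ᶠ ε in 𝓝[>] 0, ∫ x, f ε x ^ 2 ∂μ ≤ C)
    (ht : Tendsto (fun ε => f ε c) (𝓝[>] 0) atTop) : μ {c} = 0 := by
  by_contra hne
  have hpos : 0 < μ.real {c} := by
    rw [measureReal_def]; exact ENNReal.toReal_pos hne (measure_ne_top _ _)
  have ht2 : Tendsto (fun ε => μ.real {c} * f ε c ^ 2) (𝓝[>] 0) atTop :=
    (((tendsto_pow_atTop two_ne_zero).comp ht)).const_mul_atTop hpos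
  obtain ⟨ε, h1, h2, hε⟩ := (hC.and ((ht2.eventually_gt_atTop C).and self_mem_nhdsWithin)).exists
  have hcont : Continuous fun x : Set.Icc (0 : ℝ) 1 => f ε x ^ 2 :=
    (continuousOn_iff_continuous_domRestrict.1 (hf ε hε)).pow 2
  have hint : Integrable (fun x : Set.Icc (0 : ℝ) 1 => f ε x ^ 2) μ := by
    have := (BoundedContinuousFunction.mkOfCompact ⟨_, hcont⟩).integrable μ
    exact this
  have h3 : ∫ x in {c}, f ε x ^ 2 ∂μ ≤ ∫ x, f ε x ^ 2 ∂μ :=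
    setIntegral_le_integral hint (ae_of_all _ fun x => sq_nonneg _)
  rw [integral_singleton, smul_eq_mul] at h3
  linarith

theorem memLp_of_continuousOn_Icc {μ : Measure (Set.Icc (0 : ℝ) 1)} [IsFiniteMeasure μ]
    {f : ℝ → ℝ} (hf : ContinuousOn f (Set.Icc 0 1)) :
    MemLp (fun x : Set.Icc (0 : ℝ) 1 => f x) 2 μ := by
  have hc := continuousOn_iff_continuous_domRestrict.1 hf
  obtain ⟨C, hC⟩ := isCompact_univ.exists_bound_of_continuousOn hc.continuousOn
  exact MemLp.of_bound hc.aestronglyMeasurable C (ae_of_all _ fun x => hC x trivial)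

/-- Fatou's lemma along `ε = 1 / (n + 1)`. The integrand is the dominating function that
`tendsto_cfc_sub` asks for, built from the bound in `regFun_le`. -/
theorem integrable_of_tendsto_regFun {μ : Measure (Set.Icc (0 : ℝ) 1)} [IsFiniteMeasure μ]
    {α C : ℝ}
    (hgood : ∀ᵐ x : Set.Icc (0 : ℝ) 1 ∂μ, (0 < α → (x : ℝ) ≠ 0) ∧ (α < 0 → (x : ℝ) ≠ 1))
    (hC2 : ∀ᶠ ε in 𝓝[>] 0, ∫ x : Set.Icc (0 : ℝ) 1, regFun α ε x ^ 2 ∂μ ≤ C ^ 2) :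
    Integrable (fun x : Set.Icc (0 : ℝ) 1 => (2 * (1 + ((1 - x) / x : ℝ) ^ α)) ^ 2) μ := by
  have hGm : Measurable fun x : Set.Icc (0 : ℝ) 1 => ((1 - x) / x : ℝ) ^ α := by fun_prop
  have hseq : Tendsto (fun n : ℕ => (1 / ((n : ℝ) + 1))) atTop (𝓝[>] 0) := by
    refine tendsto_nhdsWithin_iff.2 ⟨tendsto_one_div_add_atTop_nhds_zero_nat, ?_⟩
    exact Eventually.of_forall fun n => by simp only [Set.mem_Ioi]; positivity
  have hL2 : MemLp (fun x : Set.Icc (0 : ℝ) 1 => ((1 - x) / x : ℝ) ^ α) 2 μ := by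
    refine ⟨hGm.aestronglyMeasurable, ?_⟩
    have hlim : ∀ᵐ x : Set.Icc (0 : ℝ) 1 ∂μ,
        Tendsto (fun n : ℕ => regFun α (1 / ((n : ℝ) + 1)) x) atTop (𝓝 (((1 - x) / x : ℝ) ^ α)) := by
      filter_upwards [hgood] with x hx
      exact (tendsto_regFun x.2 hx.1 hx.2).comp hseq
    have hm : ∀ n : ℕ, MemLp (fun x : Set.Icc (0 : ℝ) 1 => regFun α (1 / ((n : ℝ) + 1)) x) 2 μ :=
      fun n => memLp_of_continuousOn_Icc (continuousOn_regFun α (by positivity))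
    have hfatou := Lp.eLpNorm_lim_le_liminf_eLpNorm (p := 2)
      (fun n => (hm n).aestronglyMeasurable) _ hlim
    refine lt_of_le_of_lt hfatou ?_
    have hb : ∀ᶠ n : ℕ in atTop, eLpNorm (fun x : Set.Icc (0 : ℝ) 1 =>
        regFun α (1 / ((n : ℝ) + 1)) x) 2 μ ≤ ENNReal.ofReal |C| := by
      filter_upwards [hseq.eventually hC2] with n hn
      rw [(hm n).eLpNorm_eq_integral_rpow_norm two_ne_zero ENNReal.ofNat_ne_top]
      refine ENNReal.ofReal_le_ofReal ?_
      simp only [ENNReal.toReal_ofNat, Real.rpow_ofNat, Real.norm_eq_abs, sq_abs]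
      calc _ ≤ (C ^ 2) ^ (2⁻¹ : ℝ) :=
            Real.rpow_le_rpow (integral_nonneg fun x => sq_nonneg _) hn (by norm_num)
        _ = |C| := by rw [← Real.sqrt_sq_eq_abs, Real.sqrt_eq_rpow]; norm_num
    exact lt_of_le_of_lt (liminf_le_of_frequently_le' hb.frequently) ENNReal.ofReal_lt_top
  have h3 : MemLp (fun x : Set.Icc (0 : ℝ) 1 => 2 * (1 + ((1 - x) / x : ℝ) ^ α)) 2 μ :=
    ((memLp_const (1 : ℝ)).add hL2).const_mul 2
  exact h3.integrable_sq

theorem exists_spectralMeasure_of_bounded {R : H →L[ℂ] H} (hR : IsSelfAdjoint R)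
    (hs : spectrum ℝ R ⊆ Set.Icc 0 1) {u : H} {α C : ℝ}
    (hC : ∀ᶠ ε in 𝓝[>] 0, ‖cfc (regFun α ε) R u‖ ≤ C) :
    ∃ μ : Measure (Set.Icc (0 : ℝ) 1), IsFiniteMeasure μ ∧
      (∀ f : ℝ → ℝ, ContinuousOn f (Set.Icc 0 1) → ‖cfc f R u‖ ^ 2 = ∫ x, f x ^ 2 ∂μ) ∧
      (∀ᵐ x : Set.Icc (0 : ℝ) 1 ∂μ, (0 < α → (x : ℝ) ≠ 0) ∧ (α < 0 → (x : ℝ) ≠ 1)) ∧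
      Integrable (fun x : Set.Icc (0 : ℝ) 1 => (2 * (1 + ((1 - x) / x : ℝ) ^ α)) ^ 2) μ := by
  obtain ⟨μ, hfin, hμ⟩ := exists_spectralMeasure hR hs u
  have hcont : ∀ ε > 0, ContinuousOn (regFun α ε) (Set.Icc 0 1) := fun ε hε => continuousOn_regFun α hε
  have hC2 : ∀ᶠ ε in 𝓝[>] 0, ∫ x, regFun α ε x ^ 2 ∂μ ≤ C ^ 2 := by
    filter_upwards [hC, self_mem_nhdsWithin] with ε h1 h2
    rw [← hμ _ (hcont ε h2)]
    gcongr
  have hgood : ∀ᵐ x : Set.Icc (0 : ℝ) 1 ∂μ, (0 < α → (x : ℝ) ≠ 0) ∧ (α < 0 → (x : ℝ) ≠ 1) := by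
    have a1 : ∀ᵐ x : Set.Icc (0 : ℝ) 1 ∂μ, (0 < α → (x : ℝ) ≠ 0) := by
      by_cases hα : 0 < α
      · have := measure_singleton_eq_zero_of_tendsto_atTop (μ := μ) ⟨0, by simp⟩ hcont hC2
          (tendsto_regFun_atTop_of_pos hα)
        filter_upwards [compl_mem_ae_iff.2 this] with x hx _ h
        exact hx (Subtype.ext h)
      · exact ae_of_all _ fun x h => absurd h hα
    have a2 : ∀ᵐ x : Set.Icc (0 : ℝ) 1 ∂μ, (α < 0 → (x : ℝ) ≠ 1) := by
      by_cases hα : α < 0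
      · have := measure_singleton_eq_zero_of_tendsto_atTop (μ := μ) ⟨1, by simp⟩ hcont hC2
          (tendsto_regFun_atTop_of_neg hα)
        filter_upwards [compl_mem_ae_iff.2 this] with x hx _ h
        exact hx (Subtype.ext h)
      · exact ae_of_all _ fun x h => absurd h hα
    filter_upwards [a1, a2] with x h1 h2 using ⟨h1, h2⟩
  refine ⟨μ, hfin, hμ, hgood, ?_⟩
  exact integrable_of_tendsto_regFun hgood hC2

/-- Boundedness alone suffices: it makes the limit function square integrable for the spectral
measure, and dominated convergence then gives the Cauchy property. -/
theorem exists_tendsto_cfc_regFun {R : H →L[ℂ] H} (hR : IsSelfAdjoint R)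
    (hs : spectrum ℝ R ⊆ Set.Icc 0 1) {u : H} {α C : ℝ}
    (hC : ∀ᶠ ε in 𝓝[>] 0, ‖cfc (regFun α ε) R u‖ ≤ C) :
    ∃ w, Tendsto (fun ε => cfc (regFun α ε) R u) (𝓝[>] 0) (𝓝 w) := by
  obtain ⟨μ, hfin, hμ, hgood, hint⟩ := exists_spectralMeasure_of_bounded hR hs hC
  have hc : ∀ᶠ ε in 𝓝[>] 0, ContinuousOn (regFun α ε) (Set.Icc 0 1) := by
    filter_upwards [self_mem_nhdsWithin] with ε hε using continuousOn_regFun α hε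
  have hb : ∀ᶠ ε in 𝓝[>] 0, ∀ᵐ x : Set.Icc (0 : ℝ) 1 ∂μ,
      |regFun α ε x| ≤ 1 + ((1 - x) / x : ℝ) ^ α := by
    filter_upwards [self_mem_nhdsWithin] with ε hε
    filter_upwards [hgood] with x hx
    rw [abs_of_pos (regFun_pos hε x.2)]
    exact regFun_le hε x.2 hx.1 hx.2
  have ht : ∀ᵐ x : Set.Icc (0 : ℝ) 1 ∂μ,
      Tendsto (fun ε => regFun α ε x) (𝓝[>] 0) (𝓝 (((1 - x) / x : ℝ) ^ α)) := by
    filter_upwards [hgood] with x hx using tendsto_regFun x.2 hx.1 hx.2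
  have h1 := tendsto_cfc_sub hμ hs hc hc hint hb hb ht ht
  have h2 : Cauchy (map (fun ε : ℝ => cfc (regFun α ε) R u) (𝓝[>] 0)) := by
    rw [cauchy_map_iff]
    refine ⟨inferInstance, ?_⟩
    rw [uniformity_eq_comap_nhds_zero, tendsto_comap_iff]
    have h3 := h1.neg
    simp only [neg_sub, neg_zero] at h3
    exact h3
  exact CompleteSpace.complete h2

end SpectralMeasure

section SquareRoot

variable {H : Type*} [NormedAddCommGroup H] [InnerProductSpace ℂ H] [CompleteSpace H]

/-! ### The square root as an integral of resolvents -/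

/-- `l / (l + t ^ 2)` in terms of the resolvent variable `x = (1 + l)⁻¹`. -/
def sqrtKernel (t x : ℝ) : ℝ := (1 - x) / (1 - x + t ^ 2 * x)

/-- The truncation `(2 / π) ∫ l / (l + t ^ 2) dt` of the integral for `l ^ (1 / 2)`. -/
def sqrtApprox (n : ℕ) (x : ℝ) : ℝ :=
  2 / Real.pi * ∫ t in Set.Ioc (1 / ((n : ℝ) + 1)) ((n : ℝ) + 1), sqrtKernel t x

theorem sqrtKernel_den_pos {t x : ℝ} (ht : 0 < t) (hx : x ∈ Set.Icc (0 : ℝ) 1) :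
    0 < 1 - x + t ^ 2 * x := by
  rcases eq_or_lt_of_le hx.1 with h | h
  · rw [← h]; norm_num
  · have : 0 < t ^ 2 * x := by positivity
    linarith [hx.2]

theorem sqrtKernel_mem {t x : ℝ} (ht : 0 < t) (hx : x ∈ Set.Icc (0 : ℝ) 1) :
    sqrtKernel t x ∈ Set.Icc (0 : ℝ) 1 := by
  have h := sqrtKernel_den_pos ht hx
  refine ⟨div_nonneg (by linarith [hx.2]) h.le, (div_le_one h).2 ?_⟩
  have : 0 ≤ t ^ 2 * x := mul_nonneg (sq_nonneg _) hx.1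
  linarith

theorem one_div_succ_le (n : ℕ) : 1 / ((n : ℝ) + 1) ≤ (n : ℝ) + 1 := by
  have h : (1 : ℝ) ≤ (n : ℝ) + 1 := by linarith [n.cast_nonneg (α := ℝ)]
  exact ((div_le_one (by positivity)).2 h).trans h

theorem continuousOn_uncurry_sqrtKernel (n : ℕ) {s : Set ℝ} (hs : s ⊆ Set.Icc 0 1) :
    ContinuousOn (Function.uncurry sqrtKernel)
      (Set.Ioc (1 / ((n : ℝ) + 1)) ((n : ℝ) + 1) ×ˢ s) := by
  unfold Function.uncurry sqrtKernel
  refine ContinuousOn.div (by fun_prop) (by fun_prop) fun p hp => ?_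
  have h0 : 0 < p.1 := lt_trans (by positivity) hp.1.1
  exact (sqrtKernel_den_pos h0 (hs hp.2)).ne'

theorem sqrtApprox_one (n : ℕ) : sqrtApprox n 1 = 0 := by
  simp [sqrtApprox, sqrtKernel]

theorem integral_sqrtKernel {l a b : ℝ} (hl : 0 < l) :
    ∫ t in a..b, l / (l + t ^ 2) = √l * (Real.arctan (b / √l) - Real.arctan (a / √l)) := by
  have hs : 0 < √l := Real.sqrt_pos.2 hl
  have hd : ∀ t : ℝ, HasDerivAt (fun t => √l * Real.arctan (t / √l)) (l / (l + t ^ 2)) t := by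
    intro t
    have h1 := (((hasDerivAt_id t).div_const √l).arctan).const_mul √l
    refine HasDerivAt.congr_deriv h1 ?_
    rw [id_eq, div_pow, Real.sq_sqrt hl.le]
    have : l + t ^ 2 ≠ 0 := by positivity
    have : 1 + t ^ 2 / l ≠ 0 := by positivity
    field_simp
  rw [intervalIntegral.integral_eq_sub_of_hasDerivAt (fun t _ => hd t)]
  · ring
  · refine Continuous.intervalIntegrable ?_ _ _
    refine Continuous.div (by fun_prop) (by fun_prop) fun t => ?_
    positivity

theorem sqrtApprox_eq {x : ℝ} (h0 : 0 < x) (h1 : x < 1) (n : ℕ) :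
    sqrtApprox n x = 2 / Real.pi * (√((1 - x) / x) *
      (Real.arctan (((n : ℝ) + 1) / √((1 - x) / x)) -
        Real.arctan (1 / ((n : ℝ) + 1) / √((1 - x) / x)))) := by
  have hl : 0 < (1 - x) / x := div_pos (by linarith) h0
  rw [← integral_sqrtKernel hl, sqrtApprox, intervalIntegral.integral_of_le (one_div_succ_le n)]
  congr 1
  refine setIntegral_congr_fun measurableSet_Ioc fun t ht => ?_
  have ht0 : 0 < t := lt_trans (by positivity) ht.1
  have h2 := sqrtKernel_den_pos ht0 ⟨h0.le, h1.le⟩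
  have h3 : 0 < (1 - x) / x + t ^ 2 := by positivity
  simp only [sqrtKernel]
  rw [div_eq_div_iff h2.ne' h3.ne']
  field_simp

theorem abs_sqrtApprox_le {x : ℝ} (hx : x ∈ Set.Icc (0 : ℝ) 1) (hx0 : x ≠ 0) (n : ℕ) :
    |sqrtApprox n x| ≤ 1 + ((1 - x) / x) ^ (1 / 2 : ℝ) := by
  have hl : 0 ≤ (1 - x) / x := div_nonneg (by linarith [hx.2]) hx.1
  rcases eq_or_lt_of_le hx.2 with rfl | h1
  · rw [sqrtApprox_one]; simp
  have h0 : 0 < x := lt_of_le_of_ne hx.1 hx0.symm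
  rw [sqrtApprox_eq h0 h1, ← Real.sqrt_eq_rpow]
  set s := √((1 - x) / x)
  have hs : 0 ≤ s := Real.sqrt_nonneg _
  have a1 : Real.arctan (1 / ((n : ℝ) + 1) / s) ≤ Real.arctan (((n : ℝ) + 1) / s) :=
    Real.arctan_strictMono.monotone (div_le_div_of_nonneg_right (one_div_succ_le n) hs)
  have a2 : 0 ≤ Real.arctan (1 / ((n : ℝ) + 1) / s) := Real.arctan_nonneg.2 (by positivity)
  have a3 := (Real.arctan_lt_pi_div_two (((n : ℝ) + 1) / s)).le
  have hpi := Real.pi_pos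
  rw [abs_of_nonneg (by
    have : 0 ≤ Real.arctan (((n : ℝ) + 1) / s) - Real.arctan (1 / ((n : ℝ) + 1) / s) := by linarith
    positivity)]
  have : s * (Real.arctan (((n : ℝ) + 1) / s) - Real.arctan (1 / ((n : ℝ) + 1) / s)) ≤
      s * (Real.pi / 2) := by gcongr; linarith
  calc _ ≤ 2 / Real.pi * (s * (Real.pi / 2)) := by gcongr
    _ = s := by field_simp
    _ ≤ _ := by linarith

theorem tendsto_sqrtApprox {x : ℝ} (hx : x ∈ Set.Icc (0 : ℝ) 1) (hx0 : x ≠ 0) :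
    Tendsto (fun n => sqrtApprox n x) atTop (𝓝 (((1 - x) / x) ^ (1 / 2 : ℝ))) := by
  rcases eq_or_lt_of_le hx.2 with rfl | h1
  · simp [sqrtApprox_one]
  have h0 : 0 < x := lt_of_le_of_ne hx.1 hx0.symm
  have hl : 0 < (1 - x) / x := div_pos (by linarith) h0
  have hs : 0 < √((1 - x) / x) := Real.sqrt_pos.2 hl
  simp only [sqrtApprox_eq h0 h1]
  rw [← Real.sqrt_eq_rpow]
  have e1 : Tendsto (fun n : ℕ => ((n : ℝ) + 1) / √((1 - x) / x)) atTop atTop :=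
    (tendsto_atTop_add_const_right _ _ tendsto_natCast_atTop_atTop).atTop_div_const hs
  have t1 : Tendsto (fun n : ℕ => Real.arctan (((n : ℝ) + 1) / √((1 - x) / x))) atTop
      (𝓝 (Real.pi / 2)) :=
    (Real.tendsto_arctan_atTop.mono_right nhdsWithin_le_nhds).comp e1
  have t2 : Tendsto (fun n : ℕ => Real.arctan (1 / ((n : ℝ) + 1) / √((1 - x) / x))) atTop (𝓝 0) := by
    have := (tendsto_one_div_add_atTop_nhds_zero_nat (𝕜 := ℝ)).div_const (√((1 - x) / x))
    rw [zero_div] at this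
    have h2 := (Real.continuous_arctan.tendsto 0).comp this
    rwa [Real.arctan_zero] at h2
  have t3 := ((t1.sub t2).const_mul (√((1 - x) / x))).const_mul (2 / Real.pi)
  convert t3 using 2
  have := Real.pi_pos
  field_simp
  ring

theorem integrable_sqrtKernel_bound (n : ℕ) :
    HasFiniteIntegral (fun _ : ℝ => (1 : ℝ))
      (volume.restrict (Set.Ioc (1 / ((n : ℝ) + 1)) ((n : ℝ) + 1))) :=
  (integrable_const (1 : ℝ)).2

theorem norm_sqrtKernel_le {n : ℕ} {t : ℝ} (ht : t ∈ Set.Ioc (1 / ((n : ℝ) + 1)) ((n : ℝ) + 1))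
    {x : ℝ} (hx : x ∈ Set.Icc (0 : ℝ) 1) : ‖sqrtKernel t x‖ ≤ 1 := by
  have h := sqrtKernel_mem (lt_trans (by positivity) ht.1) hx
  rw [Real.norm_of_nonneg h.1]; exact h.2

theorem continuousOn_sqrtApprox (n : ℕ) : ContinuousOn (sqrtApprox n) (Set.Icc 0 1) := by
  unfold sqrtApprox
  refine ContinuousOn.const_mul ?_ _
  have hc := continuousOn_uncurry_sqrtKernel n (le_refl (Set.Icc (0 : ℝ) 1))
  refine continuousOn_of_dominated (bound := fun _ => 1) ?_ ?_ (integrable_const _) ?_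
  · intro x hx
    refine ContinuousOn.aestronglyMeasurable ?_ measurableSet_Ioc
    exact hc.comp (f := fun t => (t, x)) (by fun_prop) fun t ht => ⟨ht, hx⟩
  · intro x hx
    exact ae_restrict_of_forall_mem measurableSet_Ioc fun t ht => norm_sqrtKernel_le ht hx
  · exact ae_restrict_of_forall_mem measurableSet_Ioc fun t ht =>
      hc.comp (f := fun x => (t, x)) (by fun_prop) fun x hx => ⟨ht, hx⟩

theorem inner_cfc_sqrtApprox {R : H →L[ℂ] H} (hR : IsSelfAdjoint R)
    (hs : spectrum ℝ R ⊆ Set.Icc 0 1) (n : ℕ) (g w : H) :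
    inner ℂ g (cfc (sqrtApprox n) R w) = (2 / Real.pi : ℝ) •
      ∫ t in Set.Ioc (1 / ((n : ℝ) + 1)) ((n : ℝ) + 1), inner ℂ g (cfc (sqrtKernel t) R w) := by
  have hb : ∀ᵐ t ∂(volume.restrict (Set.Ioc (1 / ((n : ℝ) + 1)) ((n : ℝ) + 1))),
      ∀ z ∈ spectrum ℝ R, ‖sqrtKernel t z‖ ≤ 1 :=
    ae_restrict_of_forall_mem measurableSet_Ioc fun t ht z hz => norm_sqrtKernel_le ht (hs hz)
  have h1 := cfc_setIntegral measurableSet_Ioc sqrtKernel (fun _ => 1) R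
    (continuousOn_uncurry_sqrtKernel n hs) hb (integrable_sqrtKernel_bound n) hR
  have hint : IntegrableOn (fun t => cfc (sqrtKernel t) R)
      (Set.Ioc (1 / ((n : ℝ) + 1)) ((n : ℝ) + 1)) :=
    integrableOn_cfc measurableSet_Ioc sqrtKernel (fun _ => 1) R
      (continuousOn_uncurry_sqrtKernel n hs) hb (integrable_sqrtKernel_bound n) hR
  let T : (H →L[ℂ] H) →L[ℂ] ℂ := innerSL ℂ g ∘L ContinuousLinearMap.apply ℂ H w
  have h2 := T.integral_comp_comm hint
  have h3 : cfc (sqrtApprox n) R = (2 / Real.pi : ℝ) •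
      cfc (fun x => ∫ t in Set.Ioc (1 / ((n : ℝ) + 1)) ((n : ℝ) + 1), sqrtKernel t x) R := by
    have hc : ContinuousOn
        (fun x => ∫ t in Set.Ioc (1 / ((n : ℝ) + 1)) ((n : ℝ) + 1), sqrtKernel t x)
        (spectrum ℝ R) := by
      have := ((continuousOn_sqrtApprox n).mono hs).const_mul (Real.pi / 2)
      refine this.congr fun x _ => ?_
      have := Real.pi_pos
      simp only [sqrtApprox]
      field_simp
    rw [← cfc_smul (2 / Real.pi) _ R hc]
    rfl
  rw [h3, h1]
  change T ((2 / Real.pi : ℝ) • _) = _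
  rw [← Complex.coe_smul, map_smul, ← h2, Complex.coe_smul]
  rfl

/-- In `l ^ (1/2) = (2 / π) ∫ l / (l + t²) dt` write `l / (l + t²) = 1 - t² / (l + t²)`.
Orthogonality of `g` and `w` removes the `1`, the hypothesis bounds the rest, and `∫ D / (1 + (ρ
t)²) dt` over `t > 0` is `π D / (2 ρ)`. -/
theorem norm_inner_le_of_resolvent_bound {R : H →L[ℂ] H} (hR : IsSelfAdjoint R)
    (hs : spectrum ℝ R ⊆ Set.Icc 0 1) {w g z : H}
    (hz : Tendsto (fun ε => cfc (regFun (1 / 2) ε) R w) (𝓝[>] 0) (𝓝 z)) (hwg : inner ℂ g w = 0)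
    {D ρ : ℝ} (hρ : 0 < ρ)
    (h : ∀ t > 0, t ^ 2 * ‖inner ℂ g (cfc (fun x => x / (1 - x + t ^ 2 * x)) R w)‖ ≤
      D / (1 + (ρ * t) ^ 2)) : ‖inner ℂ g z‖ ≤ D / ρ := by
  have hD : 0 ≤ D := by
    have := (by positivity : 0 ≤ (1 : ℝ) ^ 2 *
      ‖inner ℂ g (cfc (fun x => x / (1 - x + (1 : ℝ) ^ 2 * x)) R w)‖).trans (h 1 one_pos)
    rw [← div_mul_cancel₀ D (by positivity : (1 + (ρ * 1) ^ 2) ≠ 0)]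
    exact mul_nonneg this (by positivity)
  have hbd : ∀ᶠ ε in 𝓝[>] (0 : ℝ), ‖cfc (regFun (1 / 2) ε) R w‖ ≤ ‖z‖ + 1 := by
    filter_upwards [hz.norm.eventually_lt_const (lt_add_one ‖z‖)] with ε hε using hε.le
  obtain ⟨μ, hfin, hμ, hgood, hint⟩ := exists_spectralMeasure_of_bounded hR hs hbd
  have hc : ∀ᶠ ε in 𝓝[>] 0, ContinuousOn (regFun (1 / 2) ε) (Set.Icc 0 1) := by
    filter_upwards [self_mem_nhdsWithin] with ε hε using continuousOn_regFun _ hε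
  have hb : ∀ᶠ ε in 𝓝[>] 0, ∀ᵐ x : Set.Icc (0 : ℝ) 1 ∂μ,
      |regFun (1 / 2) ε x| ≤ 1 + ((1 - x) / x : ℝ) ^ (1 / 2 : ℝ) := by
    filter_upwards [self_mem_nhdsWithin] with ε hε
    filter_upwards [hgood] with x hx
    rw [abs_of_pos (regFun_pos hε x.2)]
    exact regFun_le hε x.2 hx.1 hx.2
  have ht : ∀ᵐ x : Set.Icc (0 : ℝ) 1 ∂μ,
      Tendsto (fun ε => regFun (1 / 2) ε x) (𝓝[>] 0) (𝓝 (((1 - x) / x : ℝ) ^ (1 / 2 : ℝ))) := by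
    filter_upwards [hgood] with x hx using tendsto_regFun x.2 hx.1 hx.2
  -- The truncated integrals and the regularized powers have the same pointwise limit and the same
  -- dominating function, so the former also converge to `z`.
  have h1 := tendsto_cfc_sub (l := (atTop : Filter ℕ)) hμ hs
    (Eventually.of_forall continuousOn_sqrtApprox) hc hint
    (Eventually.of_forall fun n => by
      filter_upwards [hgood] with x hx using abs_sqrtApprox_le x.2 (hx.1 (by norm_num)) n) hb
    (by filter_upwards [hgood] with x hx using tendsto_sqrtApprox x.2 (hx.1 (by norm_num))) ht
  have h2 := h1.add (hz.comp (tendsto_snd (f := (atTop : Filter ℕ))))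
  simp only [Function.comp_def, sub_add_cancel, zero_add] at h2
  have h3 : Tendsto (fun n => cfc (sqrtApprox n) R w) atTop (𝓝 z) := by
    have h4 : Tendsto (fun n => cfc (sqrtApprox n) R w)
        (map Prod.fst ((atTop : Filter ℕ) ×ˢ 𝓝[>] (0 : ℝ))) (𝓝 z) := tendsto_map'_iff.2 h2
    rwa [map_fst_prod] at h4
  have h5 : Tendsto (fun n => ‖inner ℂ g (cfc (sqrtApprox n) R w)‖) atTop (𝓝 ‖inner ℂ g z‖) :=
    (tendsto_const_nhds.inner h3).norm
  refine le_of_tendsto h5 (Eventually.of_forall fun n => ?_)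
  rw [inner_cfc_sqrtApprox hR hs, norm_smul]
  have hker : ∀ t > 0, ‖inner ℂ g (cfc (sqrtKernel t) R w)‖ ≤ D / (1 + (ρ * t) ^ 2) := by
    intro t ht
    have hcont : ContinuousOn (fun x => x / (1 - x + t ^ 2 * x)) (spectrum ℝ R) :=
      ContinuousOn.div (by fun_prop) (by fun_prop) fun x hx => (sqrtKernel_den_pos ht (hs hx)).ne'
    have e : cfc (sqrtKernel t) R =
        1 - (t ^ 2) • cfc (fun x => x / (1 - x + t ^ 2 * x)) R := by
      rw [← cfc_const_mul _ _ R hcont, ← cfc_const_one ℝ R hR,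
        ← cfc_sub _ _ R continuousOn_const (hcont.const_mul _)]
      refine cfc_congr fun x hx => ?_
      have := (sqrtKernel_den_pos ht (hs hx)).ne'
      simp only [sqrtKernel]
      rw [eq_sub_iff_add_eq, ← mul_div_assoc, ← add_div, div_self this]
    rw [e]
    change ‖inner ℂ g (w - (t ^ 2) • cfc (fun x => x / (1 - x + t ^ 2 * x)) R w)‖ ≤ _
    rw [inner_sub_right, hwg, zero_sub, norm_neg, ← Complex.coe_smul, inner_smul_right, norm_mul,
      Complex.norm_real, Real.norm_of_nonneg (sq_nonneg t)]
    exact h t ht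
  have hcb : Continuous fun t : ℝ => D / (1 + (ρ * t) ^ 2) :=
    Continuous.div (by fun_prop) (by fun_prop) fun t => by positivity
  have h6 : ‖∫ t in Set.Ioc (1 / ((n : ℝ) + 1)) ((n : ℝ) + 1),
      inner ℂ g (cfc (sqrtKernel t) R w)‖ ≤
      ∫ t in Set.Ioc (1 / ((n : ℝ) + 1)) ((n : ℝ) + 1), D / (1 + (ρ * t) ^ 2) := by
    refine norm_integral_le_of_norm_le ?_ ?_
    · exact (hcb.integrableOn_Icc).mono_set Set.Ioc_subset_Icc_self
    · exact ae_restrict_of_forall_mem measurableSet_Ioc fun t ht =>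
        hker t (lt_trans (by positivity) ht.1)
  have h7 : ∫ t in (1 / ((n : ℝ) + 1))..((n : ℝ) + 1), D / (1 + (ρ * t) ^ 2) ≤
      D / ρ * (Real.pi / 2) := by
    have e : ∀ t : ℝ, HasDerivAt (fun t => D / ρ * Real.arctan (ρ * t)) (D / (1 + (ρ * t) ^ 2)) t := by
      intro t
      have := ((((hasDerivAt_id t).const_mul ρ)).arctan).const_mul (D / ρ)
      refine HasDerivAt.congr_deriv this ?_
      rw [id_eq]
      have : 1 + (ρ * t) ^ 2 ≠ 0 := by positivity
      field_simp
    rw [intervalIntegral.integral_eq_sub_of_hasDerivAt (fun t _ => e t) (hcb.intervalIntegrable _ _),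
      ← mul_sub]
    have a2 : 0 ≤ Real.arctan (ρ * (1 / ((n : ℝ) + 1))) := Real.arctan_nonneg.2 (by positivity)
    have a3 := (Real.arctan_lt_pi_div_two (ρ * ((n : ℝ) + 1))).le
    gcongr
    linarith
  rw [intervalIntegral.integral_of_le (one_div_succ_le n)] at h7
  have hpi := Real.pi_pos
  rw [Real.norm_of_nonneg (by positivity)]
  calc _ ≤ 2 / Real.pi * (D / ρ * (Real.pi / 2)) := by gcongr; exact h6.trans h7
    _ = D / ρ := by field_simp

end SquareRoot

/-! ### Multiplication operators on `L²(ℝ³)`. -/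

section Multiplication

open Classical in
/-- The class of `f` in `L²(ℝ³)` (zero if `f` is not square integrable). -/
def toL2 (f : R3 → ℂ) : L2R3 := if h : MemLp f 2 volume then h.toLp f else 0

theorem coeFn_toL2 {f : R3 → ℂ} (h : MemLp f 2 volume) : (toL2 f : R3 → ℂ) =ᵐ[volume] f := by
  rw [toL2, dif_pos h]
  exact h.coeFn_toLp

theorem toL2_eq {f : R3 → ℂ} {u : L2R3} (h : (u : R3 → ℂ) =ᵐ[volume] f) : toL2 f = u := by
  have hm : MemLp f 2 volume := (memLp_congr_ae h).1 (Lp.memLp u)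
  apply Lp.ext
  exact (coeFn_toL2 hm).trans h.symm

/-- `a` is bounded and measurable. -/
def IsBddMul (a : R3 → ℂ) : Prop := AEStronglyMeasurable a volume ∧ ∃ C, ∀ x, ‖a x‖ ≤ C

theorem IsBddMul.memLp {a : R3 → ℂ} (h : IsBddMul a) (u : L2R3) :
    MemLp (fun x => a x * u x) 2 volume := by
  obtain ⟨C, hC⟩ := h.2
  refine (Lp.memLp u).of_le_mul (c := C) (h.1.mul (Lp.aestronglyMeasurable u)) ?_
  filter_upwards with x
  rw [norm_mul]
  exact mul_le_mul_of_nonneg_right (hC x) (norm_nonneg _)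

theorem IsBddMul.mul {a b : R3 → ℂ} (ha : IsBddMul a) (hb : IsBddMul b) :
    IsBddMul fun x => a x * b x := by
  obtain ⟨C, hC⟩ := ha.2
  obtain ⟨D, hD⟩ := hb.2
  refine ⟨ha.1.mul hb.1, C * D, fun x => ?_⟩
  rw [norm_mul]
  exact mul_le_mul (hC x) (hD x) (norm_nonneg _) ((norm_nonneg _).trans (hC x))

theorem IsBddMul.add {a b : R3 → ℂ} (ha : IsBddMul a) (hb : IsBddMul b) :
    IsBddMul fun x => a x + b x := by
  obtain ⟨C, hC⟩ := ha.2
  obtain ⟨D, hD⟩ := hb.2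
  exact ⟨ha.1.add hb.1, C + D, fun x => (norm_add_le _ _).trans (add_le_add (hC x) (hD x))⟩

theorem IsBddMul.const (c : ℂ) : IsBddMul fun _ => c :=
  ⟨aestronglyMeasurable_const, ‖c‖, fun _ => le_rfl⟩

theorem IsBddMul.conj {a : R3 → ℂ} (ha : IsBddMul a) :
    IsBddMul fun x => (starRingEnd ℂ) (a x) := by
  obtain ⟨C, hC⟩ := ha.2
  refine ⟨?_, C, fun x => ?_⟩
  · exact Complex.continuous_conj.comp_aestronglyMeasurable ha.1
  · rw [RCLike.norm_conj]
    exact hC x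

/-- A bounded continuous real function. -/
theorem IsBddMul.ofReal {a : R3 → ℝ} (ha : Measurable a) {C : ℝ} (hC : ∀ x, |a x| ≤ C) :
    IsBddMul fun x => (a x : ℂ) := by
  refine ⟨(Complex.measurable_ofReal.comp ha).aestronglyMeasurable, C, fun x => ?_⟩
  rw [Complex.norm_real]
  exact hC x

open Classical in
/-- The operator of multiplication by the bounded measurable function `a`. -/
def mulOp (a : R3 → ℂ) : L2R3 →L[ℂ] L2R3 :=
  if h : IsBddMul a then
    LinearMap.mkContinuousOfExistsBound
      { toFun := fun u => (h.memLp u).toLp _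
        map_add' := by
          intro u v
          rw [← MemLp.toLp_add]
          apply MemLp.toLp_congr
          filter_upwards [Lp.coeFn_add u v] with x hx
          rw [hx]
          simp only [Pi.add_apply]
          ring
        map_smul' := by
          intro c u
          rw [RingHom.id_apply, ← MemLp.toLp_const_smul]
          apply MemLp.toLp_congr
          filter_upwards [Lp.coeFn_smul c u] with x hx
          rw [hx]
          simp only [Pi.smul_apply, smul_eq_mul]
          ring }
      (by
        obtain ⟨C, hC⟩ := h.2
        refine ⟨C, fun u => Lp.norm_le_mul_norm_of_ae_le_mul ?_⟩
        filter_upwards [(h.memLp u).coeFn_toLp] with x hx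
        simp only [LinearMap.coe_mk, AddHom.coe_mk]
        rw [hx, norm_mul]
        exact mul_le_mul_of_nonneg_right (hC x) (norm_nonneg _))
  else 0

theorem coeFn_mulOp {a : R3 → ℂ} (h : IsBddMul a) (u : L2R3) :
    (mulOp a u : R3 → ℂ) =ᵐ[volume] fun x => a x * u x := by
  rw [mulOp, dif_pos h]
  exact (h.memLp u).coeFn_toLp

theorem norm_mulOp_le {a : R3 → ℂ} (h : IsBddMul a) {C : ℝ} (hC : ∀ x, ‖a x‖ ≤ C) (u : L2R3) :
    ‖mulOp a u‖ ≤ C * ‖u‖ := by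
  refine Lp.norm_le_mul_norm_of_ae_le_mul ?_
  filter_upwards [coeFn_mulOp h u] with x hx
  rw [hx, norm_mul]
  exact mul_le_mul_of_nonneg_right (hC x) (norm_nonneg _)

theorem mulOp_mul_apply {a b : R3 → ℂ} (ha : IsBddMul a) (hb : IsBddMul b) (u : L2R3) :
    mulOp (fun x => a x * b x) u = mulOp a (mulOp b u) := by
  apply Lp.ext
  filter_upwards [coeFn_mulOp (ha.mul hb) u, coeFn_mulOp ha (mulOp b u), coeFn_mulOp hb u]
    with x h1 h2 h3
  rw [h1, h2, h3, mul_assoc]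

theorem mulOp_add_apply {a b : R3 → ℂ} (ha : IsBddMul a) (hb : IsBddMul b) (u : L2R3) :
    mulOp (fun x => a x + b x) u = mulOp a u + mulOp b u := by
  apply Lp.ext
  filter_upwards [coeFn_mulOp (ha.add hb) u, coeFn_mulOp ha u, coeFn_mulOp hb u,
    Lp.coeFn_add (mulOp a u) (mulOp b u)] with x h1 h2 h3 h4
  rw [h1, h4, Pi.add_apply, h2, h3, add_mul]

theorem mulOp_const_apply (c : ℂ) (u : L2R3) : mulOp (fun _ => c) u = c • u := by
  apply Lp.ext
  filter_upwards [coeFn_mulOp (IsBddMul.const c) u, Lp.coeFn_smul c u] with x h1 h2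
  rw [h1, h2, Pi.smul_apply, smul_eq_mul]

theorem inner_mulOp_left {a : R3 → ℂ} (ha : IsBddMul a) (u v : L2R3) :
    inner ℂ (mulOp a u) v = inner ℂ u (mulOp (fun x => (starRingEnd ℂ) (a x)) v) := by
  rw [L2.inner_def, L2.inner_def]
  apply integral_congr_ae
  filter_upwards [coeFn_mulOp ha u, coeFn_mulOp ha.conj v] with x h1 h2
  rw [h1, h2]
  simp only [RCLike.inner_apply, map_mul]
  ring

theorem inner_mulOp_ofReal_left {a : R3 → ℝ} (ha : IsBddMul fun x => (a x : ℂ)) (u v : L2R3) :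
    inner ℂ (mulOp (fun x => (a x : ℂ)) u) v = inner ℂ u (mulOp (fun x => (a x : ℂ)) v) := by
  rw [inner_mulOp_left ha]
  simp only [Complex.conj_ofReal]

theorem mulOp_toL2 {a f : R3 → ℂ} (ha : IsBddMul a) (hf : MemLp f 2 volume) :
    mulOp a (toL2 f) = toL2 fun x => a x * f x := by
  symm
  apply toL2_eq
  filter_upwards [coeFn_mulOp ha (toL2 f), coeFn_toL2 hf] with x h1 h2
  rw [h1, h2]

theorem norm_sq_eq_integral (u : L2R3) : ‖u‖ ^ 2 = ∫ x, ‖u x‖ ^ 2 := by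
  have h := L2.inner_def (𝕜 := ℂ) u u
  rw [inner_self_eq_norm_sq_to_K] at h
  have h2 : ∫ x, inner ℂ (u x) (u x) = ((∫ x, ‖u x‖ ^ 2 : ℝ) : ℂ) := by
    rw [← integral_complex_ofReal]
    congr 1
    ext x
    rw [inner_self_eq_norm_sq_to_K]
    norm_cast
  rw [h2] at h
  apply Complex.ofReal_injective
  rw [← h, Complex.ofReal_pow]
  rfl

theorem integrable_norm_sq (u : L2R3) : Integrable (fun x => ‖u x‖ ^ 2) volume :=
  (Lp.memLp u).integrable_norm_pow (by norm_num)

theorem norm_toL2_sq {f : R3 → ℂ} (hf : MemLp f 2 volume) : ‖toL2 f‖ ^ 2 = ∫ x, ‖f x‖ ^ 2 := by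
  rw [norm_sq_eq_integral]
  apply integral_congr_ae
  filter_upwards [coeFn_toL2 hf] with x hx
  rw [hx]

/-- Multiplication by uniformly bounded functions converging pointwise to `1`. -/
theorem tendsto_mulOp {a : ℕ → R3 → ℂ} (ha : ∀ n, IsBddMul (a n)) {C : ℝ}
    (hC : ∀ n x, ‖a n x‖ ≤ C) (hlim : ∀ x, Tendsto (fun n => a n x) atTop (𝓝 1)) (u : L2R3) :
    Tendsto (fun n => mulOp (a n) u) atTop (𝓝 u) := by
  rw [tendsto_iff_norm_sub_tendsto_zero]
  have key : Tendsto (fun n => ‖mulOp (a n) u - u‖ ^ 2) atTop (𝓝 0) := by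
    have e : ∀ n, ‖mulOp (a n) u - u‖ ^ 2 = ∫ x, ‖(a n x - 1) * u x‖ ^ 2 := by
      intro n
      rw [norm_sq_eq_integral]
      apply integral_congr_ae
      filter_upwards [coeFn_mulOp (ha n) u, Lp.coeFn_sub (mulOp (a n) u) u] with x h1 h2
      rw [h2, Pi.sub_apply, h1, sub_mul, one_mul]
    simp only [e]
    have h0 : ∫ _ : R3, (0 : ℝ) = 0 := integral_zero _ _
    rw [← h0]
    apply tendsto_integral_of_dominated_convergence (fun x => (C + 1) ^ 2 * ‖u x‖ ^ 2)
    · intro n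
      exact ((((ha n).1.sub aestronglyMeasurable_const).mul
        (Lp.aestronglyMeasurable u)).norm.pow 2)
    · exact (integrable_norm_sq u).const_mul _
    · intro n
      filter_upwards with x
      rw [norm_mul, mul_pow, Real.norm_of_nonneg (by positivity)]
      gcongr
      refine (norm_sub_le _ _).trans ?_
      rw [norm_one]
      exact add_le_add (hC n x) le_rfl
    · filter_upwards with x
      have h1 : Tendsto (fun n => ‖(a n x - 1) * u x‖ ^ 2) atTop (𝓝 (‖(1 - 1) * u x‖ ^ 2)) :=
        ((((hlim x).sub_const 1).mul_const (u x)).norm).pow 2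
      simpa using h1
  have h2 := (Real.continuous_sqrt.tendsto 0).comp key
  rw [Real.sqrt_zero] at h2
  refine h2.congr fun n => ?_
  simp only [Function.comp_apply]
  exact Real.sqrt_sq (norm_nonneg _)

end Multiplication

/-! ### Test functions and their weak gradients. -/

section TestFunctions

/-- `φ ∈ C_c^∞(ℝ³)`. -/
def IsTest (φ : R3 → ℂ) : Prop := ContDiff ℝ ∞ φ ∧ HasCompactSupport φ

/-- The unit vector `e_i`. -/
abbrev unitVec (i : Fin 3) : R3 := EuclideanSpace.single i 1

/-- The partial derivative `∂_i f`. -/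
def pd {F : Type*} [NormedAddCommGroup F] [NormedSpace ℝ F] (i : Fin 3) (f : R3 → F) (x : R3) : F :=
  fderiv ℝ f x (unitVec i)

theorem IsTest.memLp {φ : R3 → ℂ} (h : IsTest φ) : MemLp φ 2 volume :=
  h.1.continuous.memLp_of_hasCompactSupport h.2

theorem IsTest.pd {φ : R3 → ℂ} (h : IsTest φ) (i : Fin 3) : IsTest (pd i φ) := by
  refine ⟨?_, h.2.fderiv_apply ℝ (unitVec i)⟩
  exact (h.1.fderiv_right (m := ∞) (by simp)).clm_apply contDiff_const

theorem IsTest.mul_left {φ a : R3 → ℂ} (h : IsTest φ) (ha : ContDiff ℝ ∞ a) :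
    IsTest fun x => a x * φ x :=
  ⟨ha.mul h.1, h.2.mul_left⟩

theorem contDiff_pd {F : Type*} [NormedAddCommGroup F] [NormedSpace ℝ F] {f : R3 → F}
    (h : ContDiff ℝ ∞ f) (i : Fin 3) : ContDiff ℝ ∞ (pd i f) :=
  (h.fderiv_right (m := ∞) (by simp)).clm_apply contDiff_const

theorem pd_mul {f g : R3 → ℂ} {x : R3} (hf : DifferentiableAt ℝ f x) (hg : DifferentiableAt ℝ g x)
    (i : Fin 3) : pd i (fun y => f y * g y) x = f x * pd i g x + pd i f x * g x := by
  unfold pd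
  rw [fderiv_fun_mul hf hg]
  simp only [add_apply, smul_apply, smul_eq_mul]
  ring

theorem pd_ofReal {f : R3 → ℝ} {x : R3} (hf : DifferentiableAt ℝ f x) (i : Fin 3) :
    pd i (fun y => (f y : ℂ)) x = ((pd i f x : ℝ) : ℂ) := by
  have h := (Complex.ofRealCLM.hasFDerivAt (x := f x)).comp x hf.hasFDerivAt
  unfold pd
  have h2 : HasFDerivAt (fun y => (f y : ℂ)) (Complex.ofRealCLM.comp (fderiv ℝ f x)) x := h
  rw [h2.fderiv]
  simp

theorem isWeakGrad_schwartz (g : 𝓢(R3, ℂ)) :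
    IsWeakGrad (g.toLp 2) fun i => (∂_{unitVec i} g).toLp 2 := by
  intro i
  rw [Lp.toTemperedDistribution_toLp_eq, Lp.toTemperedDistribution_toLp_eq]
  exact TemperedDistribution.lineDerivOp_toTemperedDistributionCLM_eq g _

theorem toL2_schwartz (g : 𝓢(R3, ℂ)) : toL2 g = g.toLp 2 :=
  toL2_eq (g.coeFn_toLp 2)

theorem coe_lineDeriv_schwartz (g : 𝓢(R3, ℂ)) (i : Fin 3) :
    ((∂_{unitVec i} g : 𝓢(R3, ℂ)) : R3 → ℂ) = pd i g := by
  ext x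
  exact SchwartzMap.lineDerivOp_apply_eq_fderiv _ _ _

theorem isWeakGrad_toL2_schwartz (g : 𝓢(R3, ℂ)) :
    IsWeakGrad (toL2 g) fun i => toL2 (pd i g) := by
  have h := isWeakGrad_schwartz g
  simp only [← toL2_schwartz, coe_lineDeriv_schwartz] at h
  exact h

/-- A test function as a Schwartz function. -/
def IsTest.toSchwartz {φ : R3 → ℂ} (h : IsTest φ) : 𝓢(R3, ℂ) := h.2.toSchwartzMap h.1

theorem IsTest.coe_toSchwartz {φ : R3 → ℂ} (h : IsTest φ) : (h.toSchwartz : R3 → ℂ) = φ := rfl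

theorem isWeakGrad_test {φ : R3 → ℂ} (h : IsTest φ) :
    IsWeakGrad (toL2 φ) fun i => toL2 (pd i φ) :=
  isWeakGrad_toL2_schwartz h.toSchwartz

end TestFunctions

/-! ### The Hilbert space `H¹(ℝ³)` as a graph. -/

section Sobolev

/-- The closed subspace of all pairs `(u, ∇u)`. -/
def sobolevGraph : Submodule ℂ (WithLp 2 (L2R3 × PiLp 2 fun _ : Fin 3 => L2R3)) where
  carrier := {p | IsWeakGrad p.fst fun i => p.snd i}
  add_mem' := by
    intro p q hp hq i
    have e1 := hp i
    have e2 := hq i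
    simp only [← Lp.toTemperedDistributionCLM_apply, WithLp.add_fst, WithLp.add_snd, PiLp.add_apply,
      map_add, LineDeriv.lineDerivOp_add] at e1 e2 ⊢
    rw [e1, e2]
  zero_mem' := by
    intro i
    simp only [← Lp.toTemperedDistributionCLM_apply, WithLp.zero_fst, WithLp.zero_snd,
      PiLp.zero_apply, map_zero, LineDeriv.lineDerivOp_zero]
  smul_mem' := by
    intro c p hp i
    have e1 := hp i
    simp only [← Lp.toTemperedDistributionCLM_apply, WithLp.smul_fst, WithLp.smul_snd,
      PiLp.smul_apply, map_smul, LineDeriv.lineDerivOp_smul] at e1 ⊢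
    rw [e1]

/-- Differentiation and the embedding of `L²` are continuous for tempered distributions. Closedness
is what makes `H1` complete. -/
theorem isClosed_sobolevGraph :
    IsClosed (sobolevGraph : Set (WithLp 2 (L2R3 × PiLp 2 fun _ : Fin 3 => L2R3))) := by
  have : (sobolevGraph : Set (WithLp 2 (L2R3 × PiLp 2 fun _ : Fin 3 => L2R3))) =
      ⋂ i : Fin 3, {p | LineDeriv.lineDerivOpCLM ℂ 𝓢'(R3, ℂ) (unitVec i)
        (Lp.toTemperedDistributionCLM ℂ volume 2 p.fst) =
          Lp.toTemperedDistributionCLM ℂ volume 2 (p.snd i)} := by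
    ext p
    simp only [Set.mem_iInter]
    rfl
  rw [this]
  refine isClosed_iInter fun i => isClosed_eq ?_ ?_
  · exact (LineDeriv.lineDerivOpCLM ℂ 𝓢'(R3, ℂ) (unitVec i)).continuous.comp
      ((Lp.toTemperedDistributionCLM ℂ volume 2).continuous.comp
        (WithLp.fstL 2 ℂ L2R3 (PiLp 2 fun _ : Fin 3 => L2R3)).continuous)
  · exact (Lp.toTemperedDistributionCLM ℂ volume 2).continuous.comp
      ((PiLp.proj 2 (fun _ : Fin 3 => L2R3) i (𝕜 := ℂ)).continuous.comp
        (WithLp.sndL 2 ℂ L2R3 (PiLp 2 fun _ : Fin 3 => L2R3)).continuous)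

/-- The Sobolev space `H¹(ℝ³)`. -/
def H1 : Type := sobolevGraph

instance : NormedAddCommGroup H1 := inferInstanceAs (NormedAddCommGroup sobolevGraph)

instance : InnerProductSpace ℂ H1 := inferInstanceAs (InnerProductSpace ℂ sobolevGraph)

instance : CompleteSpace H1 :=
  isClosed_sobolevGraph.completeSpace_coe

/-- The inclusion of `H¹` in the space of pairs `(u, G)`. -/
def H1.incl : H1 →L[ℂ] WithLp 2 (L2R3 × PiLp 2 fun _ : Fin 3 => L2R3) := sobolevGraph.subtypeL

/-- The embedding `H¹ → L²`. -/
def embL2 : H1 →L[ℂ] L2R3 := (WithLp.fstL 2 ℂ L2R3 (PiLp 2 fun _ : Fin 3 => L2R3)).comp H1.incl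

/-- The gradient `H¹ → (L²)³`. -/
def grad : H1 →L[ℂ] PiLp 2 fun _ : Fin 3 => L2R3 :=
  (WithLp.sndL 2 ℂ L2R3 (PiLp 2 fun _ : Fin 3 => L2R3)).comp H1.incl

theorem norm_sq_H1 (v : H1) : ‖v‖ ^ 2 = ‖embL2 v‖ ^ 2 + ‖grad v‖ ^ 2 :=
  WithLp.prod_norm_sq_eq_of_L2 (H1.incl v)

theorem inner_H1 (v w : H1) :
    inner ℂ v w = inner ℂ (embL2 v) (embL2 w) + inner ℂ (grad v) (grad w) :=
  WithLp.prod_inner_apply (H1.incl v) (H1.incl w)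

theorem isWeakGrad_grad (v : H1) : IsWeakGrad (embL2 v) fun i => grad v i :=
  (show sobolevGraph from v).2

/-- The element of `H¹` with given weak gradient. -/
def IsWeakGrad.toH1 {u : L2R3} {G : Fin 3 → L2R3} (h : IsWeakGrad u G) : H1 :=
  show sobolevGraph from ⟨WithLp.toLp 2 (u, WithLp.toLp 2 G), h⟩

@[simp]
theorem IsWeakGrad.embL2_toH1 {u : L2R3} {G : Fin 3 → L2R3} (h : IsWeakGrad u G) :
    embL2 h.toH1 = u := rfl

@[simp]
theorem IsWeakGrad.grad_toH1 {u : L2R3} {G : Fin 3 → L2R3} (h : IsWeakGrad u G) (i : Fin 3) :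
    grad h.toH1 i = G i := rfl

theorem H1.ext {v w : H1} (h : embL2 v = embL2 w) (h' : ∀ i, grad v i = grad w i) : v = w := by
  rw [← sub_eq_zero, ← norm_eq_zero, ← sq_eq_zero_iff, norm_sq_H1, map_sub, map_sub, h, sub_self,
    PiLp.norm_sq_eq_of_L2]
  simp [h']

/-- A test function as an element of `H¹`. -/
def IsTest.toH1 {φ : R3 → ℂ} (h : IsTest φ) : H1 := (isWeakGrad_test h).toH1

@[simp]
theorem IsTest.embL2_toH1 {φ : R3 → ℂ} (h : IsTest φ) : embL2 h.toH1 = toL2 φ := rfl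

@[simp]
theorem IsTest.grad_toH1 {φ : R3 → ℂ} (h : IsTest φ) (i : Fin 3) :
    grad h.toH1 i = toL2 (_root_.pd i φ) := rfl

end Sobolev

/-! ### Radial cutoff functions. -/

section Cutoff

theorem exists_abs_deriv_smoothTransition_le :
    ∃ C : ℝ, 0 < C ∧ ∀ t, |deriv Real.smoothTransition t| ≤ C := by
  have hc : Continuous (deriv Real.smoothTransition) :=
    (Real.smoothTransition.contDiff (n := 1)).continuous_deriv le_rfl
  obtain ⟨C, hC⟩ := (isCompact_Icc (a := (0 : ℝ)) (b := 1)).exists_bound_of_continuousOn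
    hc.continuousOn
  refine ⟨max C 1, by positivity, fun t => ?_⟩
  by_cases ht : t ∈ Set.Icc (0 : ℝ) 1
  · exact (hC t ht).trans (le_max_left _ _)
  · have h0 : deriv Real.smoothTransition t = 0 := by
      rw [Set.mem_Icc, not_and_or, not_le, not_le] at ht
      rcases ht with h | h
      · have : Real.smoothTransition =ᶠ[𝓝 t] fun _ => 0 := by
          filter_upwards [Iio_mem_nhds h] with s hs
          exact Real.smoothTransition.zero_of_nonpos (le_of_lt hs)
        rw [this.deriv_eq, deriv_const]
      · have : Real.smoothTransition =ᶠ[𝓝 t] fun _ => 1 := by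
          filter_upwards [Ioi_mem_nhds h] with s hs
          exact Real.smoothTransition.one_of_one_le (le_of_lt hs)
        rw [this.deriv_eq, deriv_const]
    rw [h0, abs_zero]
    positivity

/-- The radial cutoff function equal to `1` for `|x| ≤ ρ` and to `0` for `|x| ≥ 2ρ`. -/
def cutoff (ρ : ℝ) (x : R3) : ℝ := Real.smoothTransition (2 - ‖x‖ ^ 2 / ρ ^ 2)

theorem contDiff_cutoff (ρ : ℝ) : ContDiff ℝ ∞ (cutoff ρ) :=
  Real.smoothTransition.contDiff.comp
    (contDiff_const.sub ((contDiff_norm_sq ℝ).div_const _))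

theorem cutoff_nonneg (ρ : ℝ) (x : R3) : 0 ≤ cutoff ρ x := Real.smoothTransition.nonneg _

theorem cutoff_le_one (ρ : ℝ) (x : R3) : cutoff ρ x ≤ 1 := Real.smoothTransition.le_one _

theorem abs_cutoff_le_one (ρ : ℝ) (x : R3) : |cutoff ρ x| ≤ 1 := by
  rw [abs_of_nonneg (cutoff_nonneg _ _)]
  exact cutoff_le_one _ _

theorem cutoff_eq_one {ρ : ℝ} (hρ : 0 < ρ) {x : R3} (h : ‖x‖ ≤ ρ) : cutoff ρ x = 1 := by
  apply Real.smoothTransition.one_of_one_le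
  have : ‖x‖ ^ 2 / ρ ^ 2 ≤ 1 := by
    rw [div_le_one (by positivity)]
    gcongr
  linarith

theorem cutoff_eq_zero {ρ : ℝ} (hρ : 0 < ρ) {x : R3} (h : 2 * ρ ≤ ‖x‖) : cutoff ρ x = 0 := by
  apply Real.smoothTransition.zero_of_nonpos
  have : 2 ≤ ‖x‖ ^ 2 / ρ ^ 2 := by
    rw [le_div_iff₀ (by positivity)]
    nlinarith
  linarith

theorem hasCompactSupport_cutoff {ρ : ℝ} (hρ : 0 < ρ) : HasCompactSupport (cutoff ρ) := by
  apply HasCompactSupport.of_support_subset_isCompact (isCompact_closedBall (0 : R3) (2 * ρ))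
  intro x hx
  rw [mem_closedBall_zero_iff]
  by_contra h
  exact hx (cutoff_eq_zero hρ (le_of_lt (not_le.1 h)))

/-- The partial derivatives of a function of `|x|²`. -/
theorem pd_comp_norm_sq {f : ℝ → ℝ} {x : R3} (hf : DifferentiableAt ℝ f (‖x‖ ^ 2)) (i : Fin 3) :
    pd i (fun y : R3 => f (‖y‖ ^ 2)) x = deriv f (‖x‖ ^ 2) * (2 * x i) := by
  have h : HasFDerivAt (fun y : R3 => f (‖y‖ ^ 2)) _ x :=
    hf.hasDerivAt.comp_hasFDerivAt x (hasStrictFDerivAt_norm_sq x).hasFDerivAt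
  unfold pd
  rw [h.fderiv]
  simp [EuclideanSpace.inner_single_right]

theorem pd_cutoff (ρ : ℝ) (x : R3) (i : Fin 3) :
    pd i (cutoff ρ) x =
      deriv Real.smoothTransition (2 - ‖x‖ ^ 2 / ρ ^ 2) * (-(2 * x i) / ρ ^ 2) := by
  have hd : DifferentiableAt ℝ Real.smoothTransition (2 - ‖x‖ ^ 2 / ρ ^ 2) :=
    (Real.smoothTransition.contDiff (n := 1)).differentiable (by simp) _
  have h1 : HasDerivAt (fun s : ℝ => 2 - s / ρ ^ 2) (-(1 / ρ ^ 2)) (‖x‖ ^ 2) :=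
    ((hasDerivAt_id _).div_const _).const_sub 2
  have h2 := hd.hasDerivAt.comp (‖x‖ ^ 2) h1
  have h3 := pd_comp_norm_sq h2.differentiableAt i
  rw [h2.deriv] at h3
  refine Eq.trans h3 ?_
  ring

theorem abs_coord_le (x : R3) (i : Fin 3) : |x i| ≤ ‖x‖ := by
  have := PiLp.norm_apply_le x i
  rwa [Real.norm_eq_abs] at this

theorem pd_eq_zero_of_eventuallyEq_const {F : Type*} [NormedAddCommGroup F] [NormedSpace ℝ F]
    {f : R3 → F} {x : R3} {c : F} (h : f =ᶠ[𝓝 x] fun _ => c) (i : Fin 3) : pd i f x = 0 := by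
  unfold pd
  rw [h.fderiv_eq]
  simp

theorem pd_cutoff_eq_zero_of_gt {ρ : ℝ} (hρ : 0 < ρ) {x : R3} (h : 2 * ρ < ‖x‖) (i : Fin 3) :
    pd i (cutoff ρ) x = 0 := by
  apply pd_eq_zero_of_eventuallyEq_const (c := 0)
  filter_upwards [(isOpen_lt continuous_const continuous_norm).mem_nhds h] with y hy
  exact cutoff_eq_zero hρ (le_of_lt hy)

/-- The gradient lives in `|x| ≤ 2 ρ`, where `2 |x i| / ρ ^ 2 ≤ 4 / ρ`. The point is that `C` does
not depend on the scale `ρ`. -/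
theorem exists_abs_pd_cutoff_le :
    ∃ C : ℝ, 0 < C ∧ ∀ ρ : ℝ, 0 < ρ → ∀ i x, |pd i (cutoff ρ) x| ≤ C / ρ := by
  obtain ⟨C, hC0, hC⟩ := exists_abs_deriv_smoothTransition_le
  refine ⟨4 * C, by positivity, fun ρ hρ i x => ?_⟩
  by_cases h : 2 * ρ < ‖x‖
  · rw [pd_cutoff_eq_zero_of_gt hρ h, abs_zero]
    positivity
  · rw [pd_cutoff, abs_mul, abs_div, abs_neg, abs_mul, abs_two, abs_of_pos (by positivity : 0 < ρ ^ 2)]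
    have h1 : 2 * |x i| / ρ ^ 2 ≤ 4 / ρ := by
      rw [div_le_div_iff₀ (by positivity) hρ]
      nlinarith [abs_coord_le x i, not_lt.1 h]
    calc _ ≤ C * (4 / ρ) := by
          apply mul_le_mul (hC _) h1 (by positivity) hC0.le
      _ = _ := by ring

theorem isBddMul_cutoff (ρ : ℝ) : IsBddMul fun x => (cutoff ρ x : ℂ) :=
  IsBddMul.ofReal (contDiff_cutoff ρ).continuous.measurable (abs_cutoff_le_one ρ)

theorem isBddMul_pd_cutoff {ρ : ℝ} (hρ : 0 < ρ) (i : Fin 3) :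
    IsBddMul fun x => ((pd i (cutoff ρ) x : ℝ) : ℂ) := by
  obtain ⟨C, -, hC⟩ := exists_abs_pd_cutoff_le
  exact IsBddMul.ofReal (contDiff_pd (contDiff_cutoff ρ) i).continuous.measurable (hC ρ hρ i)

theorem contDiff_ofReal {a : R3 → ℝ} (h : ContDiff ℝ ∞ a) : ContDiff ℝ ∞ fun x => (a x : ℂ) :=
  Complex.ofRealCLM.contDiff.comp h

theorem tendsto_cutoff (u : L2R3) :
    Tendsto (fun n : ℕ => mulOp (fun x => (cutoff (n + 1) x : ℂ)) u) atTop (𝓝 u) := by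
  refine tendsto_mulOp (fun n => isBddMul_cutoff _) (C := 1) (fun n x => ?_) (fun x => ?_) u
  · rw [Complex.norm_real]
    exact abs_cutoff_le_one _ _
  · apply tendsto_const_nhds.congr'
    filter_upwards [eventually_ge_atTop ⌈‖x‖⌉₊] with n hn
    rw [cutoff_eq_one (by positivity), Complex.ofReal_one]
    exact (Nat.le_ceil _).trans ((Nat.cast_le.2 hn).trans (by linarith))

theorem tendsto_pd_cutoff (u : L2R3) (i : Fin 3) :
    Tendsto (fun n : ℕ => mulOp (fun x => ((pd i (cutoff (n + 1)) x : ℝ) : ℂ)) u) atTop (𝓝 0) := by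
  obtain ⟨C, hC0, hC⟩ := exists_abs_pd_cutoff_le
  apply squeeze_zero_norm (a := fun n : ℕ => C / (n + 1) * ‖u‖)
  · intro n
    apply norm_mulOp_le (isBddMul_pd_cutoff (by positivity) i)
    intro x
    rw [Complex.norm_real]
    exact hC _ (by positivity) i x
  · have h := (tendsto_one_div_add_atTop_nhds_zero_nat (𝕜 := ℝ)).const_mul (C * ‖u‖)
    rw [mul_zero] at h
    exact h.congr fun n => by ring

end Cutoff

/-! ### Weak derivatives and `1 - Δ` on the Fourier side. -/

section Fourier

/-- Both sides are locally integrable and define the same distribution; membership of the right side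
in `L²` is a consequence, not an input. -/
theorem fourier_weakGrad {u : L2R3} {G : Fin 3 → L2R3} (h : IsWeakGrad u G) (i : Fin 3) :
    ((𝓕 (G i) : L2R3) : R3 → ℂ) =ᵐ[volume]
      fun ξ => 2 * Real.pi * Complex.I * ξ i * (𝓕 u : L2R3) ξ := by
  have h1 := congrArg (fun T : 𝓢'(R3, ℂ) => 𝓕 T) (h i)
  simp only [TemperedDistribution.fourier_lineDerivOp_eq, Lp.fourier_toTemperedDistribution_eq] at h1
  apply ae_eq_of_integral_contDiff_smul_eq
  · exact (Lp.memLp _).locallyIntegrable (by norm_num : (1 : ℝ≥0∞) ≤ 2)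
  · have hloc : LocallyIntegrable (fun ξ => (𝓕 u : L2R3) ξ) volume :=
      (Lp.memLp _).locallyIntegrable (by norm_num : (1 : ℝ≥0∞) ≤ 2)
    exact hloc.continuous_smul (g := fun ξ : R3 => 2 * Real.pi * Complex.I * (ξ i : ℂ))
      (by fun_prop)
  · intro g hg hg'
    have hT : IsTest fun x => (g x : ℂ) := ⟨contDiff_ofReal hg, hg'.comp_left (g := fun t : ℝ => (t : ℂ)) (by simp)⟩
    have h2 := congrArg (fun T : 𝓢'(R3, ℂ) => T hT.toSchwartz) h1
    have ht : (fun x : R3 => inner ℝ x (EuclideanSpace.single i 1)).HasTemperateGrowth := by fun_prop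
    have e2 : ∀ ξ, SchwartzMap.smulLeftCLM ℂ
        (fun x : R3 => ((inner ℝ x (EuclideanSpace.single i 1) : ℝ) : ℂ)) hT.toSchwartz ξ =
          ξ i * g ξ := by
      intro ξ
      rw [SchwartzMap.smulLeftCLM_apply_apply (by fun_prop), hT.coe_toSchwartz]
      simp [EuclideanSpace.inner_single_right]
    simp only [smul_apply, TemperedDistribution.smulLeftCLM_apply_apply,
      Lp.toTemperedDistribution_apply, e2, hT.coe_toSchwartz, smul_eq_mul] at h2
    simp only [Complex.real_smul]
    rw [← h2, ← integral_const_mul]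
    congr 1
    ext ξ
    ring

theorem toL2_pd_mul {a : R3 → ℝ} (ha : ContDiff ℝ ∞ a) (hb : IsBddMul fun x => (a x : ℂ))
    (i : Fin 3) (hb' : IsBddMul fun x => ((pd i a x : ℝ) : ℂ)) {f : R3 → ℂ} (hf : ContDiff ℝ ∞ f)
    (hm : MemLp f 2 volume) (hm' : MemLp (pd i f) 2 volume) :
    toL2 (pd i fun x => (a x : ℂ) * f x) =
      mulOp (fun x => (a x : ℂ)) (toL2 (pd i f)) +
        mulOp (fun x => ((pd i a x : ℝ) : ℂ)) (toL2 f) := by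
  apply toL2_eq
  filter_upwards [Lp.coeFn_add (mulOp (fun x => (a x : ℂ)) (toL2 (pd i f)))
    (mulOp (fun x => ((pd i a x : ℝ) : ℂ)) (toL2 f)), coeFn_mulOp hb (toL2 (pd i f)),
    coeFn_mulOp hb' (toL2 f), coeFn_toL2 hm, coeFn_toL2 hm'] with x h1 h2 h3 h4 h5
  rw [h1, Pi.add_apply, h2, h3, h4, h5, pd_mul, pd_ofReal]
  · exact ha.differentiable (by simp) x
  · exact (contDiff_ofReal ha).differentiable (by simp) x
  · exact hf.differentiable (by simp) x

theorem memLp_pd_schwartz (g : 𝓢(R3, ℂ)) (i : Fin 3) : MemLp (pd i g) 2 volume := by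
  rw [← coe_lineDeriv_schwartz]
  exact SchwartzMap.memLp _ 2 volume

theorem isTest_cutoff_mul {ρ : ℝ} (hρ : 0 < ρ) {f : R3 → ℂ} (hf : ContDiff ℝ ∞ f) :
    IsTest fun x => (cutoff ρ x : ℂ) * f x :=
  ⟨(contDiff_ofReal (contDiff_cutoff ρ)).mul hf,
    ((hasCompactSupport_cutoff hρ).comp_left (g := fun t : ℝ => (t : ℂ)) (by simp)).mul_right⟩

/-- If `⟨φ, v⟩ + ⟨∇φ, ∇v⟩ = ⟨φ, x⟩` for all test functions, then `(1 - Δ) v = x`. -/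
theorem fourier_of_forall_test {v x : L2R3} {G : Fin 3 → L2R3} (h : IsWeakGrad v G)
    (hx : ∀ φ, IsTest φ →
      inner ℂ (toL2 φ) v + ∑ i, inner ℂ (toL2 (pd i φ)) (G i) = inner ℂ (toL2 φ) x) :
    ((𝓕 x : L2R3) : R3 → ℂ) =ᵐ[volume]
      fun ξ => ((1 + (2 * Real.pi * ‖ξ‖) ^ 2 : ℝ) : ℂ) * (𝓕 v : L2R3) ξ := by
  -- The equation passes to Schwartz functions by cutting off, since the gradients of the cutoffs
  -- are `O(1 / n)`. Schwartz functions are needed because the Fourier transform does not preserve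
  -- compact support.
  have hS : ∀ g : 𝓢(R3, ℂ),
      inner ℂ (toL2 g) v + ∑ i, inner ℂ (toL2 (pd i g)) (G i) = inner ℂ (toL2 g) x := by
    intro g
    have hg : ContDiff ℝ ∞ g := g.smooth ⊤
    have hgm : MemLp g 2 volume := g.memLp 2 volume
    have e1 : ∀ n : ℕ, toL2 (fun x => (cutoff (n + 1) x : ℂ) * g x) =
        mulOp (fun x => (cutoff (n + 1) x : ℂ)) (toL2 g) := fun n =>
      (mulOp_toL2 (isBddMul_cutoff _) hgm).symm
    have t1 : Tendsto (fun n : ℕ => toL2 (fun x => (cutoff (n + 1) x : ℂ) * g x)) atTop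
        (𝓝 (toL2 g)) := by
      simp only [e1]
      exact tendsto_cutoff _
    have t2 : ∀ i, Tendsto (fun n : ℕ => toL2 (pd i (fun x => (cutoff (n + 1) x : ℂ) * g x))) atTop
        (𝓝 (toL2 (pd i g))) := by
      intro i
      have e2 : ∀ n : ℕ, _ := fun n : ℕ => toL2_pd_mul (contDiff_cutoff (n + 1))
        (isBddMul_cutoff _) i (isBddMul_pd_cutoff (by positivity) i) hg hgm (memLp_pd_schwartz g i)
      simp only [e2]
      simpa using (tendsto_cutoff (toL2 (pd i g))).add (tendsto_pd_cutoff (toL2 g) i)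
    have l1 := ((t1.inner tendsto_const_nhds).add (tendsto_finsetSum Finset.univ fun i _ =>
      (t2 i).inner (tendsto_const_nhds (x := G i)))  : Tendsto (fun n : ℕ => inner ℂ (toL2 (fun x => (cutoff (n + 1) x : ℂ) * g x)) v + ∑ i, inner ℂ (toL2 (pd i (fun x => (cutoff (n + 1) x : ℂ) * g x))) (G i)) atTop (𝓝 (inner ℂ (toL2 g) v + ∑ i, inner ℂ (toL2 (pd i g)) (G i))))
    have l2 : Tendsto (fun n : ℕ => inner ℂ (toL2 (fun x => (cutoff (n + 1) x : ℂ) * g x)) x) atTop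
      (𝓝 (inner ℂ (toL2 g) x)) := t1.inner tendsto_const_nhds
    refine tendsto_nhds_unique l1 (l2.congr fun n => ?_)
    exact (hx _ (isTest_cutoff_mul (by positivity) hg)).symm
  have hloc : ∀ u : L2R3, LocallyIntegrable (fun ξ => u ξ) volume := fun u =>
    (Lp.memLp _).locallyIntegrable (by norm_num : (1 : ℝ≥0∞) ≤ 2)
  apply ae_eq_of_integral_contDiff_smul_eq (hloc _)
  · exact (hloc (𝓕 v)).continuous_smul
      (g := fun ξ : R3 => ((1 + (2 * Real.pi * ‖ξ‖) ^ 2 : ℝ) : ℂ)) (by fun_prop)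
  · intro η hη hη'
    have hT : IsTest fun x => (η x : ℂ) :=
      ⟨contDiff_ofReal hη, hη'.comp_left (g := fun t : ℝ => (t : ℂ)) (by simp)⟩
    -- `g` is chosen so that its Fourier transform is the given test function `η`; Plancherel then
    -- gives the identity tested against `η`.
    set g : 𝓢(R3, ℂ) := 𝓕⁻ hT.toSchwartz with hg
    have f0 : 𝓕 (toL2 g) = toL2 fun x => (η x : ℂ) := by
      rw [toL2_schwartz, SchwartzMap.toLp_fourier_eq, hg, FourierTransform.fourier_fourierInv_eq,
        ← toL2_schwartz, hT.coe_toSchwartz]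
    have c0 := coeFn_toL2 hT.memLp
    have p : ∀ u : L2R3, inner ℂ (toL2 g) u = ∫ ξ, η ξ • (𝓕 u : L2R3) ξ := by
      intro u
      rw [← Lp.inner_fourier_eq, f0, L2.inner_def]
      apply integral_congr_ae
      filter_upwards [c0] with ξ h0
      rw [h0, RCLike.inner_apply, Complex.conj_ofReal, Complex.real_smul, mul_comm]
    have q : ∀ i, inner ℂ (toL2 (pd i g)) (G i) =
        ∫ ξ, η ξ • (((2 * Real.pi * ξ i) ^ 2 : ℝ) * (𝓕 v : L2R3) ξ) := by
      intro i
      rw [← Lp.inner_fourier_eq, L2.inner_def]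
      apply integral_congr_ae
      have h1 := fourier_weakGrad (isWeakGrad_toL2_schwartz g) i
      rw [f0] at h1
      filter_upwards [c0, h1, fourier_weakGrad h i] with ξ h0 h1 h2
      rw [h1, h2, h0, RCLike.inner_apply, Complex.real_smul]
      simp only [map_mul, Complex.conj_ofReal, Complex.conj_I, map_ofNat]
      push_cast
      linear_combination (-4 * Real.pi ^ 2 * ξ i ^ 2 * (𝓕 v : L2R3) ξ * η ξ : ℂ) * Complex.I_sq
    have hi : ∀ F : R3 → ℂ, LocallyIntegrable F volume → Integrable (fun ξ => η ξ • F ξ) volume :=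
      fun F hF => hF.integrable_smul_left_of_hasCompactSupport hη.continuous hη'
    have hv := hS g
    rw [p, p] at hv
    simp only [q] at hv
    rw [← hv, ← integral_finsetSum, ← integral_add]
    · apply integral_congr_ae
      filter_upwards with ξ
      rw [← Finset.smul_sum, ← smul_add, ← Finset.sum_mul, EuclideanSpace.norm_eq, mul_pow,
        Real.sq_sqrt (by positivity)]
      congr 1
      simp only [Fin.sum_univ_three, Real.norm_eq_abs, sq_abs]
      push_cast
      ring
    · exact hi _ (hloc _)
    · apply integrable_finsetSum
      intro i _
      exact hi _ ((hloc (𝓕 v)).continuous_smul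
        (g := fun ξ : R3 => (((2 * Real.pi * ξ i) ^ 2 : ℝ) : ℂ)) (by fun_prop))
    · intro i _
      exact hi _ ((hloc (𝓕 v)).continuous_smul
        (g := fun ξ : R3 => (((2 * Real.pi * ξ i) ^ 2 : ℝ) : ℂ)) (by fun_prop))

end Fourier

/-! ### Density of test functions in `H¹`. -/

section Density

/-- The test functions, as a subspace of `H¹`. -/
def testSubmodule : Submodule ℂ H1 where
  carrier := {v | ∃ φ, ∃ h : IsTest φ, v = h.toH1}
  add_mem' := by
    rintro _ _ ⟨φ, h, rfl⟩ ⟨ψ, h', rfl⟩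
    have hs : IsTest fun x => φ x + ψ x := ⟨h.1.add h'.1, h.2.add h'.2⟩
    refine ⟨_, hs, ?_⟩
    have e0 : toL2 (fun x => φ x + ψ x) = toL2 φ + toL2 ψ := by
      apply toL2_eq
      filter_upwards [Lp.coeFn_add (toL2 φ) (toL2 ψ), coeFn_toL2 h.memLp, coeFn_toL2 h'.memLp]
        with x h1 h2 h3
      rw [h1, Pi.add_apply, h2, h3]
    have e1 : ∀ i, toL2 (pd i fun x => φ x + ψ x) = toL2 (pd i φ) + toL2 (pd i ψ) := by
      intro i
      apply toL2_eq
      filter_upwards [Lp.coeFn_add (toL2 (pd i φ)) (toL2 (pd i ψ)), coeFn_toL2 (h.pd i).memLp,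
        coeFn_toL2 (h'.pd i).memLp] with x h1 h2 h3
      rw [h1, Pi.add_apply, h2, h3]
      unfold pd
      rw [fderiv_fun_add (h.1.differentiable (by simp) x) (h'.1.differentiable (by simp) x)]
      rfl
    apply H1.ext
    · simp [e0]
    · simp [e1]
  zero_mem' := by
    have h0 : IsTest fun _ => 0 := ⟨contDiff_const, HasCompactSupport.zero⟩
    refine ⟨_, h0, ?_⟩
    have e0 : toL2 (fun _ => 0) = 0 := toL2_eq (Lp.coeFn_zero _ _ _)
    have e1 : ∀ i, pd i (fun _ : R3 => (0 : ℂ)) = fun _ => 0 := by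
      intro i
      ext x
      simp [pd]
    apply H1.ext
    · simp [e0]
    · simp [e1, e0]
  smul_mem' := by
    rintro c _ ⟨φ, h, rfl⟩
    have hs : IsTest fun x => c * φ x := ⟨contDiff_const.mul h.1, h.2.mul_left⟩
    refine ⟨_, hs, ?_⟩
    have e0 : toL2 (fun x => c * φ x) = c • toL2 φ := by
      apply toL2_eq
      filter_upwards [Lp.coeFn_smul c (toL2 φ), coeFn_toL2 h.memLp] with x h1 h2
      rw [h1, Pi.smul_apply, h2, smul_eq_mul]
    have e1 : ∀ i, toL2 (pd i fun x => c * φ x) = c • toL2 (pd i φ) := by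
      intro i
      apply toL2_eq
      filter_upwards [Lp.coeFn_smul c (toL2 (pd i φ)), coeFn_toL2 (h.pd i).memLp] with x h1 h2
      rw [h1, Pi.smul_apply, h2, smul_eq_mul]
      unfold pd
      rw [fderiv_const_mul (h.1.differentiable (by simp) x)]
      rfl
    apply H1.ext
    · simp [e0]
    · simp [e1]

/-- A vector orthogonal to all test functions solves `(1 - Δ) v = 0`, and the symbol `1 + |2πξ|²`
has no zero. -/
theorem dense_testSubmodule : testSubmodule.topologicalClosure = ⊤ := by
  rw [Submodule.topologicalClosure_eq_top_iff, Submodule.eq_bot_iff]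
  intro v hv
  rw [Submodule.mem_orthogonal] at hv
  have h := fourier_of_forall_test (isWeakGrad_grad v) (x := 0) (by
    intro φ hφ
    have h1 := hv _ ⟨φ, hφ, rfl⟩
    rw [inner_H1, PiLp.inner_apply] at h1
    rw [inner_zero_right]
    exact h1)
  have h0 : 𝓕 (embL2 v) = (0 : L2R3) := by
    apply Lp.ext
    have hz : (𝓕 (0 : L2R3) : L2R3) = 0 := by
      rw [← norm_eq_zero, Lp.norm_fourier_eq, norm_zero]
    rw [hz] at h
    filter_upwards [h, Lp.coeFn_zero ℂ 2 (volume : Measure R3)] with ξ h1 h2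
    rw [h2] at h1 ⊢
    have h3 : ((1 + (2 * Real.pi * ‖ξ‖) ^ 2 : ℝ) : ℂ) ≠ 0 := by
      rw [Complex.ofReal_ne_zero]
      positivity
    exact ((mul_eq_zero.1 h1.symm).resolve_left h3)
  have hg : ∀ i, grad v i = 0 := by
    intro i
    have h1 := fourier_weakGrad (isWeakGrad_grad v) i
    rw [h0] at h1
    have h2 : 𝓕 (grad v i) = (0 : L2R3) := by
      apply Lp.ext
      filter_upwards [h1, Lp.coeFn_zero ℂ 2 (volume : Measure R3)] with ξ h1 h2
      rw [h1, h2]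
      simp
    rw [← norm_eq_zero, ← Lp.norm_fourier_eq, h2, norm_zero]
  have h1 : ‖v‖ ^ 2 = 0 := by
    rw [norm_sq_H1, PiLp.norm_sq_eq_of_L2]
    simp only [hg]
    rw [← Lp.norm_fourier_eq, h0]
    simp
  exact norm_eq_zero.1 (by simpa using h1)

/-- Density as an induction principle: relations continuous in `v` need to be checked on test
functions only. -/
theorem H1_induction {p : H1 → Prop} (hc : IsClosed {v | p v})
    (ht : ∀ φ (h : IsTest φ), p h.toH1) (v : H1) : p v := by
  have h1 : v ∈ testSubmodule.topologicalClosure := by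
    rw [dense_testSubmodule]
    trivial
  have h2 : closure (testSubmodule : Set H1) ⊆ {v | p v} := by
    apply closure_minimal _ hc
    rintro _ ⟨φ, h, rfl⟩
    exact ht φ h
  exact h2 h1

theorem denseRange_embL2 : DenseRange embL2 := by
  have h : Set.range (SchwartzMap.toLpCLM ℂ (E := R3) ℂ 2 volume) ⊆ Set.range embL2 := by
    rintro _ ⟨g, rfl⟩
    exact ⟨(isWeakGrad_schwartz g).toH1, rfl⟩
  exact (SchwartzMap.denseRange_toLpCLM (by norm_num)).mono h

end Density

/-! ### Products of `H¹` functions with smooth bounded functions. -/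

section ProductRule

/-- The operator of multiplication by a bounded real function. -/
abbrev rmul (a : R3 → ℝ) : L2R3 →L[ℂ] L2R3 := mulOp fun x => (a x : ℂ)

/-- `a` is smooth, and `a` and its first derivatives are bounded. -/
structure IsMultiplier (a : R3 → ℝ) : Prop where
  contDiff : ContDiff ℝ ∞ a
  bdd : IsBddMul fun x => (a x : ℂ)
  bdd_pd : ∀ i, IsBddMul fun x => ((pd i a x : ℝ) : ℂ)

theorem IsMultiplier.isWeakGrad {a : R3 → ℝ} (ha : IsMultiplier a) (v : H1) :
    IsWeakGrad (rmul a (embL2 v)) fun i => rmul a (grad v i) + rmul (pd i a) (embL2 v) := by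
  induction v using H1_induction with
  | hc =>
    have hcont : Continuous fun v : H1 => (WithLp.toLp 2 (rmul a (embL2 v),
        WithLp.toLp 2 fun i => rmul a (grad v i) + rmul (pd i a) (embL2 v)) :
          WithLp 2 (L2R3 × PiLp 2 fun _ : Fin 3 => L2R3)) := by
      fun_prop
    exact isClosed_sobolevGraph.preimage hcont
  | ht φ h =>
    have h1 := isWeakGrad_test (h.mul_left (contDiff_ofReal ha.contDiff))
    rw [← mulOp_toL2 ha.bdd h.memLp] at h1
    simp only [toL2_pd_mul ha.contDiff ha.bdd _ (ha.bdd_pd _) h.1 h.memLp (h.pd _).memLp] at h1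
    exact h1

/-- Multiplication of an element of `H¹` by a smooth bounded function. -/
def IsMultiplier.smul {a : R3 → ℝ} (ha : IsMultiplier a) (v : H1) : H1 := (ha.isWeakGrad v).toH1

@[simp]
theorem IsMultiplier.embL2_smul {a : R3 → ℝ} (ha : IsMultiplier a) (v : H1) :
    embL2 (ha.smul v) = rmul a (embL2 v) := rfl

@[simp]
theorem IsMultiplier.grad_smul {a : R3 → ℝ} (ha : IsMultiplier a) (v : H1) (i : Fin 3) :
    grad (ha.smul v) i = rmul a (grad v i) + rmul (pd i a) (embL2 v) := rfl

theorem isMultiplier_cutoff {ρ : ℝ} (hρ : 0 < ρ) : IsMultiplier (cutoff ρ) :=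
  ⟨contDiff_cutoff ρ, isBddMul_cutoff ρ, isBddMul_pd_cutoff hρ⟩

end ProductRule

/-! ### Hardy's inequality. -/

section Hardy

theorem pd_mul_real {f g : R3 → ℝ} {x : R3} (hf : DifferentiableAt ℝ f x)
    (hg : DifferentiableAt ℝ g x) (i : Fin 3) :
    pd i (fun y => f y * g y) x = f x * pd i g x + pd i f x * g x := by
  unfold pd
  rw [fderiv_fun_mul hf hg]
  simp only [add_apply, smul_apply, smul_eq_mul]
  ring

theorem pd_coord (i j : Fin 3) (x : R3) : pd i (fun y : R3 => y j) x = if i = j then 1 else 0 := by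
  have h : HasFDerivAt (fun y : R3 => y j) (EuclideanSpace.proj j : R3 →L[ℝ] ℝ) x :=
    (EuclideanSpace.proj j : R3 →L[ℝ] ℝ).hasFDerivAt
  unfold pd
  rw [h.fderiv]
  simp [eq_comm]

theorem pd_norm_sq {φ : R3 → ℂ} {x : R3} (h : DifferentiableAt ℝ φ x) (i : Fin 3) :
    pd i (fun y => ‖φ y‖ ^ 2) x = 2 * inner ℝ (φ x) (pd i φ x) := by
  unfold pd
  rw [h.hasFDerivAt.norm_sq.fderiv]
  simp
  ring

theorem integral_pd_eq_zero {F : R3 → ℝ} (h : ContDiff ℝ 1 F) (hc : HasCompactSupport F)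
    (i : Fin 3) : ∫ x, pd i F x = 0 := by
  have h1 : Continuous (pd i F) := (h.continuous_fderiv (by simp)).clm_apply continuous_const
  have h2 : HasCompactSupport (pd i F) := hc.fderiv_apply ℝ (unitVec i)
  have h3 := integral_mul_fderiv_eq_neg_fderiv_mul_of_integrable (𝕜 := ℝ) (μ := (volume : Measure R3))
    (f := F) (g := fun _ => 1) (v := unitVec i)
    (by simp only [mul_one]; exact h1.integrable_of_hasCompactSupport h2) (by simp)
    (by simpa using h.continuous.integrable_of_hasCompactSupport hc)
    (fun x _ => h.differentiable (by simp) x) (fun x _ => differentiableAt_const _)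
  simp only [mul_one, fderiv_fun_const, Pi.zero_apply, zero_apply, mul_zero,
    integral_zero] at h3
  exact neg_eq_zero.1 h3.symm

theorem norm_sq_eq_sum (x : R3) : ‖x‖ ^ 2 = ∑ i, x i ^ 2 := by
  rw [EuclideanSpace.norm_sq_eq]
  simp

/-- The divergence of `|φ|² x / (|x|² + δ)` integrates to zero. In dimension three `x / (|x|² + δ)`
has divergence at least `(|x|² + δ)⁻¹`; half of this absorbs the cross term and half remains, which
yields the constant `4`. The shift by `δ` keeps the field smooth. -/
theorem hardy_test {φ : R3 → ℂ} (h : IsTest φ) {δ : ℝ} (hδ : 0 < δ) :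
    ∫ x, ‖φ x‖ ^ 2 / (‖x‖ ^ 2 + δ) ≤ 4 * ∫ x, ∑ i, ‖pd i φ x‖ ^ 2 := by
  have hq : ∀ x : R3, 0 < ‖x‖ ^ 2 + δ := fun x => by positivity
  have hφ : ContDiff ℝ ∞ fun x => ‖φ x‖ ^ 2 := h.1.norm_sq ℝ
  have hinv : ContDiff ℝ ∞ fun x : R3 => (‖x‖ ^ 2 + δ)⁻¹ :=
    ((contDiff_norm_sq ℝ).add contDiff_const).inv fun x => (hq x).ne'
  have hco : ∀ i, ContDiff ℝ ∞ fun y : R3 => y i := fun i =>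
    (EuclideanSpace.proj i : R3 →L[ℝ] ℝ).contDiff
  have hX : ∀ i, ContDiff ℝ ∞ fun y : R3 => y i * (‖y‖ ^ 2 + δ)⁻¹ := fun i => (hco i).mul hinv
  have hcs : HasCompactSupport fun x => ‖φ x‖ ^ 2 := by
    exact h.2.comp_left (g := fun z : ℂ => ‖z‖ ^ 2) (by simp)
  have hF : ∀ i, ContDiff ℝ ∞ fun y : R3 => y i * (‖y‖ ^ 2 + δ)⁻¹ * ‖φ y‖ ^ 2 := fun i =>
    (hX i).mul hφ
  have hFc : ∀ i, HasCompactSupport fun y : R3 => y i * (‖y‖ ^ 2 + δ)⁻¹ * ‖φ y‖ ^ 2 := fun i =>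
    hcs.mul_left
  have hint : ∀ i, Integrable (pd i fun y : R3 => y i * (‖y‖ ^ 2 + δ)⁻¹ * ‖φ y‖ ^ 2) volume :=
    fun i => (contDiff_pd (hF i) i).continuous.integrable_of_hasCompactSupport
      ((hFc i).fderiv_apply ℝ (unitVec i))
  have hz : ∫ x, ∑ i, pd i (fun y : R3 => y i * (‖y‖ ^ 2 + δ)⁻¹ * ‖φ y‖ ^ 2) x = 0 := by
    rw [integral_finsetSum _ fun i _ => hint i]
    apply Finset.sum_eq_zero
    intro i _
    exact integral_pd_eq_zero ((hF i).of_le (by simp)) (hFc i) i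
  have hd1 : Integrable (fun x => ‖φ x‖ ^ 2 / (‖x‖ ^ 2 + δ)) volume := by
    apply Continuous.integrable_of_hasCompactSupport
    · simp only [div_eq_mul_inv]
      exact (hφ.mul hinv).continuous
    · simp only [div_eq_mul_inv]
      exact hcs.mul_right
  have hd2 : Integrable (fun x => ∑ i, ‖pd i φ x‖ ^ 2) volume := by
    apply integrable_finsetSum
    intro i _
    apply Continuous.integrable_of_hasCompactSupport
    · exact (h.pd i).1.continuous.norm.pow 2
    · exact (h.pd i).2.comp_left (g := fun z : ℂ => ‖z‖ ^ 2) (by simp)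
  have hpt : ∀ x, ‖φ x‖ ^ 2 / (‖x‖ ^ 2 + δ) * (1 / 2) - 2 * ∑ i, ‖pd i φ x‖ ^ 2 ≤
      ∑ i, pd i (fun y : R3 => y i * (‖y‖ ^ 2 + δ)⁻¹ * ‖φ y‖ ^ 2) x := by
    intro x
    -- The coefficient `-5/2` is `-2` from differentiating the weight and `-1/2` from Young's
    -- inequality for the cross term, whose other part is `2 ‖∂_i φ‖²`.
    have e : ∀ i, x i ^ 2 * (-(5 / 2)) * ‖φ x‖ ^ 2 * ((‖x‖ ^ 2 + δ)⁻¹) ^ 2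
          + (‖x‖ ^ 2 + δ)⁻¹ * ‖φ x‖ ^ 2 - 2 * ‖pd i φ x‖ ^ 2 ≤
        pd i (fun y : R3 => y i * (‖y‖ ^ 2 + δ)⁻¹ * ‖φ y‖ ^ 2) x := by
      intro i
      have hdq : HasDerivAt (fun s : ℝ => (s + δ)⁻¹) (-1 / (‖x‖ ^ 2 + δ) ^ 2) (‖x‖ ^ 2) :=
        ((hasDerivAt_id _).add_const δ).fun_inv (hq x).ne'
      rw [pd_mul_real ((hX i).differentiable (by simp) x) (hφ.differentiable (by simp) x),
        pd_mul_real ((hco i).differentiable (by simp) x) (hinv.differentiable (by simp) x),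
        pd_norm_sq (h.1.differentiable (by simp) x), pd_coord,
        pd_comp_norm_sq (f := fun s => (s + δ)⁻¹) hdq.differentiableAt, hdq.deriv, if_pos rfl]
      have hi := abs_real_inner_le_norm (φ x) (pd i φ x)
      set I := inner ℝ (φ x) (pd i φ x)
      set p := ‖φ x‖
      set d := ‖pd i φ x‖
      set Q := (‖x‖ ^ 2 + δ)⁻¹
      have eQ : -1 / (‖x‖ ^ 2 + δ) ^ 2 = -Q ^ 2 := by
        rw [neg_div, one_div, inv_pow]
      rw [eQ]
      have h1 : -(|x i| * Q * (p * d)) ≤ x i * Q * I := by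
        have hQ : 0 < Q := inv_pos.2 (hq x)
        have : |x i * Q * I| ≤ |x i| * Q * (p * d) := by
          rw [abs_mul, abs_mul, abs_of_pos hQ]
          gcongr
        exact neg_le_of_abs_le this
      have h2 : 0 ≤ (|x i| * Q * p - 2 * d) ^ 2 := sq_nonneg _
      have h3 : (|x i| * Q * p - 2 * d) ^ 2 =
          x i ^ 2 * Q ^ 2 * p ^ 2 - 4 * (|x i| * Q * (p * d)) + 4 * d ^ 2 := by
        rw [← sq_abs (x i)]
        ring
      nlinarith
    refine le_trans ?_ (Finset.sum_le_sum fun i _ => e i)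
    rw [Finset.sum_sub_distrib, Finset.sum_add_distrib, ← Finset.sum_mul, ← Finset.sum_mul,
      ← Finset.sum_mul, ← norm_sq_eq_sum, Finset.mul_sum]
    simp only [Finset.sum_const, Finset.card_univ, Fintype.card_fin, nsmul_eq_mul]
    have h1 : ‖x‖ ^ 2 * ((‖x‖ ^ 2 + δ)⁻¹) ≤ 1 := by
      rw [← div_eq_mul_inv, div_le_one (hq x)]
      linarith
    have h2 : 0 ≤ ‖φ x‖ ^ 2 * (‖x‖ ^ 2 + δ)⁻¹ := by
      have := hq x
      positivity
    have h3 := mul_le_mul_of_nonneg_right h1 h2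
    rw [div_eq_mul_inv]
    push_cast
    nlinarith
  have hI := integral_mono ((hd1.mul_const _).sub (hd2.const_mul _))
    (integrable_finsetSum Finset.univ fun i _ => hint i) hpt
  rw [hz] at hI
  have : ∫ x, (‖φ x‖ ^ 2 / (‖x‖ ^ 2 + δ) * (1 / 2) - 2 * ∑ i, ‖pd i φ x‖ ^ 2) =
      (∫ x, ‖φ x‖ ^ 2 / (‖x‖ ^ 2 + δ)) * (1 / 2) - 2 * ∫ x, ∑ i, ‖pd i φ x‖ ^ 2 := by
    rw [integral_sub (hd1.mul_const _) (hd2.const_mul _), integral_mul_const, integral_const_mul]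
  simp only [Pi.sub_apply] at hI
  rw [this] at hI
  linarith

/-- The weight in Hardy's inequality. -/
def hardyWeight (δ : ℝ) (x : R3) : ℝ := (Real.sqrt (‖x‖ ^ 2 + δ))⁻¹

theorem isBddMul_hardyWeight {δ : ℝ} (hδ : 0 < δ) : IsBddMul fun x => (hardyWeight δ x : ℂ) := by
  apply IsBddMul.ofReal (C := (Real.sqrt δ)⁻¹)
  · unfold hardyWeight
    fun_prop
  · intro x
    unfold hardyWeight
    rw [abs_of_nonneg (by positivity)]
    have h1 : 0 < Real.sqrt δ := Real.sqrt_pos.2 hδ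
    have h2 : Real.sqrt δ ≤ Real.sqrt (‖x‖ ^ 2 + δ) := Real.sqrt_le_sqrt (by nlinarith [sq_nonneg ‖x‖])
    exact inv_anti₀ h1 h2

/-- Hardy's inequality. -/
theorem hardy {δ : ℝ} (hδ : 0 < δ) (v : H1) :
    ‖rmul (hardyWeight δ) (embL2 v)‖ ^ 2 ≤ 4 * ‖grad v‖ ^ 2 := by
  induction v using H1_induction with
  | hc => exact isClosed_le (by fun_prop) (by fun_prop)
  | ht φ h =>
    have h1 := hardy_test h hδ
    have hb := isBddMul_hardyWeight hδ
    rw [PiLp.norm_sq_eq_of_L2, norm_sq_eq_integral]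
    simp only [IsTest.grad_toH1, IsTest.embL2_toH1]
    have e1 : ∀ i, ‖toL2 (pd i φ)‖ ^ 2 = ∫ x, ‖pd i φ x‖ ^ 2 := fun i =>
      norm_toL2_sq (h.pd i).memLp
    simp only [e1]
    rw [← integral_finsetSum]
    · refine le_trans (le_of_eq ?_) h1
      apply integral_congr_ae
      filter_upwards [coeFn_mulOp hb (toL2 φ), coeFn_toL2 h.memLp] with x h2 h3
      rw [h2, h3, norm_mul, Complex.norm_real, mul_pow, Real.norm_eq_abs, sq_abs, hardyWeight,
        inv_pow, Real.sq_sqrt (by positivity)]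
      ring
    · intro i _
      apply Continuous.integrable_of_hasCompactSupport
      · exact (h.pd i).1.continuous.norm.pow 2
      · exact (h.pd i).2.comp_left (g := fun z : ℂ => ‖z‖ ^ 2) (by simp)

end Hardy

/-! ### Functional calculus under star homomorphisms. -/

section RealCalculus

/-- The real continuous functional calculus of a C⋆-algebra. -/
def fcalc {A : Type*} [CStarAlgebra A] (g : ℝ → ℝ) (a : A) : A := cfc g a

open scoped CStarAlgebra in
theorem map_fcalc {A B : Type*} [CStarAlgebra A] [CStarAlgebra B] (φ : A →⋆ₐ[ℂ] B) {g : ℝ → ℝ}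
    (hg : Continuous g) {a : A} (ha : IsSelfAdjoint a) : φ (fcalc g a) = fcalc g (φ a) :=
  StarAlgHom.map_cfc (S := ℂ) φ g a hg.continuousOn (map_continuous φ) ha (ha.map φ)

theorem fcalc_ofReal (g : ℝ → ℝ) (r : ℝ) : fcalc g (r : ℂ) = (g r : ℂ) :=
  cfc_algebraMap r g

theorem fcalc_eq_cfc {H : Type*} [NormedAddCommGroup H] [InnerProductSpace ℂ H] [CompleteSpace H]
    (g : ℝ → ℝ) (R : H →L[ℂ] H) : fcalc g R = cfc g R := rfl

theorem IsFormResolvent.fcalc_congr {H V K : Type*} [NormedAddCommGroup H] [InnerProductSpace ℂ H]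
    [CompleteSpace H] [NormedAddCommGroup V] [InnerProductSpace ℂ V] [CompleteSpace V]
    [NormedAddCommGroup K] [InnerProductSpace ℂ K] [CompleteSpace K] {ι : V →L[ℂ] H}
    {ℓ : V →L[ℂ] K} {R : H →L[ℂ] H} (hR : IsFormResolvent ι ℓ R) {g g' : ℝ → ℝ}
    (h : Set.EqOn g g' (Set.Icc 0 1)) : fcalc g R = fcalc g' R :=
  cfc_congr fun _ hx => h (hR.spectrum_subset hx)

end RealCalculus

/-! ### Functional calculus of `(1 - Δ)⁻¹` and the homogeneous Sobolev norms. -/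

section FourierCalculus

open scoped BoundedContinuousFunction

theorem isBddMul_bcf (b : R3 →ᵇ ℂ) : IsBddMul b :=
  ⟨b.continuous.aestronglyMeasurable, ‖b‖, b.norm_coe_le_norm⟩

/-- The representation of bounded continuous functions by multiplication operators. -/
def mulOpHom : (R3 →ᵇ ℂ) →⋆ₐ[ℂ] (L2R3 →L[ℂ] L2R3) where
  toFun b := mulOp b
  map_one' := by
    ext1 u
    exact (mulOp_const_apply 1 u).trans (one_smul _ _)
  map_mul' a b := by
    ext1 u
    exact mulOp_mul_apply (isBddMul_bcf a) (isBddMul_bcf b) u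
  map_zero' := by
    ext1 u
    exact (mulOp_const_apply 0 u).trans (zero_smul _ _)
  map_add' a b := by
    ext1 u
    exact mulOp_add_apply (isBddMul_bcf a) (isBddMul_bcf b) u
  commutes' c := by
    ext1 u
    exact mulOp_const_apply c u
  map_star' b := by
    refine (ContinuousLinearMap.eq_adjoint_iff _ _).2 fun u v => ?_
    have h : (fun x => (starRingEnd ℂ) ((star b : R3 →ᵇ ℂ) x)) = b := by
      ext x
      simp
    rw [inner_mulOp_left (isBddMul_bcf (star b)), h]

/-- Star homomorphisms commute with the functional calculus. Point evaluations compute it for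
bounded functions, and `mulOpHom` carries the result to operators. -/
theorem mulOpHom_fcalc {a : R3 →ᵇ ℂ} {r : R3 → ℝ} (ha : ∀ ξ, a ξ = r ξ) {g : ℝ → ℝ}
    (hg : Continuous g) (u : L2R3) :
    (fcalc g (mulOpHom a) u : R3 → ℂ) =ᵐ[volume] fun ξ => (g (r ξ) : ℂ) * u ξ := by
  have hsa : IsSelfAdjoint a := by
    ext ξ
    simp [ha]
  rw [← map_fcalc mulOpHom hg hsa]
  have hp : ∀ ξ, (fcalc g a : R3 →ᵇ ℂ) ξ = g (r ξ) := by
    intro ξ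
    let ev : (R3 →ᵇ ℂ) →⋆ₐ[ℂ] ℂ :=
      { toFun := fun b => b ξ
        map_one' := rfl
        map_mul' := fun _ _ => rfl
        map_zero' := rfl
        map_add' := fun _ _ => rfl
        commutes' := fun _ => rfl
        map_star' := fun _ => rfl }
    have h1 := map_fcalc ev hg hsa
    have h2 : ev a = (r ξ : ℂ) := ha ξ
    rw [h2, fcalc_ofReal] at h1
    exact h1
  filter_upwards [coeFn_mulOp (isBddMul_bcf (fcalc g a)) u] with ξ h
  refine h.trans ?_
  rw [hp]

/-- The symbol of `-Δ`. -/
def lapSymbol (ξ : R3) : ℝ := (2 * Real.pi * ‖ξ‖) ^ 2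

theorem lapSymbol_nonneg (ξ : R3) : 0 ≤ lapSymbol ξ := sq_nonneg _

/-- The symbol of `(1 - Δ)⁻¹`. -/
def resSymbol (ξ : R3) : ℝ := (1 + lapSymbol ξ)⁻¹

theorem resSymbol_mem (ξ : R3) : resSymbol ξ ∈ Set.Icc (0 : ℝ) 1 := by
  have h := lapSymbol_nonneg ξ
  exact ⟨by unfold resSymbol; positivity, inv_le_one_of_one_le₀ (by linarith)⟩

theorem continuous_resSymbol : Continuous resSymbol := by
  unfold resSymbol lapSymbol
  exact Continuous.inv₀ (by fun_prop) fun ξ => by positivity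

/-- The symbol of `(1 - Δ)⁻¹` as a bounded continuous function. -/
def resBCF : R3 →ᵇ ℂ :=
  BoundedContinuousFunction.ofNormedAddCommGroup (fun ξ => (resSymbol ξ : ℂ))
    (Complex.continuous_ofReal.comp continuous_resSymbol) 1 fun ξ => by
      rw [Complex.norm_real, Real.norm_of_nonneg (resSymbol_mem ξ).1]
      exact (resSymbol_mem ξ).2

theorem fourier_formResolvent {R : L2R3 →L[ℂ] L2R3} (hR : IsFormResolvent embL2 grad R)
    (x : L2R3) : (𝓕 (R x) : L2R3) = mulOpHom resBCF (𝓕 x) := by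
  obtain ⟨v, hv, hw⟩ := hR x
  have h := fourier_of_forall_test (isWeakGrad_grad v) (x := x) fun φ hφ => by
    have := hw hφ.toH1
    rw [PiLp.inner_apply] at this
    exact this
  rw [hv] at h
  apply Lp.ext
  filter_upwards [h, coeFn_mulOp (isBddMul_bcf resBCF) (𝓕 x)] with ξ h1 h2
  refine Eq.trans ?_ h2.symm
  have h3 : ((1 + (2 * Real.pi * ‖ξ‖) ^ 2 : ℝ) : ℂ) ≠ 0 := by
    rw [Complex.ofReal_ne_zero]
    positivity
  change _ = (((1 + (2 * Real.pi * ‖ξ‖) ^ 2)⁻¹ : ℝ) : ℂ) * _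
  rw [h1, Complex.ofReal_inv, inv_mul_cancel_left₀ h3]

/-- The functional calculus of `(1 - Δ)⁻¹` in terms of the Fourier transform. -/
theorem fourier_fcalc {R : L2R3 →L[ℂ] L2R3} (hR : IsFormResolvent embL2 grad R) {g : ℝ → ℝ}
    (hg : ContinuousOn g (Set.Icc 0 1)) (u : L2R3) :
    ((𝓕 (fcalc g R u) : L2R3) : R3 → ℂ) =ᵐ[volume]
      fun ξ => (g (resSymbol ξ) : ℂ) * (𝓕 u : L2R3) ξ := by
  -- Continuity of `g` is known on `[0, 1]` only; composing with the projection gives a continuous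
  -- function on `ℝ` with the same values there.
  set g' : ℝ → ℝ := fun x => g (Set.projIcc 0 1 zero_le_one x) with hg'
  have hc : Continuous g' :=
    (continuousOn_iff_continuous_domRestrict.1 hg).comp continuous_projIcc
  have he : ∀ x ∈ Set.Icc (0 : ℝ) 1, g' x = g x := by
    intro x hx
    simp [hg', Set.projIcc_of_mem zero_le_one hx]
  have e1 : fcalc g R = fcalc g' R := hR.fcalc_congr fun x hx => (he x hx).symm
  set e := Lp.fourierTransformₗᵢ R3 ℂ with hee
  have hsa : IsSelfAdjoint R := hR.isSelfAdjoint
  -- Conjugation by the Fourier transform is a star homomorphism that turns `R` into multiplication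
  -- by `resSymbol`.
  set Θ : (L2R3 →L[ℂ] L2R3) →⋆ₐ[ℂ] (L2R3 →L[ℂ] L2R3) := 
    { toFun := e.conjStarAlgEquiv
      map_one' := map_one _
      map_mul' := map_mul _
      map_zero' := map_zero _
      map_add' := map_add _
      commutes' := fun c => by
        rw [Algebra.algebraMap_eq_smul_one, map_smul, map_one]
      map_star' := map_star _ }
  have e2 : Θ R = mulOpHom resBCF := by
    ext1 x
    change 𝓕 (R (e.symm x)) = _
    rw [fourier_formResolvent hR]
    congr 1
    exact e.apply_symm_apply x
  have e3 : Θ (fcalc g' R) = fcalc g' (Θ R) :=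
    map_fcalc Θ hc hsa
  have e4 : 𝓕 (fcalc g R u) = Θ (fcalc g' R) (𝓕 u) := by
    rw [e1]
    change e _ = e (fcalc g' R (e.symm (e u)))
    rw [e.symm_apply_apply]
  rw [e4, e3, e2]
  filter_upwards [mulOpHom_fcalc (a := resBCF) (r := resSymbol) (fun ξ => rfl) hc (𝓕 u)] with ξ h
  rw [h, he _ (resSymbol_mem ξ)]

theorem enorm_fcalc {R : L2R3 →L[ℂ] L2R3} (hR : IsFormResolvent embL2 grad R) {g : ℝ → ℝ}
    (hg : ContinuousOn g (Set.Icc 0 1)) (u : L2R3) :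
    ‖fcalc g R u‖ₑ = eLpNorm (fun ξ => (g (resSymbol ξ) : ℂ) * (𝓕 u : L2R3) ξ) 2 volume := by
  rw [← eLpNorm_congr_ae (fourier_fcalc hR hg u), ← Lp.enorm_def]
  simp only [enorm_eq_iff_norm_eq, Lp.norm_fourier_eq]

theorem ae_ne_zero : ∀ᵐ ξ : R3, ξ ≠ 0 := by
  simp [ae_iff, measure_singleton]

theorem symbol_quotient (ξ : R3) : (1 - resSymbol ξ) / resSymbol ξ = lapSymbol ξ := by
  have h := lapSymbol_nonneg ξ
  unfold resSymbol
  field_simp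
  ring

theorem lapSymbol_rpow (s : ℝ) (ξ : R3) : lapSymbol ξ ^ (s / 2) = (2 * Real.pi * ‖ξ‖) ^ s := by
  have h : (0 : ℝ) ≤ 2 * Real.pi * ‖ξ‖ := by positivity
  rw [lapSymbol, ← Real.rpow_natCast, ← Real.rpow_mul h]
  congr 1
  push_cast
  ring

theorem resSymbol_ne_zero (ξ : R3) : resSymbol ξ ≠ 0 := by
  have h := lapSymbol_nonneg ξ
  unfold resSymbol
  positivity

theorem resSymbol_ne_one {ξ : R3} (hξ : ξ ≠ 0) : resSymbol ξ ≠ 1 := by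
  have h : 0 < lapSymbol ξ := by
    unfold lapSymbol
    positivity
  unfold resSymbol
  rw [Ne, inv_eq_one]
  linarith

theorem tendsto_symbol (s : ℝ) {ξ : R3} (hξ : ξ ≠ 0) :
    Tendsto (fun ε => regFun (s / 2) ε (resSymbol ξ)) (𝓝[>] 0)
      (𝓝 ((2 * Real.pi * ‖ξ‖) ^ s)) := by
  rw [← lapSymbol_rpow, ← symbol_quotient]
  exact tendsto_regFun (resSymbol_mem ξ) (fun _ => resSymbol_ne_zero ξ) fun _ => resSymbol_ne_one hξ

theorem measurable_symbol (s ε : ℝ) : Measurable fun ξ => (regFun (s / 2) ε (resSymbol ξ) : ℂ) := by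
  apply Complex.measurable_ofReal.comp
  have := continuous_resSymbol.measurable
  unfold regFun
  fun_prop

/-- Fatou's lemma. Finiteness of `hDotNorm` is not assumed, so this also proves it. -/
theorem hDotNorm_le_of_eventually {R : L2R3 →L[ℂ] L2R3} (hR : IsFormResolvent embL2 grad R)
    {s : ℝ} {u : L2R3} {C : ℝ≥0∞}
    (hC : ∀ᶠ ε in 𝓝[>] (0 : ℝ), ‖fcalc (regFun (s / 2) ε) R u‖ₑ ≤ C) : hDotNorm s u ≤ C := by
  apply Lp.eLpNorm_le_of_ae_tendsto (u := 𝓝[>] (0 : ℝ))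
    (f := fun ε ξ => (regFun (s / 2) ε (resSymbol ξ) : ℂ) * (𝓕 u : L2R3) ξ)
  · filter_upwards [hC, self_mem_nhdsWithin] with ε h1 h2
    rwa [← enorm_fcalc hR (continuousOn_regFun _ h2)]
  · intro ε
    exact (measurable_symbol s ε).aestronglyMeasurable.mul (Lp.aestronglyMeasurable _)
  · filter_upwards [ae_ne_zero] with ξ hξ
    exact ((Complex.continuous_ofReal.tendsto _).comp (tendsto_symbol s hξ)).mul_const _

/-- Dominated convergence: by `regFun_le` the symbols are at most `1 + (2π|ξ|) ^ s`, and both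
summands times the Fourier transform of `u` are square integrable. -/
theorem tendsto_enorm_fcalc_regFun {R : L2R3 →L[ℂ] L2R3} (hR : IsFormResolvent embL2 grad R)
    {s : ℝ} {u : L2R3} (hu : hDotNorm s u < ⊤) :
    Tendsto (fun ε : ℝ => ‖fcalc (regFun (s / 2) ε) R u‖ₑ) (𝓝[>] 0) (𝓝 (hDotNorm s u)) := by
  have hmeas : AEStronglyMeasurable
      (fun ξ : R3 => (((2 * Real.pi * ‖ξ‖) ^ s : ℝ) : ℂ) * (𝓕 u : L2R3) ξ) volume := by
    apply AEStronglyMeasurable.mul _ (Lp.aestronglyMeasurable _)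
    apply Measurable.aestronglyMeasurable
    fun_prop
  have hd := hu
  rw [hDotNorm, eLpNorm_eq_lintegral_rpow_enorm_toReal (by norm_num) (by norm_num)] at hd ⊢
  have hb := (Lp.memLp (𝓕 u : L2R3)).eLpNorm_lt_top
  rw [eLpNorm_eq_lintegral_rpow_enorm_toReal (by norm_num) (by norm_num)] at hb
  have hd' := (ENNReal.rpow_lt_top_iff_of_pos (by norm_num)).1 hd
  have hb' := (ENNReal.rpow_lt_top_iff_of_pos (by norm_num)).1 hb
  have key : Tendsto (fun ε : ℝ => (∫⁻ ξ, ‖(regFun (s / 2) ε (resSymbol ξ) : ℂ) *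
      (𝓕 u : L2R3) ξ‖ₑ ^ ENNReal.toReal 2)) (𝓝[>] 0)
      (𝓝 (∫⁻ ξ, ‖(((2 * Real.pi * ‖ξ‖) ^ s : ℝ) : ℂ) * (𝓕 u : L2R3) ξ‖ₑ ^ ENNReal.toReal 2)) := by
    apply tendsto_lintegral_filter_of_dominated_convergence
      (fun ξ => 2 ^ (ENNReal.toReal 2 - 1) * (‖(𝓕 u : L2R3) ξ‖ₑ ^ ENNReal.toReal 2 +
        ‖(((2 * Real.pi * ‖ξ‖) ^ s : ℝ) : ℂ) * (𝓕 u : L2R3) ξ‖ₑ ^ ENNReal.toReal 2))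
    · filter_upwards with ε
      have h1 := (measurable_symbol s ε).mul (Lp.stronglyMeasurable (𝓕 u : L2R3)).measurable
      exact h1.enorm.pow_const _
    · filter_upwards [self_mem_nhdsWithin] with ε hε
      filter_upwards [ae_ne_zero] with ξ hξ
      refine le_trans ?_ (ENNReal.rpow_add_le_mul_rpow_add_rpow _ _ (by norm_num))
      refine ENNReal.rpow_le_rpow ?_ (by norm_num)
      have h1 := regFun_le (α := s / 2) hε (resSymbol_mem ξ) (fun _ => resSymbol_ne_zero ξ)
        fun _ => resSymbol_ne_one hξ
      rw [symbol_quotient, lapSymbol_rpow] at h1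
      have h2 := (regFun_pos (α := s / 2) hε (resSymbol_mem ξ)).le
      have h3 : 0 ≤ (2 * Real.pi * ‖ξ‖) ^ s := by positivity
      simp only [← ofReal_norm]
      rw [← ENNReal.ofReal_add (norm_nonneg _) (norm_nonneg _)]
      apply ENNReal.ofReal_le_ofReal
      rw [norm_mul, norm_mul, Complex.norm_real, Complex.norm_real, Real.norm_of_nonneg h2,
        Real.norm_of_nonneg h3]
      nlinarith [norm_nonneg ((𝓕 u : L2R3) ξ)]
    · rw [lintegral_const_mul' _ _ (by simp), lintegral_add_left']
      · exact ENNReal.mul_ne_top (by simp) (ENNReal.add_ne_top.2 ⟨hb'.ne, hd'.ne⟩)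
      · exact (Lp.aestronglyMeasurable _).enorm.pow_const _
    · filter_upwards [ae_ne_zero] with ξ hξ
      have h1 := ((Complex.continuous_ofReal.tendsto _).comp (tendsto_symbol s hξ)).mul_const
        ((𝓕 u : L2R3) ξ)
      exact (ENNReal.continuous_rpow_const.tendsto _).comp ((continuous_enorm.tendsto _).comp h1)
  have h2 := ((ENNReal.continuous_rpow_const (y := 1 / ENNReal.toReal 2)).tendsto _).comp key
  refine h2.congr' ?_
  filter_upwards [self_mem_nhdsWithin] with ε hε
  rw [enorm_fcalc hR (continuousOn_regFun _ hε),
    eLpNorm_eq_lintegral_rpow_enorm_toReal (by norm_num) (by norm_num)]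
  rfl

end FourierCalculus

/-! ### Radial coefficients and the function `h`. -/

section Radial

/-- `k` is smooth, and constant near `(-∞, 0]`. -/
structure IsRadialSmooth (k : ℝ → ℝ) : Prop where
  contDiff : ContDiff ℝ ∞ k
  eq_const : ∃ r₀ > 0, ∃ c, ∀ r < r₀, k r = c

theorem IsRadialSmooth.contDiff_norm {k : ℝ → ℝ} (hk : IsRadialSmooth k) :
    ContDiff ℝ ∞ fun x : R3 => k ‖x‖ := by
  obtain ⟨r₀, hr₀, c, hc⟩ := hk.eq_const
  rw [contDiff_iff_contDiffAt]
  intro x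
  by_cases hx : x = 0
  · subst hx
    have : (fun x : R3 => k ‖x‖) =ᶠ[𝓝 0] fun _ => c := by
      filter_upwards [Metric.ball_mem_nhds (0 : R3) hr₀] with y hy
      exact hc _ (by simpa using hy)
    exact contDiffAt_const.congr_of_eventuallyEq this
  · exact hk.contDiff.contDiffAt.comp x (contDiffAt_norm ℝ hx)

theorem pd_comp_norm {k : ℝ → ℝ} {x : R3} (hx : x ≠ 0) (hk : DifferentiableAt ℝ k ‖x‖) (i : Fin 3) :
    pd i (fun y : R3 => k ‖y‖) x = deriv k ‖x‖ * (x i / ‖x‖) := by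
  have h0 : ‖x‖ ≠ 0 := norm_ne_zero_iff.2 hx
  have h1 : (fun y : R3 => k ‖y‖) = fun y => (fun s => k (Real.sqrt s)) (‖y‖ ^ 2) := by
    ext y
    simp
  have h2 : HasDerivAt (fun s => k (Real.sqrt s)) (deriv k ‖x‖ * (1 / (2 * ‖x‖))) (‖x‖ ^ 2) := by
    have h3 := Real.hasDerivAt_sqrt (x := ‖x‖ ^ 2) (by positivity)
    have h4 : HasDerivAt k (deriv k ‖x‖) (Real.sqrt (‖x‖ ^ 2)) := by
      rw [Real.sqrt_sq (norm_nonneg _)]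
      exact hk.hasDerivAt
    have h5 := h4.comp (‖x‖ ^ 2) h3
    rwa [Real.sqrt_sq (norm_nonneg _)] at h5
  rw [h1, pd_comp_norm_sq h2.differentiableAt, h2.deriv]
  field_simp

theorem IsRadialSmooth.pd_norm {k : ℝ → ℝ} (hk : IsRadialSmooth k) (x : R3) (i : Fin 3) :
    pd i (fun y : R3 => k ‖y‖) x = deriv k ‖x‖ * (x i / ‖x‖) := by
  by_cases hx : x = 0
  · subst hx
    obtain ⟨r₀, hr₀, c, hc⟩ := hk.eq_const
    rw [pd_eq_zero_of_eventuallyEq_const (c := c)]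
    · simp
    · filter_upwards [Metric.ball_mem_nhds (0 : R3) hr₀] with y hy
      exact hc _ (by simpa using hy)
  · exact pd_comp_norm hx (hk.contDiff.differentiable (by simp) _) i

theorem abs_coord_div_norm_le (x : R3) (i : Fin 3) : |x i / ‖x‖| ≤ 1 := by
  rw [abs_div, abs_norm]
  exact div_le_one_of_le₀ (abs_coord_le x i) (norm_nonneg _)

/-- A radial function with the decay of the derivative that allows for Hardy's inequality. -/
structure IsRadialMultiplier (k : ℝ → ℝ) : Prop extends IsRadialSmooth k where
  bdd : ∃ C, ∀ r, |k r| ≤ C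
  deriv_le : ∃ C, ∀ r, 0 ≤ r → |deriv k r| ≤ C * (Real.sqrt (r ^ 2 + 1))⁻¹

theorem IsRadialMultiplier.exists_abs_pd_le {k : ℝ → ℝ} (hk : IsRadialMultiplier k) :
    ∃ C, 0 ≤ C ∧ ∀ i x, |pd i (fun y : R3 => k ‖y‖) x| ≤ C * hardyWeight 1 x := by
  obtain ⟨C, hC⟩ := hk.deriv_le
  refine ⟨|C|, abs_nonneg _, fun i x => ?_⟩
  rw [hk.pd_norm, abs_mul]
  have h1 := hC ‖x‖ (norm_nonneg x)
  have h2 : 0 ≤ hardyWeight 1 x := by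
    unfold hardyWeight
    positivity
  calc _ ≤ |deriv k ‖x‖| * 1 := by
        gcongr
        exact abs_coord_div_norm_le x i
    _ ≤ C * hardyWeight 1 x := by
        rw [mul_one]
        exact h1
    _ ≤ _ := mul_le_mul_of_nonneg_right (le_abs_self C) h2

theorem hardyWeight_one_le (x : R3) : hardyWeight 1 x ≤ 1 := by
  unfold hardyWeight
  apply inv_le_one_of_one_le₀
  rw [Real.one_le_sqrt]
  nlinarith [sq_nonneg ‖x‖]

theorem IsRadialMultiplier.isMultiplier {k : ℝ → ℝ} (hk : IsRadialMultiplier k) :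
    IsMultiplier fun x : R3 => k ‖x‖ := by
  obtain ⟨C, hC⟩ := hk.bdd
  obtain ⟨D, hD0, hD⟩ := hk.exists_abs_pd_le
  refine ⟨hk.contDiff_norm, IsBddMul.ofReal hk.contDiff_norm.continuous.measurable
    (C := C) fun x => hC _, fun i => IsBddMul.ofReal
      (contDiff_pd hk.contDiff_norm i).continuous.measurable (C := D) fun x => (hD i x).trans ?_⟩
  exact mul_le_of_le_one_right hD0 (hardyWeight_one_le x)

/-- The radial coefficient function of the operator. -/
structure IsRadialCoeff (h : ℝ → ℝ) : Prop where
  contDiff : ContDiff ℝ ∞ h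
  eq_one : ∃ r₀ > 0, ∀ r < r₀, h r = 1
  abs_sub_one_le : ∀ r, |h r - 1| ≤ 1 / 2
  deriv_le : ∃ C, ∀ r, 0 ≤ r → |deriv h r| ≤ C * (Real.sqrt (r ^ 2 + 1))⁻¹

theorem IsRadialCoeff.half_le {h : ℝ → ℝ} (hh : IsRadialCoeff h) (r : ℝ) : 1 / 2 ≤ h r := by
  have := (abs_le.1 (hh.abs_sub_one_le r)).1
  linarith

theorem IsRadialCoeff.le {h : ℝ → ℝ} (hh : IsRadialCoeff h) (r : ℝ) : h r ≤ 3 / 2 := by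
  have := (abs_le.1 (hh.abs_sub_one_le r)).2
  linarith

theorem IsRadialCoeff.isRadialMultiplier {h : ℝ → ℝ} (hh : IsRadialCoeff h) :
    IsRadialMultiplier h where
  contDiff := hh.contDiff
  eq_const := by
    obtain ⟨r₀, hr₀, h1⟩ := hh.eq_one
    exact ⟨r₀, hr₀, 1, h1⟩
  bdd := ⟨3 / 2, fun r => abs_le.2 ⟨by linarith [hh.half_le r], hh.le r⟩⟩
  deriv_le := hh.deriv_le

theorem IsRadialCoeff.inv {h : ℝ → ℝ} (hh : IsRadialCoeff h) :
    IsRadialMultiplier fun r => (h r)⁻¹ where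
  contDiff := hh.contDiff.inv fun r => by linarith [hh.half_le r]
  eq_const := by
    obtain ⟨r₀, hr₀, h1⟩ := hh.eq_one
    exact ⟨r₀, hr₀, 1, fun r hr => by rw [h1 r hr, inv_one]⟩
  bdd := by
    refine ⟨2, fun r => ?_⟩
    have h1 := hh.half_le r
    rw [abs_of_nonneg (by positivity), inv_le_comm₀ (by linarith) (by norm_num)]
    linarith
  deriv_le := by
    obtain ⟨C, hC⟩ := hh.deriv_le
    refine ⟨4 * C, fun r hr => ?_⟩
    have h1 := hh.half_le r
    have hd : HasDerivAt h (deriv h r) r := (hh.contDiff.differentiable (by simp) r).hasDerivAt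
    rw [(hd.fun_inv (by linarith)).deriv, abs_div, abs_neg, abs_of_nonneg (sq_nonneg (h r)),
      div_le_iff₀ (by positivity)]
    have h2 := hC r hr
    have h3 : 1 ≤ 4 * h r ^ 2 := by nlinarith
    nlinarith [abs_nonneg (deriv h r)]

/-- The function `(h² - 1) / r²`. -/
def coeffQuot (h : ℝ → ℝ) (r : ℝ) : ℝ := (h r ^ 2 - 1) / r ^ 2

/-- The quotient is not singular because `h = 1` near the origin. Hence the flux of a test function
is smooth across `x = 0`. -/
theorem IsRadialCoeff.isRadialSmooth_coeffQuot {h : ℝ → ℝ} (hh : IsRadialCoeff h) :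
    IsRadialSmooth (coeffQuot h) := by
  obtain ⟨r₀, hr₀, h1⟩ := hh.eq_one
  have h2 : ∀ r < r₀, coeffQuot h r = 0 := fun r hr => by simp [coeffQuot, h1 r hr]
  refine ⟨?_, r₀, hr₀, 0, h2⟩
  rw [contDiff_iff_contDiffAt]
  intro r
  rcases lt_or_ge r r₀ with hr | hr
  · apply contDiffAt_const (c := (0 : ℝ)) |>.congr_of_eventuallyEq
    filter_upwards [Iio_mem_nhds hr] with s hs using h2 s hs
  · exact ((hh.contDiff.contDiffAt.pow 2).sub contDiffAt_const).div (contDiffAt_id.pow 2)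
      (by have : 0 < r := by linarith
          positivity)

/-- Where `h ≠ 1` one has `r ≥ K M / 2`, so `|h - 1| ≤ (1 + B) * 2 M / r ≤ 4 (1 + B) / K`; the term
`8 (1 + B)` in the bound on `K` makes this at most `1/2`. The term `16` keeps `1 - 2 M / r` away
from zero. -/
theorem isRadialCoeff_hFun {B K M : ℝ} (hK : 8 * (1 + B) + 16 ≤ K) (hM : 0 < M) {ψ : ℝ → ℝ}
    (hψ : ContDiff ℝ ∞ ψ) (hB : ∀ r, |ψ r| ≤ B) (h1 : ∀ r, r < K * M / 2 → ψ r = 1)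
    (h0 : ∀ r, K * M < r → ψ r = 0) : IsRadialCoeff (hFun M ψ) := by
  have hB0 : 0 ≤ B := (abs_nonneg _).trans (hB 0)
  have hK16 : 16 ≤ K := by linarith
  have hKM : 16 * M ≤ K * M := mul_le_mul_of_nonneg_right hK16 hM.le
  have e1 : ∀ r < K * M / 2, hFun M ψ r = 1 := fun r hr => by simp [hFun, h1 r hr]
  have hpos : ∀ r, K * M / 2 ≤ r → 1 / 2 ≤ 1 - 2 * M / r := by
    intro r hr
    have hr0 : 0 < r := by linarith
    have : 2 * M / r ≤ 1 / 2 := by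
      rw [div_le_iff₀ hr0]
      linarith
    linarith
  have hsm : ∀ r, K * M / 2 ≤ r → ContDiffAt ℝ ∞ (fun r => Real.sqrt (1 - 2 * M / r)) r := by
    intro r hr
    have hr0 : r ≠ 0 := by
      have : 0 < r := by linarith
      exact this.ne'
    refine ContDiffAt.sqrt ?_ (by linarith [hpos r hr])
    exact contDiffAt_const.sub (contDiffAt_const.div contDiffAt_id hr0)
  have hc : ContDiff ℝ ∞ (hFun M ψ) := by
    rw [contDiff_iff_contDiffAt]
    intro r
    rcases lt_or_ge r (K * M / 2) with hr | hr
    · apply contDiffAt_const (c := (1 : ℝ)) |>.congr_of_eventuallyEq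
      filter_upwards [Iio_mem_nhds hr] with s hs using e1 s hs
    · exact ((contDiffAt_const.sub hψ.contDiffAt).mul (hsm r hr)).add hψ.contDiffAt
  refine ⟨hc, ⟨K * M / 2, by linarith, e1⟩, ?_, ?_⟩
  · intro r
    rcases lt_or_ge r (K * M / 2) with hr | hr
    · rw [e1 r hr]
      norm_num
    · have hr0 : 0 < r := by linarith
      have hp := hpos r hr
      have e : hFun M ψ r - 1 = (1 - ψ r) * (Real.sqrt (1 - 2 * M / r) - 1) := by
        unfold hFun
        ring
      have hs1 : Real.sqrt (1 - 2 * M / r) ≤ 1 := by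
        rw [Real.sqrt_le_left zero_le_one, one_pow]
        have : 0 ≤ 2 * M / r := by positivity
        linarith
      have hs0 := Real.sqrt_nonneg (1 - 2 * M / r)
      have hsq := Real.sq_sqrt (show 0 ≤ 1 - 2 * M / r by linarith)
      have hs : |Real.sqrt (1 - 2 * M / r) - 1| ≤ 2 * M / r := by
        rw [abs_of_nonpos (by linarith)]
        nlinarith
      have hψ1 : |1 - ψ r| ≤ 1 + B := by
        refine (abs_sub _ _).trans ?_
        rw [abs_one]
        linarith [hB r]
      have h4 : 2 * M / r ≤ 4 / K := by
        rw [div_le_div_iff₀ hr0 (by linarith)]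
        linarith
      rw [e, abs_mul]
      calc _ ≤ (1 + B) * (4 / K) := mul_le_mul hψ1 (hs.trans h4) (abs_nonneg _) (by linarith)
        _ ≤ 1 / 2 := by
          rw [mul_div_assoc', div_le_iff₀ (by linarith)]
          linarith
  · have hdc : Continuous (deriv (hFun M ψ)) := hc.continuous_deriv (by simp)
    have hcs : Continuous fun r : ℝ => |deriv (hFun M ψ) r| * Real.sqrt (r ^ 2 + 1) := by fun_prop
    -- Compactness handles `r ≤ K M + 1`. Beyond it `ψ` vanishes near `r` and also `r ≥ 1`, so `2 M
    -- / r² * (r + 1) ≤ 4 M`.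
    obtain ⟨C, hC⟩ := (isCompact_Icc (a := (0 : ℝ)) (b := K * M + 1)).exists_bound_of_continuousOn
      hcs.continuousOn
    refine ⟨max C (4 * M), fun r hr => ?_⟩
    have hsp : 0 < Real.sqrt (r ^ 2 + 1) := by positivity
    rw [← div_eq_mul_inv, le_div_iff₀ hsp]
    rcases le_or_gt r (K * M + 1) with hr1 | hr1
    · exact ((le_abs_self _).trans (hC r ⟨hr, hr1⟩)).trans (le_max_left _ _)
    · refine le_trans ?_ (le_max_right _ _)
      have hr0 : 0 < r := by linarith
      have hp := hpos r (by linarith)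
      have hev : hFun M ψ =ᶠ[𝓝 r] fun r => Real.sqrt (1 - 2 * M / r) := by
        filter_upwards [Ioi_mem_nhds (show K * M < r by linarith)] with s hs
        simp [hFun, h0 s hs]
      have hd : HasDerivAt (fun r : ℝ => 1 - 2 * M / r) (2 * M / r ^ 2) r := by
        have := ((hasDerivAt_inv hr0.ne').const_mul (2 * M)).const_sub 1
        simp only [div_eq_mul_inv]
        refine this.congr_deriv ?_
        ring
      have hd2 := hd.sqrt (by linarith)
      rw [hev.deriv_eq, hd2.deriv]
      have hsl : 1 / 2 ≤ Real.sqrt (1 - 2 * M / r) := by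
        apply Real.le_sqrt_of_sq_le
        linarith
      have hA : 2 * M / r ^ 2 / (2 * Real.sqrt (1 - 2 * M / r)) ≤ 2 * M / r ^ 2 := by
        apply div_le_self (by positivity)
        linarith
      have hB : Real.sqrt (r ^ 2 + 1) ≤ r + 1 := by
        rw [Real.sqrt_le_left (by linarith)]
        nlinarith
      rw [abs_of_nonneg (by positivity)]
      calc _ ≤ 2 * M / r ^ 2 * (r + 1) := mul_le_mul hA hB hsp.le (by positivity)
        _ ≤ 4 * M := by
          have hr2 : 1 ≤ r := by linarith
          rw [div_mul_eq_mul_div, div_le_iff₀ (by positivity)]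
          nlinarith [mul_nonneg hM.le (show 0 ≤ 2 * r ^ 2 - r - 1 by nlinarith)]

end Radial

/-! ### Vector fields and matrix multipliers. -/

section VectorFields

/-- The space `L²(ℝ³; ℂ³)`. -/
abbrev V3 : Type := PiLp 2 fun _ : Fin 3 => L2R3

/-- A vector of operators, as an operator into `L²(ℝ³; ℂ³)`. -/
def toV3 {E : Type*} [NormedAddCommGroup E] [InnerProductSpace ℂ E] (T : Fin 3 → (E →L[ℂ] L2R3)) :
    E →L[ℂ] V3 :=
  (PiLp.continuousLinearEquiv 2 ℂ fun _ : Fin 3 => L2R3).symm.toContinuousLinearMap.comp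
    (ContinuousLinearMap.pi T)

@[simp]
theorem toV3_apply {E : Type*} [NormedAddCommGroup E] [InnerProductSpace ℂ E]
    (T : Fin 3 → (E →L[ℂ] L2R3)) (v : E) (i : Fin 3) : toV3 T v i = T i v := rfl

/-- The coordinates of a vector field. -/
def compV3 (i : Fin 3) : V3 →L[ℂ] L2R3 := PiLp.proj 2 (fun _ : Fin 3 => L2R3) i

@[simp]
theorem compV3_apply (i : Fin 3) (G : V3) : compV3 i G = G i := rfl

theorem norm_sq_V3 (G : V3) : ‖G‖ ^ 2 = ∫ x, ∑ i, ‖G i x‖ ^ 2 := by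
  rw [PiLp.norm_sq_eq_of_L2, integral_finsetSum _ fun i _ => integrable_norm_sq (G i)]
  simp only [norm_sq_eq_integral]

theorem norm_sq_V3_le {G G' : V3} {C : ℝ}
    (h : ∀ᵐ x, ∑ i, ‖G' i x‖ ^ 2 ≤ C * ∑ i, ‖G i x‖ ^ 2) : ‖G'‖ ^ 2 ≤ C * ‖G‖ ^ 2 := by
  rw [norm_sq_V3, norm_sq_V3, ← integral_const_mul]
  apply integral_mono_ae _ _ h
  · exact integrable_finsetSum _ fun i _ => integrable_norm_sq _
  · exact (integrable_finsetSum _ fun i _ => integrable_norm_sq _).const_mul _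

theorem norm_comp_le (G : V3) (i : Fin 3) : ‖G i‖ ≤ ‖G‖ := PiLp.norm_apply_le G i

/-- Multiplication of a vector field by a real matrix. -/
def matOp (S : Fin 3 → Fin 3 → R3 → ℝ) : V3 →L[ℂ] V3 :=
  toV3 fun a => ∑ b, (rmul (S a b)).comp (compV3 b)

theorem matOp_apply (S : Fin 3 → Fin 3 → R3 → ℝ) (G : V3) (a : Fin 3) :
    matOp S G a = ∑ b, rmul (S a b) (G b) := by
  simp [matOp]

theorem coeFn_matOp {S : Fin 3 → Fin 3 → R3 → ℝ} (hS : ∀ a b, IsBddMul fun x => (S a b x : ℂ))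
    (G : V3) : ∀ᵐ x, ∀ a, matOp S G a x = ∑ b, (S a b x : ℂ) * G b x := by
  rw [ae_all_iff]
  intro a
  rw [matOp_apply]
  filter_upwards [Lp.coeFn_finsetSum Finset.univ fun b => rmul (S a b) (G b),
    ae_all_iff.2 fun b => coeFn_mulOp (hS a b) (G b)] with x h1 h2
  rw [h1]
  simp only [Finset.sum_apply, h2]

end VectorFields

/-! ### The form of `P₁` and its comparison with the Dirichlet form. -/

section Form

/-- The Fourier transform of a function determines that of its weak gradient. -/
theorem embL2_injective {v w : H1} (h : embL2 v = embL2 w) : v = w := by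
  apply H1.ext h
  intro i
  have h1 : 𝓕 (grad v i) = (𝓕 (grad w i) : L2R3) := by
    apply Lp.ext
    filter_upwards [fourier_weakGrad (isWeakGrad_grad v) i, fourier_weakGrad (isWeakGrad_grad w) i]
      with ξ h1 h2
    rw [h1, h2, h]
  exact (Lp.fourierTransformₗᵢ R3 ℂ).injective h1

/-- The gradient of a product. -/
def gradMul (a : R3 → ℝ) : H1 →L[ℂ] V3 :=
  toV3 fun i => (rmul a).comp ((compV3 i).comp grad) + (rmul (pd i a)).comp embL2

theorem gradMul_apply (a : R3 → ℝ) (v : H1) (i : Fin 3) :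
    gradMul a v i = rmul a (grad v i) + rmul (pd i a) (embL2 v) := rfl

theorem IsMultiplier.grad_smul_eq {a : R3 → ℝ} (ha : IsMultiplier a) (v : H1) :
    grad (ha.smul v) = gradMul a v := rfl

theorem norm_rmul_le_of_le {a b : R3 → ℝ} (ha : IsBddMul fun x => (a x : ℂ))
    (hb : IsBddMul fun x => (b x : ℂ)) {C : ℝ} (h : ∀ x, |a x| ≤ C * |b x|) (u : L2R3) :
    ‖rmul a u‖ ≤ C * ‖rmul b u‖ := by
  apply Lp.norm_le_mul_norm_of_ae_le_mul
  filter_upwards [coeFn_mulOp ha u, coeFn_mulOp hb u] with x h1 h2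
  rw [h1, h2, norm_mul, norm_mul, Complex.norm_real, Complex.norm_real, ← mul_assoc]
  exact mul_le_mul_of_nonneg_right (h x) (norm_nonneg _)

theorem norm_rmul_le {a : R3 → ℝ} (ha : IsBddMul fun x => (a x : ℂ)) {C : ℝ}
    (h : ∀ x, |a x| ≤ C) (u : L2R3) : ‖rmul a u‖ ≤ C * ‖u‖ :=
  norm_mulOp_le ha (fun x => by rw [Complex.norm_real]; exact h x) u

theorem norm_rmul_hardyWeight_le {δ : ℝ} (hδ : 0 < δ) (v : H1) :
    ‖rmul (hardyWeight δ) (embL2 v)‖ ≤ 2 * ‖grad v‖ := by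
  refine (sq_le_sq₀ (norm_nonneg _) (by positivity)).1 ?_
  rw [mul_pow]
  norm_num
  exact hardy hδ v

theorem norm_sq_le_of_comp_le {G : V3} {C : ℝ} (h : ∀ i, ‖G i‖ ≤ C) : ‖G‖ ^ 2 ≤ 3 * C ^ 2 := by
  rw [PiLp.norm_sq_eq_of_L2]
  calc _ ≤ ∑ _ : Fin 3, C ^ 2 :=
        Finset.sum_le_sum fun i _ => pow_le_pow_left₀ (norm_nonneg _) (h i) 2
    _ = _ := by simp

/-- The term `(∇ k) v` is handled by Hardy's inequality, since `|∇ k|` is bounded by a multiple of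
`(1 + |x|²) ^ (-1/2)`. The bound thus contains the gradient alone, which the homogeneous norms
require. -/
theorem IsRadialMultiplier.exists_norm_gradMul_le {k : ℝ → ℝ} (hk : IsRadialMultiplier k) :
    ∃ C, 0 ≤ C ∧ ∀ v, ‖gradMul (fun x => k ‖x‖) v‖ ^ 2 ≤ C * ‖grad v‖ ^ 2 := by
  obtain ⟨C, hC⟩ := hk.bdd
  obtain ⟨D, hD0, hD⟩ := hk.exists_abs_pd_le
  refine ⟨3 * (C + D * 2) ^ 2, by positivity, fun v => ?_⟩
  have h1 : ∀ i, ‖gradMul (fun x => k ‖x‖) v i‖ ≤ (C + D * 2) * ‖grad v‖ := by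
    intro i
    have e1 : ‖rmul (fun x => k ‖x‖) (grad v i)‖ ≤ C * ‖grad v‖ :=
      (norm_rmul_le hk.isMultiplier.bdd (fun x => hC _) _).trans
        (mul_le_mul_of_nonneg_left (norm_comp_le _ _) ((abs_nonneg _).trans (hC 0)))
    have e2 : ‖rmul (pd i fun x => k ‖x‖) (embL2 v)‖ ≤ D * (2 * ‖grad v‖) := by
      refine (norm_rmul_le_of_le (hk.isMultiplier.bdd_pd i) (isBddMul_hardyWeight one_pos)
        (C := D) (fun x => (hD i x).trans (mul_le_mul_of_nonneg_left (le_abs_self _) hD0)) _).trans ?_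
      exact mul_le_mul_of_nonneg_left (norm_rmul_hardyWeight_le one_pos v) hD0
    rw [gradMul_apply]
    refine (norm_add_le _ _).trans ((add_le_add e1 e2).trans (le_of_eq ?_))
    ring
  refine (norm_sq_le_of_comp_le h1).trans (le_of_eq ?_)
  ring

/-- The matrix `1 + (h - 1) x xᵀ / |x|²`. -/
def coefS (h : ℝ → ℝ) (a b : Fin 3) (x : R3) : ℝ :=
  (if a = b then 1 else 0) + (h ‖x‖ - 1) * ((x a / ‖x‖) * (x b / ‖x‖))

variable {h : ℝ → ℝ}

theorem abs_coefS_le (hh : IsRadialCoeff h) (a b : Fin 3) (x : R3) : |coefS h a b x| ≤ 2 := by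
  unfold coefS
  refine (abs_add_le _ _).trans ?_
  have h1 : |(if a = b then 1 else 0 : ℝ)| ≤ 1 := by split_ifs <;> simp
  have h2 : |(h ‖x‖ - 1) * ((x a / ‖x‖) * (x b / ‖x‖))| ≤ 1 / 2 * (1 * 1) := by
    rw [abs_mul, abs_mul]
    gcongr
    · exact hh.abs_sub_one_le _
    · exact abs_coord_div_norm_le x a
    · exact abs_coord_div_norm_le x b
  linarith

theorem measurable_coord (a : Fin 3) : Measurable fun x : R3 => x a :=
  (EuclideanSpace.proj a : R3 →L[ℝ] ℝ).continuous.measurable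

theorem isBddMul_coefS (hh : IsRadialCoeff h) (a b : Fin 3) :
    IsBddMul fun x => (coefS h a b x : ℂ) := by
  refine IsBddMul.ofReal ?_ (abs_coefS_le hh a b)
  have h1 := hh.contDiff.continuous.measurable
  have h2 := measurable_coord a
  have h3 := measurable_coord b
  unfold coefS
  fun_prop

theorem coefS_comm (a b : Fin 3) : coefS h a b = coefS h b a := by
  ext x
  simp only [coefS, eq_comm (a := a), mul_comm (x a / ‖x‖)]

theorem sum_div_norm_sq {x : R3} (hx : x ≠ 0) : ∑ a, (x a / ‖x‖) ^ 2 = 1 := by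
  simp only [div_pow]
  rw [← Finset.sum_div, ← norm_sq_eq_sum, div_self]
  have := norm_ne_zero_iff.2 hx
  positivity

theorem sum_sq_rankOne {n ξ : Fin 3 → ℝ} (hn : ∑ a, n a ^ 2 = 1) (c : ℝ) :
    ∑ a, (∑ b, ((if a = b then 1 else 0) + (c - 1) * (n a * n b)) * ξ b) ^ 2 =
      ∑ a, ξ a ^ 2 + (c ^ 2 - 1) * (∑ a, n a * ξ a) ^ 2 := by
  simp only [Fin.sum_univ_three] at hn ⊢
  simp
  linear_combination (c - 1) ^ 2 * (n 0 * ξ 0 + n 1 * ξ 1 + n 2 * ξ 2) ^ 2 * hn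

/-- The symmetric matrix `1 + (c - 1) n nᵀ` has square `1 + (c² - 1) n nᵀ`, and `1/4 ≤ c² ≤ 9/4`. -/
theorem sum_sq_rankOne_bounds {n ξ : Fin 3 → ℝ} (hn : ∑ a, n a ^ 2 = 1) {c : ℝ} (h1 : 1 / 2 ≤ c)
    (h2 : c ≤ 3 / 2) :
    ∑ a, (∑ b, ((if a = b then 1 else 0) + (c - 1) * (n a * n b)) * ξ b) ^ 2 ≤ 4 * ∑ a, ξ a ^ 2 ∧
    ∑ a, ξ a ^ 2 ≤
      4 * ∑ a, (∑ b, ((if a = b then 1 else 0) + (c - 1) * (n a * n b)) * ξ b) ^ 2 := by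
  rw [sum_sq_rankOne hn]
  have h3 : (∑ a, n a * ξ a) ^ 2 ≤ ∑ a, ξ a ^ 2 := by
    have := Finset.sum_mul_sq_le_sq_mul_sq Finset.univ n ξ
    rwa [hn, one_mul] at this
  have h4 := sq_nonneg (∑ a, n a * ξ a)
  have h5 : (c ^ 2 - 1) * (∑ a, n a * ξ a) ^ 2 ≤ 5 / 4 * (∑ a, n a * ξ a) ^ 2 :=
    mul_le_mul_of_nonneg_right (by nlinarith) h4
  have h6 : -(3 / 4) * (∑ a, n a * ξ a) ^ 2 ≤ (c ^ 2 - 1) * (∑ a, n a * ξ a) ^ 2 :=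
    mul_le_mul_of_nonneg_right (by nlinarith) h4
  constructor <;> linarith

theorem coefS_bounds (hh : IsRadialCoeff h) {x : R3} (hx : x ≠ 0) (ξ : Fin 3 → ℂ) :
    ∑ a, ‖∑ b, (coefS h a b x : ℂ) * ξ b‖ ^ 2 ≤ 4 * ∑ a, ‖ξ a‖ ^ 2 ∧
    ∑ a, ‖ξ a‖ ^ 2 ≤ 4 * ∑ a, ‖∑ b, (coefS h a b x : ℂ) * ξ b‖ ^ 2 := by
  have hn := sum_div_norm_sq hx
  have h1 := sum_sq_rankOne_bounds hn (ξ := fun a => (ξ a).re) (hh.half_le ‖x‖) (hh.le ‖x‖)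
  have h2 := sum_sq_rankOne_bounds hn (ξ := fun a => (ξ a).im) (hh.half_le ‖x‖) (hh.le ‖x‖)
  have e : ∀ z : ℂ, ‖z‖ ^ 2 = z.re ^ 2 + z.im ^ 2 := fun z => by
    rw [Complex.sq_norm, Complex.normSq_apply]
    ring
  simp only [e, Complex.re_sum, Complex.im_sum, Complex.re_ofReal_mul, Complex.im_ofReal_mul,
    Finset.sum_add_distrib]
  simp only [coefS]
  constructor
  · linarith [h1.1, h2.1]
  · linarith [h1.2, h2.2]

theorem norm_matOp_coefS_sq_le (hh : IsRadialCoeff h) (G : V3) :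
    ‖matOp (coefS h) G‖ ^ 2 ≤ 4 * ‖G‖ ^ 2 := by
  apply norm_sq_V3_le
  filter_upwards [coeFn_matOp (isBddMul_coefS hh) G, ae_ne_zero] with x h1 hx
  simp only [h1]
  exact (coefS_bounds hh hx _).1

theorem norm_sq_le_matOp_coefS (hh : IsRadialCoeff h) (G : V3) :
    ‖G‖ ^ 2 ≤ 4 * ‖matOp (coefS h) G‖ ^ 2 := by
  apply norm_sq_V3_le
  filter_upwards [coeFn_matOp (isBddMul_coefS hh) G, ae_ne_zero] with x h1 hx
  simp only [h1]
  exact (coefS_bounds hh hx _).2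

/-- The first order operator `u ↦ S ∇ (h u)`. -/
def formMap (h : ℝ → ℝ) : H1 →L[ℂ] V3 := (matOp (coefS h)).comp (gradMul fun x => h ‖x‖)

/-- Multiplication by `h` and by `1 / h` are both bounded for the gradient norm, and `S` and its
inverse are bounded matrices. -/
theorem exists_formMap_bounds (hh : IsRadialCoeff h) :
    ∃ C, 1 ≤ C ∧ ∀ v, ‖formMap h v‖ ^ 2 ≤ C * ‖grad v‖ ^ 2 ∧
      ‖grad v‖ ^ 2 ≤ C * ‖formMap h v‖ ^ 2 := by
  obtain ⟨C, hC0, hC⟩ := hh.isRadialMultiplier.exists_norm_gradMul_le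
  obtain ⟨D, hD0, hD⟩ := hh.inv.exists_norm_gradMul_le
  refine ⟨1 + 4 * C + 4 * D, by linarith, fun v => ⟨?_, ?_⟩⟩
  · have h1 := norm_matOp_coefS_sq_le hh (gradMul (fun x => h ‖x‖) v)
    have h2 := hC v
    change ‖matOp (coefS h) (gradMul (fun x => h ‖x‖) v)‖ ^ 2 ≤ _
    nlinarith [sq_nonneg ‖grad v‖]
  · have hm := hh.isRadialMultiplier.isMultiplier
    -- For the lower bound, `v` is recovered as `h⁻¹ (h v)`, so its gradient is controlled by that
    -- of `h v`.
    have e : hh.inv.isMultiplier.smul (hm.smul v) = v := by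
      apply embL2_injective
      rw [IsMultiplier.embL2_smul, IsMultiplier.embL2_smul,
        ← mulOp_mul_apply hh.inv.isMultiplier.bdd hm.bdd]
      have : (fun x : R3 => (((h ‖x‖)⁻¹ : ℝ) : ℂ) * (h ‖x‖ : ℂ)) = fun _ => 1 := by
        ext x
        have := hh.half_le ‖x‖
        rw [← Complex.ofReal_mul, inv_mul_cancel₀ (by linarith), Complex.ofReal_one]
      rw [this, mulOp_const_apply, one_smul]
    have h1 := hD (hm.smul v)
    rw [← IsMultiplier.grad_smul_eq hh.inv.isMultiplier, e, hm.grad_smul_eq] at h1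
    have h2 := norm_sq_le_matOp_coefS hh (gradMul (fun x => h ‖x‖) v)
    change _ ≤ _ * ‖matOp (coefS h) (gradMul (fun x => h ‖x‖) v)‖ ^ 2
    nlinarith [sq_nonneg ‖matOp (coefS h) (gradMul (fun x => h ‖x‖) v)‖]

end Form

/-! ### From polar coordinates to divergence form. -/

section PolarCoordinates

theorem fderiv_eq_sum_pd (f : R3 → ℂ) (x v : R3) : fderiv ℝ f x v = ∑ i, (v i : ℂ) * pd i f x := by
  have h : v = ∑ i, v i • unitVec i := by
    ext j
    simp [unitVec, Fin.sum_univ_three]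
    fin_cases j <;> simp
  conv_lhs => rw [h]
  simp [pd]

theorem pd_add {f g : R3 → ℂ} {x : R3} (hf : DifferentiableAt ℝ f x) (hg : DifferentiableAt ℝ g x)
    (i : Fin 3) : pd i (fun y => f y + g y) x = pd i f x + pd i g x := by
  unfold pd
  rw [fderiv_fun_add hf hg]
  rfl

theorem pd_sub {f g : R3 → ℂ} {x : R3} (hf : DifferentiableAt ℝ f x) (hg : DifferentiableAt ℝ g x)
    (i : Fin 3) : pd i (fun y => f y - g y) x = pd i f x - pd i g x := by
  unfold pd
  rw [fderiv_fun_sub hf hg]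
  rfl

theorem pd_sum {f : Fin 3 → R3 → ℂ} {x : R3} (hf : ∀ j, DifferentiableAt ℝ (f j) x) (i : Fin 3) :
    pd i (fun y => ∑ j, f j y) x = ∑ j, pd i (f j) x := by
  unfold pd
  rw [fderiv_fun_sum fun j _ => hf j]
  simp

theorem contDiff_coord (i : Fin 3) : ContDiff ℝ ∞ fun y : R3 => y i :=
  (EuclideanSpace.proj i : R3 →L[ℝ] ℝ).contDiff

theorem differentiableAt_coord (i : Fin 3) (x : R3) :
    DifferentiableAt ℝ (fun y : R3 => (y i : ℂ)) x :=
  (contDiff_ofReal (contDiff_coord i)).differentiable (by simp) x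

theorem pd_coord_mul {f : R3 → ℂ} {x : R3} (hf : DifferentiableAt ℝ f x) (i j : Fin 3) :
    pd i (fun y : R3 => (y j : ℂ) * f y) x = x j * pd i f x + (if i = j then 1 else 0) * f x := by
  rw [pd_mul (differentiableAt_coord j x) hf, pd_ofReal ((contDiff_coord j).differentiable (by simp) x),
    pd_coord]
  split_ifs <;> simp

/-- The Euler derivative `x · ∇ f`. -/
def euler (f : R3 → ℂ) (x : R3) : ℂ := ∑ i, (x i : ℂ) * pd i f x

theorem contDiff_euler {f : R3 → ℂ} (hf : ContDiff ℝ ∞ f) : ContDiff ℝ ∞ (euler f) :=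
  ContDiff.sum fun i _ => (contDiff_ofReal (contDiff_coord i)).mul (contDiff_pd hf i)

theorem radialDeriv_eq (f : R3 → ℂ) (x : R3) :
    radialDeriv f x = ((‖x‖⁻¹ : ℝ) : ℂ) * euler f x := by
  rw [radialDeriv, map_smul, fderiv_eq_sum_pd, Complex.real_smul]
  rfl

theorem rotDeriv_eq (i j : Fin 3) (f : R3 → ℂ) (x : R3) :
    rotDeriv i j f x = x i * pd j f x - x j * pd i f x := by
  rw [rotDeriv, map_sub, map_smul, map_smul, Complex.real_smul, Complex.real_smul]
  rfl

theorem contDiff_rotDeriv {f : R3 → ℂ} (hf : ContDiff ℝ ∞ f) (i j : Fin 3) :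
    ContDiff ℝ ∞ (rotDeriv i j f) := by
  have : rotDeriv i j f = fun x => (x i : ℂ) * pd j f x - x j * pd i f x :=
    funext fun x => rotDeriv_eq i j f x
  rw [this]
  exact ((contDiff_ofReal (contDiff_coord i)).mul (contDiff_pd hf j)).sub
    ((contDiff_ofReal (contDiff_coord j)).mul (contDiff_pd hf i))

theorem rotDeriv_radial_mul {k : ℝ → ℝ} (hk : IsRadialSmooth k) {f : R3 → ℂ} (hf : ContDiff ℝ ∞ f)
    (i j : Fin 3) :
    rotDeriv i j (fun x => (k ‖x‖ : ℂ) * f x) = fun x => (k ‖x‖ : ℂ) * rotDeriv i j f x := by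
  ext x
  have h1 : DifferentiableAt ℝ (fun x : R3 => k ‖x‖) x :=
    hk.contDiff_norm.differentiable (by simp) x
  have h2 : DifferentiableAt ℝ (fun x : R3 => (k ‖x‖ : ℂ)) x :=
    (contDiff_ofReal hk.contDiff_norm).differentiable (by simp) x
  have h3 := hf.differentiable (by simp) x
  rw [rotDeriv_eq, rotDeriv_eq, pd_mul h2 h3, pd_mul h2 h3, pd_ofReal h1, pd_ofReal h1, hk.pd_norm,
    hk.pd_norm]
  push_cast
  ring

theorem sphereLaplacian_radial_mul {k : ℝ → ℝ} (hk : IsRadialSmooth k) {f : R3 → ℂ}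
    (hf : ContDiff ℝ ∞ f) (x : R3) :
    sphereLaplacian (fun x => (k ‖x‖ : ℂ) * f x) x = k ‖x‖ * sphereLaplacian f x := by
  simp only [sphereLaplacian, rotDeriv_radial_mul hk hf,
    rotDeriv_radial_mul hk (contDiff_rotDeriv hf _ _)]
  ring

/-- The Laplacian. -/
def lap (f : R3 → ℂ) (x : R3) : ℂ := ∑ i, pd i (pd i f) x

/-- The second order part of the square of the Euler derivative. -/
def euler₂ (f : R3 → ℂ) (x : R3) : ℂ := ∑ i, (x i : ℂ) * ∑ j, (x j : ℂ) * pd i (pd j f) x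

theorem rotDeriv_rotDeriv {f : R3 → ℂ} (hf : ContDiff ℝ ∞ f) {i j : Fin 3} (hij : i ≠ j) (x : R3) :
    rotDeriv i j (rotDeriv i j f) x =
      x i ^ 2 * pd j (pd j f) x + x j ^ 2 * pd i (pd i f) x
        - x i * x j * (pd i (pd j f) x + pd j (pd i f) x) - x i * pd i f x - x j * pd j f x := by
  have h0 : rotDeriv i j f = fun x => (x i : ℂ) * pd j f x - x j * pd i f x :=
    funext fun x => rotDeriv_eq i j f x
  have hd : ∀ k, DifferentiableAt ℝ (pd k f) x := fun k =>
    (contDiff_pd hf k).differentiable (by simp) x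
  have hm : ∀ k l, DifferentiableAt ℝ (fun x : R3 => (x k : ℂ) * pd l f x) x := fun k l =>
    (differentiableAt_coord k x).mul (hd l)
  rw [rotDeriv_eq, h0, pd_sub (hm _ _) (hm _ _), pd_sub (hm _ _) (hm _ _), pd_coord_mul (hd _),
    pd_coord_mul (hd _), pd_coord_mul (hd _), pd_coord_mul (hd _), if_neg hij, if_neg hij.symm,
    if_pos rfl, if_pos rfl]
  ring

/-- With the Euler derivative `E`, the sum of squared rotations is `r² Δ - E² - E`, and `E² = euler₂
+ E`. -/
theorem sphereLaplacian_eq {f : R3 → ℂ} (hf : ContDiff ℝ ∞ f) (x : R3) :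
    sphereLaplacian f x = ((‖x‖ ^ 2 : ℝ) : ℂ) * lap f x - euler₂ f x - 2 * euler f x := by
  rw [sphereLaplacian, rotDeriv_rotDeriv hf (by decide), rotDeriv_rotDeriv hf (by decide),
    rotDeriv_rotDeriv hf (by decide), norm_sq_eq_sum, lap, euler₂, euler]
  simp only [Fin.sum_univ_three]
  push_cast
  ring

theorem pd_euler {f : R3 → ℂ} (hf : ContDiff ℝ ∞ f) (i : Fin 3) (x : R3) :
    pd i (euler f) x = (∑ j, (x j : ℂ) * pd i (pd j f) x) + pd i f x := by
  have hd : ∀ k, DifferentiableAt ℝ (pd k f) x := fun k =>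
    (contDiff_pd hf k).differentiable (by simp) x
  have h := pd_sum (f := fun k (x : R3) => (x k : ℂ) * pd k f x) (x := x)
    (fun k => (differentiableAt_coord k x).mul (hd k)) i
  refine Eq.trans h ?_
  simp only [pd_coord_mul (hd _), Finset.sum_add_distrib]
  simp

theorem euler_euler {f : R3 → ℂ} (hf : ContDiff ℝ ∞ f) (x : R3) :
    euler (euler f) x = euler₂ f x + euler f x := by
  rw [euler, euler₂, euler]
  simp only [pd_euler hf, mul_add, Finset.sum_add_distrib]

theorem sum_coord_sq (x : R3) : ∑ i, (x i : ℂ) ^ 2 = ((‖x‖ ^ 2 : ℝ) : ℂ) := by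
  rw [norm_sq_eq_sum]
  push_cast
  rfl

theorem euler_radial_mul {k : ℝ → ℝ} {f : R3 → ℂ} (hf : ContDiff ℝ ∞ f) {x : R3} (hx : x ≠ 0)
    (hk : DifferentiableAt ℝ k ‖x‖) :
    euler (fun y => (k ‖y‖ : ℂ) * f y) x =
      k ‖x‖ * euler f x + ((deriv k ‖x‖ * ‖x‖ : ℝ) : ℂ) * f x := by
  have h0 : ‖x‖ ≠ 0 := norm_ne_zero_iff.2 hx
  have h1 : DifferentiableAt ℝ (fun x : R3 => k ‖x‖) x :=
    hk.comp x ((contDiffAt_norm ℝ hx (n := 1)).differentiableAt (by simp))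
  have h2 : DifferentiableAt ℝ (fun x : R3 => (k ‖x‖ : ℂ)) x :=
    Complex.ofRealCLM.differentiableAt.comp x h1
  have e : ∀ i, (x i : ℂ) * pd i (fun y => (k ‖y‖ : ℂ) * f y) x =
      k ‖x‖ * (x i * pd i f x) + ((deriv k ‖x‖ / ‖x‖ : ℝ) : ℂ) * f x * (x i : ℂ) ^ 2 := by
    intro i
    rw [pd_mul h2 (hf.differentiable (by simp) x), pd_ofReal h1, pd_comp_norm hx hk]
    push_cast
    ring
  rw [euler]
  simp only [e, Finset.sum_add_distrib, ← Finset.mul_sum]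
  rw [sum_coord_sq, euler]
  have h0' : (‖x‖ : ℂ) ≠ 0 := Complex.ofReal_ne_zero.2 h0
  push_cast
  field_simp

/-- The vector field `(1 + (h² - 1) x xᵀ / |x|²) ∇ g`. -/
def fluxField (h : ℝ → ℝ) (g : R3 → ℂ) (a : Fin 3) (x : R3) : ℂ :=
  pd a g x + (coeffQuot h ‖x‖ : ℂ) * ((x a : ℂ) * euler g x)

variable {h : ℝ → ℝ}

theorem contDiff_fluxField (hh : IsRadialCoeff h) {g : R3 → ℂ} (hg : ContDiff ℝ ∞ g) (a : Fin 3) :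
    ContDiff ℝ ∞ (fluxField h g a) :=
  (contDiff_pd hg a).add ((contDiff_ofReal hh.isRadialSmooth_coeffQuot.contDiff_norm).mul
    ((contDiff_ofReal (contDiff_coord a)).mul (contDiff_euler hg)))

theorem deriv_coeffQuot (hh : IsRadialCoeff h) {r : ℝ} (hr : 0 < r) :
    deriv (coeffQuot h) r = 2 * h r * deriv h r / r ^ 2 - 2 * (h r ^ 2 - 1) / r ^ 3 := by
  have hd : HasDerivAt h (deriv h r) r := (hh.contDiff.differentiable (by simp) r).hasDerivAt
  have h1 := ((hd.fun_pow 2).sub_const 1).fun_div ((hasDerivAt_id r).fun_pow 2)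
    (by simp only [id]; positivity)
  have h2 : deriv (coeffQuot h) r = _ := h1.deriv
  rw [h2]
  simp only [id]
  field_simp
  push_cast
  ring

theorem sum_pd_fluxField (hh : IsRadialCoeff h) {g : R3 → ℂ} (hg : ContDiff ℝ ∞ g) {x : R3}
    (hx : x ≠ 0) :
    ∑ a, pd a (fluxField h g a) x =
      lap g x + ((deriv (coeffQuot h) ‖x‖ * ‖x‖ + 3 * coeffQuot h ‖x‖ : ℝ) : ℂ) * euler g x +
        coeffQuot h ‖x‖ * (euler₂ g x + euler g x) := by
  have hk := hh.isRadialSmooth_coeffQuot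
  have h1 : DifferentiableAt ℝ (fun x : R3 => coeffQuot h ‖x‖) x :=
    hk.contDiff_norm.differentiable (by simp) x
  have h2 : DifferentiableAt ℝ (fun x : R3 => (coeffQuot h ‖x‖ : ℂ)) x :=
    (contDiff_ofReal hk.contDiff_norm).differentiable (by simp) x
  have hE := (contDiff_euler hg).differentiable (by simp) x
  have h0' : (‖x‖ : ℂ) ≠ 0 := Complex.ofReal_ne_zero.2 (norm_ne_zero_iff.2 hx)
  have e : ∀ a, pd a (fluxField h g a) x = pd a (pd a g) x +
      (coeffQuot h ‖x‖ * (x a * pd a (euler g) x) + coeffQuot h ‖x‖ * euler g x +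
        ((deriv (coeffQuot h) ‖x‖ / ‖x‖ : ℝ) : ℂ) * euler g x * (x a : ℂ) ^ 2) := by
    intro a
    have hm : DifferentiableAt ℝ (fun y : R3 => (y a : ℂ) * euler g y) x :=
      (differentiableAt_coord a x).mul hE
    have hm2 : DifferentiableAt ℝ
        (fun y : R3 => (coeffQuot h ‖y‖ : ℂ) * ((y a : ℂ) * euler g y)) x := h2.mul hm
    refine (pd_add ((contDiff_pd hg a).differentiable (by simp) x) hm2 a).trans ?_
    rw [pd_mul h2 hm, pd_coord_mul hE, pd_ofReal h1, hk.pd_norm, if_pos rfl]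
    push_cast
    ring
  simp only [e, Finset.sum_add_distrib, ← Finset.mul_sum, sum_coord_sq]
  rw [← euler_euler hg, ← lap, ← euler]
  simp only [Finset.sum_const, Finset.card_univ, Fintype.card_fin, nsmul_eq_mul]
  push_cast
  field_simp
  ring

/-- The operator `P₁` in divergence form. -/
theorem P1Expr_eq (hh : IsRadialCoeff h) {φ : R3 → ℂ} (hφ : ContDiff ℝ ∞ φ) {x : R3} (hx : x ≠ 0) :
    P1Expr h φ x =
      -(h ‖x‖ : ℂ) * ∑ a, pd a (fluxField h (fun y => (h ‖y‖ : ℂ) * φ y) a) x := by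
  have hr : 0 < ‖x‖ := norm_pos_iff.2 hx
  have hrad := hh.isRadialMultiplier.toIsRadialSmooth
  set g : R3 → ℂ := fun y => (h ‖y‖ : ℂ) * φ y with hg
  have hgs : ContDiff ℝ ∞ g := (contDiff_ofReal hrad.contDiff_norm).mul hφ
  have hd : HasDerivAt h (deriv h ‖x‖) ‖x‖ := (hh.contDiff.differentiable (by simp) _).hasDerivAt
  have hk : HasDerivAt (fun r => r * h r ^ 2) (h ‖x‖ ^ 2 + 2 * ‖x‖ * h ‖x‖ * deriv h ‖x‖) ‖x‖ := by
    refine ((hasDerivAt_id _).fun_mul (hd.fun_pow 2)).congr_deriv ?_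
    push_cast
    ring
  -- Here `r² h² ∂_r = r h² E`. The two functions agree also at the origin, where the factor `‖y‖`
  -- makes both vanish.
  have e1 : (fun y : R3 => ((‖y‖ ^ 2 * h ‖y‖ ^ 2 : ℝ) : ℂ) * radialDeriv g y) =
      fun y => (((fun r => r * h r ^ 2) ‖y‖ : ℝ) : ℂ) * euler g y := by
    ext y
    rw [radialDeriv_eq, ← mul_assoc, ← Complex.ofReal_mul]
    congr 2
    by_cases hy : ‖y‖ = 0
    · simp [hy]
    · field_simp
  have e2 : (h ‖x‖ : ℂ) * sphereLaplacian φ x =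
      ((‖x‖ ^ 2 : ℝ) : ℂ) * lap g x - euler₂ g x - 2 * euler g x := by
    rw [← sphereLaplacian_eq hgs, hg, sphereLaplacian_radial_mul hrad hφ]
  have e3 : ((h ‖x‖ ^ 2 * (‖x‖ ^ 2)⁻¹ : ℝ) : ℂ) * sphereLaplacian φ x =
      ((h ‖x‖ * (‖x‖ ^ 2)⁻¹ : ℝ) : ℂ) * ((h ‖x‖ : ℂ) * sphereLaplacian φ x) := by
    push_cast
    ring
  have h0' : (‖x‖ : ℂ) ≠ 0 := Complex.ofReal_ne_zero.2 hr.ne'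
  rw [P1Expr, e3, e2, e1, radialDeriv_eq, euler_radial_mul (contDiff_euler hgs) hx hk.differentiableAt,
    hk.deriv, euler_euler hgs, sum_pd_fluxField hh hgs hx, deriv_coeffQuot hh hr, coeffQuot]
  push_cast
  field_simp
  ring

end PolarCoordinates

/-! ### Identification of `P₁` with the operator of the form. -/

section Operator

/-- Plancherel: the symbol `2πiξ_i` is purely imaginary. -/
theorem inner_grad (v w : H1) (i : Fin 3) :
    inner ℂ (embL2 v) (grad w i) = -inner ℂ (grad v i) (embL2 w) := by
  rw [← Lp.inner_fourier_eq, ← Lp.inner_fourier_eq (grad v i), L2.inner_def, L2.inner_def,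
    ← integral_neg]
  apply integral_congr_ae
  filter_upwards [fourier_weakGrad (isWeakGrad_grad v) i, fourier_weakGrad (isWeakGrad_grad w) i]
    with ξ h1 h2
  rw [h1, h2]
  simp only [RCLike.inner_apply, map_mul, Complex.conj_ofReal, Complex.conj_I, map_ofNat]
  ring

theorem inner_matOp_left {S : Fin 3 → Fin 3 → R3 → ℝ} (hS : ∀ a b, IsBddMul fun x => (S a b x : ℂ))
    (hc : ∀ a b, S a b = S b a) (F G : V3) :
    inner ℂ (matOp S F) G = inner ℂ F (matOp S G) := by
  simp only [PiLp.inner_apply, matOp_apply, sum_inner, inner_sum]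
  rw [Finset.sum_comm]
  refine Finset.sum_congr rfl fun a _ => Finset.sum_congr rfl fun b _ => ?_
  rw [inner_mulOp_ofReal_left (hS _ _), hc]

variable {h : ℝ → ℝ}

theorem sum_coefS_coefS {x : R3} (hx : x ≠ 0) (a c : Fin 3) :
    ∑ b, coefS h a b x * coefS h b c x =
      (if a = c then 1 else 0) + coeffQuot h ‖x‖ * (x a * x c) := by
  have hn := sum_div_norm_sq hx
  have h0 : ‖x‖ ≠ 0 := norm_ne_zero_iff.2 hx
  have e : coeffQuot h ‖x‖ * (x a * x c) =
      (h ‖x‖ ^ 2 - 1) * ((x a / ‖x‖) * (x c / ‖x‖)) := by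
    unfold coeffQuot
    field_simp
  rw [e]
  simp only [coefS, mul_add, add_mul, Finset.sum_add_distrib]
  have e2 : ∑ b, (h ‖x‖ - 1) * (x a / ‖x‖ * (x b / ‖x‖)) * ((h ‖x‖ - 1) * (x b / ‖x‖ * (x c / ‖x‖)))
      = (h ‖x‖ - 1) ^ 2 * (x a / ‖x‖ * (x c / ‖x‖)) * ∑ b, (x b / ‖x‖) ^ 2 := by
    rw [Finset.mul_sum]
    refine Finset.sum_congr rfl fun b _ => ?_
    ring
  rw [e2, hn]
  simp
  ring

theorem matOp_coefS_coefS (hh : IsRadialCoeff h) {g : R3 → ℂ} {G : V3}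
    (hG : ∀ a, (G a : R3 → ℂ) =ᵐ[volume] pd a g) (a : Fin 3) :
    (matOp (coefS h) (matOp (coefS h) G) a : R3 → ℂ) =ᵐ[volume] fluxField h g a := by
  have hS := isBddMul_coefS hh
  filter_upwards [coeFn_matOp hS (matOp (coefS h) G), coeFn_matOp hS G, ae_all_iff.2 hG, ae_ne_zero]
    with x h1 h2 h3 hx
  rw [h1]
  simp only [h2, h3, Finset.mul_sum]
  rw [Finset.sum_comm]
  have e : ∀ c, ∑ b, (coefS h a b x : ℂ) * (coefS h b c x * pd c g x) =
      (((if a = c then 1 else 0) + coeffQuot h ‖x‖ * (x a * x c) : ℝ) : ℂ) * pd c g x := by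
    intro c
    rw [← sum_coefS_coefS hx, Complex.ofReal_sum, Finset.sum_mul]
    refine Finset.sum_congr rfl fun b _ => ?_
    push_cast
    ring
  have e2 : ∀ c, (((if a = c then 1 else 0) + coeffQuot h ‖x‖ * (x a * x c) : ℝ) : ℂ) * pd c g x =
      (if a = c then pd c g x else 0) +
        (coeffQuot h ‖x‖ : ℂ) * ((x a : ℂ) * ((x c : ℂ) * pd c g x)) := by
    intro c
    split_ifs <;> push_cast <;> ring
  simp only [e, e2, fluxField, euler, Finset.mul_sum, Finset.sum_add_distrib]
  simp

/-- Integration by parts: `P₁` is the operator of the form `⟨S ∇ (h u), S ∇ (h v)⟩`. -/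
theorem inner_P1Expr (hh : IsRadialCoeff h) {φ : R3 → ℂ} (hφ : IsTest φ) (w : H1) :
    MemLp (P1Expr h φ) 2 volume ∧
    inner ℂ (toL2 (P1Expr h φ)) (embL2 w) = inner ℂ (formMap h hφ.toH1) (formMap h w) := by
  have hm := hh.isRadialMultiplier.isMultiplier
  have hS := isBddMul_coefS hh
  set g : R3 → ℂ := fun y => (h ‖y‖ : ℂ) * φ y with hg
  have hgt : IsTest g := hφ.mul_left (contDiff_ofReal hm.contDiff)
  have hF : ∀ a, IsTest (fluxField h g a) := by
    intro a
    refine ⟨contDiff_fluxField hh hgt.1 a, ?_⟩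
    refine HasCompactSupport.add (hgt.pd a).2 (HasCompactSupport.mul_left (HasCompactSupport.mul_left ?_))
    refine HasCompactSupport.intro hgt.2 fun x hx => ?_
    rw [euler]
    apply Finset.sum_eq_zero
    intro i _
    have : pd i g x = 0 := by
      have h1 : x ∉ tsupport (pd i g) := fun h2 =>
        hx (tsupport_fderiv_apply_subset ℝ (unitVec i) h2)
      exact image_eq_zero_of_notMem_tsupport h1
    rw [this, mul_zero]
  have hae : P1Expr h φ =ᵐ[volume] fun x => -(h ‖x‖ : ℂ) * ∑ a, pd a (fluxField h g a) x := by
    filter_upwards [ae_ne_zero] with x hx using P1Expr_eq hh hφ.1 hx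
  have hmem : MemLp (P1Expr h φ) 2 volume := by
    rw [memLp_congr_ae hae]
    apply Continuous.memLp_of_hasCompactSupport
    · exact (Complex.continuous_ofReal.comp hm.contDiff.continuous).neg.mul
        (continuous_finsetSum _ fun a _ => ((hF a).pd a).1.continuous)
    · apply HasCompactSupport.mul_left
      have := ((hF 0).pd 0).2.add (((hF 1).pd 1).2.add ((hF 2).pd 2).2)
      convert! this using 1
      ext x
      simp [Fin.sum_univ_three, add_assoc]
  refine ⟨hmem, ?_⟩
  have e1 : ∀ a, (gradMul (fun x => h ‖x‖) hφ.toH1 a : R3 → ℂ) =ᵐ[volume] pd a g := by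
    intro a
    rw [gradMul_apply, IsTest.grad_toH1, IsTest.embL2_toH1,
      ← toL2_pd_mul hm.contDiff hm.bdd a (hm.bdd_pd a) hφ.1 hφ.memLp (hφ.pd a).memLp]
    exact coeFn_toL2 (hgt.pd a).memLp
  have e2 : ∀ a, matOp (coefS h) (matOp (coefS h) (gradMul (fun x => h ‖x‖) hφ.toH1)) a =
      toL2 (fluxField h g a) := fun a => (toL2_eq (matOp_coefS_coefS hh e1 a)).symm
  have e3 : inner ℂ (formMap h hφ.toH1) (formMap h w) =
      ∑ a, inner ℂ (toL2 (fluxField h g a)) (grad (hm.smul w) a) := by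
    change inner ℂ (matOp (coefS h) (gradMul (fun x => h ‖x‖) hφ.toH1))
      (matOp (coefS h) (gradMul (fun x => h ‖x‖) w)) = _
    rw [← inner_matOp_left hS coefS_comm, PiLp.inner_apply]
    simp only [e2]
    rfl
  have e4 : ∀ a, inner ℂ (toL2 (fluxField h g a)) (grad (hm.smul w) a) =
      inner ℂ (-rmul (fun x => h ‖x‖) (toL2 (pd a (fluxField h g a)))) (embL2 w) := by
    intro a
    have := inner_grad (hF a).toH1 (hm.smul w) a
    rw [IsTest.embL2_toH1, IsTest.grad_toH1] at this
    rw [this, IsMultiplier.embL2_smul, inner_neg_left, inner_mulOp_ofReal_left hm.bdd]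
  rw [e3]
  simp only [e4]
  rw [← sum_inner]
  congr 1
  apply toL2_eq
  filter_upwards [hae, Lp.coeFn_finsetSum Finset.univ fun a =>
      -rmul (fun x => h ‖x‖) (toL2 (pd a (fluxField h g a))),
    ae_all_iff.2 fun a => Lp.coeFn_neg (rmul (fun x => h ‖x‖) (toL2 (pd a (fluxField h g a)))),
    ae_all_iff.2 fun a => coeFn_mulOp hm.bdd (toL2 (pd a (fluxField h g a))),
    ae_all_iff.2 fun a => coeFn_toL2 ((hF a).pd a).memLp] with x h1 h2 h3 h4 h5
  rw [h1, h2, Finset.sum_apply, Finset.mul_sum]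
  refine Finset.sum_congr rfl fun a _ => ?_
  rw [h3, Pi.neg_apply, h4, h5]
  ring

theorem eq_zero_of_forall_test {f : L2R3} (hf : ∀ φ, IsTest φ → inner ℂ (toL2 φ) f = 0) : f = 0 := by
  have h1 : ∀ v : H1, inner ℂ (embL2 v) f = 0 := by
    intro v
    induction v using H1_induction with
    | hc => exact isClosed_eq (by fun_prop) continuous_const
    | ht φ hφ => exact hf φ hφ
  exact denseRange_embL2.eq_zero_of_inner_right ℂ h1

/-- By `inner_P1Expr`, the distributional equation for an `H¹` function is the form equation tested
against `C_c^∞`. -/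
theorem mem_P1Graph (hh : IsRadialCoeff h) {u f : L2R3} :
    (u, f) ∈ P1Graph h ↔ ∃ v : H1, embL2 v = u ∧
      ∀ φ (hφ : IsTest φ), inner ℂ (formMap h hφ.toH1) (formMap h v) = inner ℂ (toL2 φ) f := by
  constructor
  · rintro ⟨⟨G, hG⟩, h1⟩
    refine ⟨hG.toH1, rfl, fun φ hφ => ?_⟩
    obtain ⟨h2, h3⟩ := inner_P1Expr hh hφ hG.toH1
    rw [← h3]
    exact h1 φ hφ.1 hφ.2 _ _ (coeFn_toL2 hφ.memLp) (coeFn_toL2 h2)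
  · rintro ⟨v, rfl, hv⟩
    refine ⟨⟨_, isWeakGrad_grad v⟩, fun φ h1 h2 Φ Ψ h3 h4 => ?_⟩
    have hφ : IsTest φ := ⟨h1, h2⟩
    rw [← toL2_eq h3, ← toL2_eq h4, (inner_P1Expr hh hφ v).2]
    exact hv φ hφ

/-- `toLinearPMap` reproduces the graph once it is single valued: for `u = 0` the form side
vanishes, so `f` is orthogonal to all test functions. -/
theorem P1_graph (hh : IsRadialCoeff h) : (P1 h).graph = P1Graph h := by
  apply Submodule.toLinearPMap_graph_eq
  rintro ⟨u, f⟩ hx (rfl : u = 0)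
  obtain ⟨v, hv, h1⟩ := (mem_P1Graph hh).1 hx
  have hv0 : v = 0 := embL2_injective (by rw [hv, map_zero])
  subst hv0
  apply eq_zero_of_forall_test
  intro φ hφ
  rw [← h1 φ hφ, map_zero, inner_zero_right]

/-- By density the equation for `(u, f)` holds against all of `H¹`, where it is the equation
defining `R (u + f)`. The solution is unique because a difference of two solutions has zero energy.
-/
theorem isGraphResolvent_P1 (hh : IsRadialCoeff h) {R : L2R3 →L[ℂ] L2R3}
    (hR : IsFormResolvent embL2 (formMap h) R) : IsGraphResolvent (P1 h) R := by
  intro u f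
  rw [P1_graph hh, mem_P1Graph hh]
  constructor
  · rintro ⟨v, rfl, h1⟩
    obtain ⟨v', hv', h2⟩ := hR (embL2 v + f)
    have h3 : ∀ w : H1, inner ℂ (formMap h w) (formMap h v) = inner ℂ (embL2 w) f := by
      intro w
      induction w using H1_induction with
      | hc => exact isClosed_eq (by fun_prop) (by fun_prop)
      | ht φ hφ => exact h1 φ hφ
    have h4 := h2 (v' - v)
    have h5 := h3 (v' - v)
    have h6 : inner ℂ (embL2 (v' - v)) (embL2 (v' - v)) +
        inner ℂ (formMap h (v' - v)) (formMap h (v' - v)) = (0 : ℂ) := by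
      rw [map_sub (formMap h) v' v, inner_sub_right, ← map_sub, h5, map_sub embL2 v' v,
        inner_sub_right, ← map_sub]
      rw [inner_add_right] at h4
      linear_combination h4
    have h7 : ‖embL2 (v' - v)‖ ^ 2 + ‖formMap h (v' - v)‖ ^ 2 = 0 := by
      rw [inner_self_eq_norm_sq_to_K, inner_self_eq_norm_sq_to_K] at h6
      apply Complex.ofReal_injective
      rw [Complex.ofReal_add, Complex.ofReal_pow, Complex.ofReal_pow]
      exact h6
    have h8 : ‖embL2 (v' - v)‖ ^ 2 = 0 := by nlinarith [sq_nonneg ‖formMap h (v' - v)‖, sq_nonneg ‖embL2 (v' - v)‖]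
    rw [sq_eq_zero_iff, norm_eq_zero, map_sub, sub_eq_zero] at h8
    rw [← hv', h8]
  · intro h1
    obtain ⟨v, hv, h2⟩ := hR (u + f)
    refine ⟨v, hv.trans h1, fun φ hφ => ?_⟩
    have h3 := h2 hφ.toH1
    rw [hv, h1, inner_add_right] at h3
    exact add_left_cancel h3

theorem exists_isFormResolvent_formMap (hh : IsRadialCoeff h) :
    ∃ R, IsFormResolvent embL2 (formMap h) R := by
  obtain ⟨C, hC1, hC⟩ := exists_formMap_bounds hh
  refine exists_isFormResolvent embL2 (formMap h) (c := C⁻¹) (by positivity) fun v => ?_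
  rw [norm_sq_H1, inv_mul_le_iff₀ (by positivity)]
  nlinarith [(hC v).2, sq_nonneg ‖embL2 v‖]

theorem exists_isFormResolvent_grad : ∃ R, IsFormResolvent embL2 grad R := by
  refine exists_isFormResolvent embL2 grad (c := 1) one_pos fun v => ?_
  rw [norm_sq_H1, one_mul]

theorem isSelfAdjoint_P1 (hh : IsRadialCoeff h) {R : L2R3 →L[ℂ] L2R3}
    (hR : IsFormResolvent embL2 (formMap h) R) : IsSelfAdjoint (P1 h) :=
  (isGraphResolvent_P1 hh hR).isSelfAdjoint hR.isSelfAdjoint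
    (denseRange_of_injective hR.isSelfAdjoint (hR.injective denseRange_embL2))

theorem regPow_P1 (hh : IsRadialCoeff h) {R : L2R3 →L[ℂ] L2R3}
    (hR : IsFormResolvent embL2 (formMap h) R) (α ε : ℝ) :
    regPow (P1 h) α ε = fcalc (regFun α ε) R := by
  rw [fcalc_eq_cfc, regPow, (isGraphResolvent_P1 hh hR).resolventNegOne_eq]
  rfl

end Operator

/-! ### Resolvents `(t² + A)⁻¹` and the square root on the form domain. -/

section FormCalculus

variable {H V K : Type*} [NormedAddCommGroup H] [InnerProductSpace ℂ H] [CompleteSpace H]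
  [NormedAddCommGroup V] [InnerProductSpace ℂ V] [CompleteSpace V]
  [NormedAddCommGroup K] [InnerProductSpace ℂ K] [CompleteSpace K]

/-- The variational equation of the resolvent `(t² + A)⁻¹`. -/
theorem IsFormResolvent.exists_resolvent {ι : V →L[ℂ] H} {ℓ : V →L[ℂ] K} {R : H →L[ℂ] H}
    (hR : IsFormResolvent ι ℓ R) {t : ℝ} (ht : 0 < t) (w : H) :
    ∃ v : V, ι v = fcalc (fun x => x / (1 - x + t ^ 2 * x)) R w ∧
      ∀ z, (t ^ 2 : ℂ) * inner ℂ (ι z) (ι v) + inner ℂ (ℓ z) (ℓ v) = inner ℂ (ι z) w := by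
  have hsa := hR.isSelfAdjoint
  have hpos : ∀ x ∈ spectrum ℝ R, 0 < 1 - x + t ^ 2 * x := by
    intro x hx
    obtain ⟨h0, h1⟩ := hR.spectrum_subset hx
    rcases h1.lt_or_eq with h | rfl
    · have : 0 ≤ t ^ 2 * x := by positivity
      linarith
    · have : 0 < t ^ 2 := by positivity
      linarith
  have hden : ContinuousOn (fun x : ℝ => 1 - x + t ^ 2 * x) (spectrum ℝ R) := by fun_prop
  have hinv : ContinuousOn (fun x : ℝ => (1 - x + t ^ 2 * x)⁻¹) (spectrum ℝ R) :=
    hden.inv₀ fun x hx => (hpos x hx).ne'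
  -- In terms of `x = (1 + l)⁻¹` the function `x / (1 - x + t² x)` is `(l + t²)⁻¹`. It is split as
  -- `R T` with `T = (1 - R + t² R)⁻¹`, so that the variational equation for `R (T w)` applies.
  set T := cfc (fun x : ℝ => (1 - x + t ^ 2 * x)⁻¹) R with hT
  have e1 : cfc (fun x => x / (1 - x + t ^ 2 * x)) R = R * T := by
    have := cfc_mul (fun x : ℝ => x) (fun x : ℝ => (1 - x + t ^ 2 * x)⁻¹) R (by fun_prop) hinv
    rw [cfc_id' ℝ R] at this
    simpa only [div_eq_mul_inv] using this
  have e2 : (1 - R + (t ^ 2) • R) * T = 1 := by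
    have h1 : cfc (fun x : ℝ => 1 - x + t ^ 2 * x) R = 1 - R + (t ^ 2) • R := by
      rw [cfc_add R (fun x : ℝ => 1 - x) (fun x : ℝ => t ^ 2 * x) (by fun_prop) (by fun_prop),
        cfc_sub (fun _ : ℝ => 1) (fun x : ℝ => x) R (by fun_prop) (by fun_prop),
        cfc_const_one ℝ R, cfc_id' ℝ R, cfc_const_mul (t ^ 2) (fun x : ℝ => x) R (by fun_prop),
        cfc_id' ℝ R]
    rw [← h1, hT, ← cfc_mul _ _ R hden hinv, ← cfc_const_one ℝ R]
    exact cfc_congr fun x hx => mul_inv_cancel₀ (hpos x hx).ne'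
  obtain ⟨v, hv, hz⟩ := hR (T w)
  refine ⟨v, ?_, fun z => ?_⟩
  · rw [fcalc_eq_cfc, e1, hv]
    rfl
  · have h1 : T w - R (T w) + t ^ 2 • R (T w) = w := congrArg (fun S : H →L[ℂ] H => S w) e2
    rw [← hv] at h1
    have h2 : T w = w + ι v - t ^ 2 • ι v := by
      calc T w = T w - ι v + t ^ 2 • ι v + ι v - t ^ 2 • ι v := by abel
        _ = _ := by rw [h1]
    have h3 := hz z
    have h4 : t ^ 2 • ι v = (t ^ 2 : ℂ) • ι v := by
      rw [← Complex.ofReal_pow, Complex.coe_smul]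
    rw [h2, h4, inner_sub_right, inner_add_right, inner_smul_right] at h3
    linear_combination h3

theorem IsFormResolvent.exists_tendsto_fcalc {ι : V →L[ℂ] H} {ℓ : V →L[ℂ] K} {R : H →L[ℂ] H}
    (hR : IsFormResolvent ι ℓ R) {u : H} {α C : ℝ}
    (hC : ∀ᶠ ε in 𝓝[>] 0, ‖fcalc (regFun α ε) R u‖ ≤ C) :
    ∃ w, Tendsto (fun ε => fcalc (regFun α ε) R u) (𝓝[>] 0) (𝓝 w) :=
  exists_tendsto_cfc_regFun hR.isSelfAdjoint hR.spectrum_subset hC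

theorem IsFormResolvent.norm_fcalc_le {K' : Type*} [NormedAddCommGroup K'] [InnerProductSpace ℂ K']
    [CompleteSpace K'] {ι : V →L[ℂ] H} {ℓ : V →L[ℂ] K} {ℓ' : V →L[ℂ] K'} {R R' : H →L[ℂ] H}
    (h : IsFormResolvent ι ℓ R) (h' : IsFormResolvent ι ℓ' R') {C : ℝ} (hC : 1 ≤ C)
    (hle : ∀ v, ‖ℓ v‖ ^ 2 ≤ C * ‖ℓ' v‖ ^ 2) (hge : ∀ v, ‖ℓ' v‖ ^ 2 ≤ C * ‖ℓ v‖ ^ 2) {ε s : ℝ}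
    (hε : 0 < ε) (hs1 : -1 ≤ s) (hs2 : s ≤ 1) (u : H) :
    ‖fcalc (regFun (s / 2) ε) R u‖ ≤ C * ‖fcalc (regFun (s / 2) ε) R' u‖ :=
  h.norm_cfc_regFun_le h' hC hle hge hε hs1 hs2 u

theorem IsFormResolvent.norm_fcalc_half_sq_le {ι : V →L[ℂ] H} {ℓ : V →L[ℂ] K} {R : H →L[ℂ] H}
    (hR : IsFormResolvent ι ℓ R) {ε : ℝ} (hε : 0 < ε) (v : V) :
    ‖fcalc (regFun (1 / 2) ε) R (ι v)‖ ^ 2 ≤ ‖ℓ v‖ ^ 2 + 2 * ε * (‖ι v‖ ^ 2 + ‖ℓ v‖ ^ 2) :=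
  hR.norm_cfc_regFun_half_sq_le hε v

theorem IsFormResolvent.norm_inner_le {ι : V →L[ℂ] H} {ℓ : V →L[ℂ] K} {R : H →L[ℂ] H}
    (hR : IsFormResolvent ι ℓ R) {w g z : H}
    (hz : Tendsto (fun ε => fcalc (regFun (1 / 2) ε) R w) (𝓝[>] 0) (𝓝 z)) (hwg : inner ℂ g w = 0)
    {D ρ : ℝ} (hρ : 0 < ρ)
    (h : ∀ t > 0, t ^ 2 * ‖inner ℂ g (fcalc (fun x => x / (1 - x + t ^ 2 * x)) R w)‖ ≤
      D / (1 + (ρ * t) ^ 2)) : ‖inner ℂ g z‖ ≤ D / ρ :=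
  norm_inner_le_of_resolvent_bound hR.isSelfAdjoint hR.spectrum_subset hz hwg hρ h

/-- The regularized square roots are bounded on the form domain, hence converge; the error `2 ε (‖ι
v‖² + ‖ℓ v‖²)` disappears in the limit. -/
theorem IsFormResolvent.exists_half {ι : V →L[ℂ] H} {ℓ : V →L[ℂ] K} {R : H →L[ℂ] H}
    (hR : IsFormResolvent ι ℓ R) (v : V) :
    ∃ z, Tendsto (fun ε => fcalc (regFun (1 / 2) ε) R (ι v)) (𝓝[>] 0) (𝓝 z) ∧ ‖z‖ ≤ ‖ℓ v‖ := by
  have hpos : ∀ᶠ ε : ℝ in 𝓝[>] 0, 0 < ε := self_mem_nhdsWithin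
  have hle1 : ∀ᶠ ε : ℝ in 𝓝[>] 0, ε ≤ 1 :=
    (Filter.Eventually.filter_mono nhdsWithin_le_nhds (eventually_le_nhds one_pos))
  obtain ⟨z, hz⟩ := hR.exists_tendsto_fcalc (α := 1 / 2) (u := ι v)
    (C := √(‖ℓ v‖ ^ 2 + 2 * (‖ι v‖ ^ 2 + ‖ℓ v‖ ^ 2))) (by
      filter_upwards [hpos, hle1] with ε h0 h1
      refine Real.le_sqrt_of_sq_le ((hR.norm_fcalc_half_sq_le h0 v).trans ?_)
      nlinarith [sq_nonneg ‖ι v‖, sq_nonneg ‖ℓ v‖])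
  refine ⟨z, hz, ?_⟩
  rw [← sq_le_sq₀ (norm_nonneg _) (norm_nonneg _)]
  refine le_of_tendsto_of_tendsto (hz.norm.pow 2)
    (g := fun ε : ℝ => ‖ℓ v‖ ^ 2 + 2 * ε * (‖ι v‖ ^ 2 + ‖ℓ v‖ ^ 2)) ?_ ?_
  · have : Continuous fun ε : ℝ => ‖ℓ v‖ ^ 2 + 2 * ε * (‖ι v‖ ^ 2 + ‖ℓ v‖ ^ 2) := by fun_prop
    simpa using (this.tendsto 0).mono_left nhdsWithin_le_nhds
  · filter_upwards [hpos] with ε h0 using hR.norm_fcalc_half_sq_le h0 v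

/-- The operator `A ^ (1/2)` on the form domain. -/
def IsFormResolvent.half {ι : V →L[ℂ] H} {ℓ : V →L[ℂ] K} {R : H →L[ℂ] H}
    (hR : IsFormResolvent ι ℓ R) : V →L[ℂ] H :=
  LinearMap.mkContinuous
    { toFun := fun v => (hR.exists_half v).choose
      map_add' := fun v w => by
        refine tendsto_nhds_unique (hR.exists_half (v + w)).choose_spec.1 ?_
        simp only [map_add]
        exact (hR.exists_half v).choose_spec.1.add (hR.exists_half w).choose_spec.1
      map_smul' := fun c v => by
        refine tendsto_nhds_unique (hR.exists_half (c • v)).choose_spec.1 ?_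
        simp only [map_smul]
        exact (hR.exists_half v).choose_spec.1.const_smul c } ‖ℓ‖
    fun v => (hR.exists_half v).choose_spec.2.trans (ℓ.le_opNorm v)

theorem IsFormResolvent.tendsto_half {ι : V →L[ℂ] H} {ℓ : V →L[ℂ] K} {R : H →L[ℂ] H}
    (hR : IsFormResolvent ι ℓ R) (v : V) :
    Tendsto (fun ε => fcalc (regFun (1 / 2) ε) R (ι v)) (𝓝[>] 0) (𝓝 (hR.half v)) :=
  (hR.exists_half v).choose_spec.1

theorem IsFormResolvent.norm_half_le {ι : V →L[ℂ] H} {ℓ : V →L[ℂ] K} {R : H →L[ℂ] H}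
    (hR : IsFormResolvent ι ℓ R) (v : V) : ‖hR.half v‖ ≤ ‖ℓ v‖ :=
  (hR.exists_half v).choose_spec.2

end FormCalculus

/-! ### Fractional powers of `P₁` and homogeneous Sobolev norms. -/

section Sobolev

theorem norm_le_of_enorm_le_toReal {E : Type*} [SeminormedAddCommGroup E] {x : E} {a : ℝ≥0∞} (ha : a ≠ ⊤)
    (h : ‖x‖ₑ ≤ a) : ‖x‖ ≤ a.toReal := by
  rw [← toReal_enorm]
  exact ENNReal.toReal_mono ha h

theorem enorm_le_ofReal_mul {E F : Type*} [SeminormedAddCommGroup E] [SeminormedAddCommGroup F]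
    {x : E} {y : F} {C : ℝ} (hC : 0 ≤ C) (h : ‖x‖ ≤ C * ‖y‖) : ‖x‖ₑ ≤ ENNReal.ofReal C * ‖y‖ₑ := by
  rw [← ofReal_norm, ← ofReal_norm, ← ENNReal.ofReal_mul hC]
  exact ENNReal.ofReal_le_ofReal h

theorem eventually_norm_le_of_tendsto {E : Type*} [SeminormedAddCommGroup E] {f : ℝ → E} {w : E}
    (h : Tendsto f (𝓝[>] 0) (𝓝 w)) : ∀ᶠ ε in 𝓝[>] 0, ‖f ε‖ ≤ ‖w‖ + 1 :=
  h.norm.eventually (eventually_le_nhds (lt_add_one _))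

variable {h : ℝ → ℝ} {C s : ℝ}

/-- Membership on either side amounts to boundedness of the regularized powers as `ε → 0`, and those
of `P₁` and `-Δ` are comparable uniformly in `ε`. -/
theorem mem_fracPow_P1 (hh : IsRadialCoeff h) (hC : 1 ≤ C)
    (hb : ∀ v, ‖formMap h v‖ ^ 2 ≤ C * ‖grad v‖ ^ 2 ∧ ‖grad v‖ ^ 2 ≤ C * ‖formMap h v‖ ^ 2)
    (hs1 : -1 ≤ s) (hs2 : s ≤ 1) (u : L2R3) :
    u ∈ (fracPow (P1 h) (s / 2)).domain ↔ hDotNorm s u < ⊤ := by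
  obtain ⟨R, hR⟩ := exists_isFormResolvent_formMap hh
  obtain ⟨R₀, hR₀⟩ := exists_isFormResolvent_grad
  have hpos : ∀ᶠ ε : ℝ in 𝓝[>] 0, 0 < ε := self_mem_nhdsWithin
  simp only [mem_fracPow_domain, regPow_P1 hh hR]
  constructor
  · rintro ⟨w, hw⟩
    refine (hDotNorm_le_of_eventually (C := ENNReal.ofReal (C * (‖w‖ + 1))) hR₀ ?_).trans_lt
      ENNReal.ofReal_lt_top
    filter_upwards [hpos, eventually_norm_le_of_tendsto hw] with ε h0 h1
    rw [← ofReal_norm]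
    refine ENNReal.ofReal_le_ofReal ((hR₀.norm_fcalc_le hR hC (fun v => (hb v).2)
      (fun v => (hb v).1) h0 hs1 hs2 u).trans ?_)
    gcongr
  · intro hu
    refine hR.exists_tendsto_fcalc (C := C * (hDotNorm s u + 1).toReal) ?_
    filter_upwards [hpos, (tendsto_enorm_fcalc_regFun hR₀ hu).eventually
      (eventually_le_nhds (ENNReal.lt_add_right hu.ne one_ne_zero))] with ε h0 h1
    refine (hR.norm_fcalc_le hR₀ hC (fun v => (hb v).1) (fun v => (hb v).2) h0 hs1 hs2 u).trans ?_
    gcongr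
    exact norm_le_of_enorm_le_toReal (by simp [hu.ne]) h1

theorem enorm_fracPow_P1 (hh : IsRadialCoeff h) (hC : 1 ≤ C)
    (hb : ∀ v, ‖formMap h v‖ ^ 2 ≤ C * ‖grad v‖ ^ 2 ∧ ‖grad v‖ ^ 2 ≤ C * ‖formMap h v‖ ^ 2)
    (hs1 : -1 ≤ s) (hs2 : s ≤ 1) (u : (fracPow (P1 h) (s / 2)).domain) :
    ‖fracPow (P1 h) (s / 2) u‖ₑ ≤ ENNReal.ofReal C * hDotNorm s (u : L2R3) ∧
      hDotNorm s (u : L2R3) ≤ ENNReal.ofReal C * ‖fracPow (P1 h) (s / 2) u‖ₑ := by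
  have hu := (mem_fracPow_P1 hh hC hb hs1 hs2 u).1 u.2
  obtain ⟨R, hR⟩ := exists_isFormResolvent_formMap hh
  obtain ⟨R₀, hR₀⟩ := exists_isFormResolvent_grad
  have hpos : ∀ᶠ ε : ℝ in 𝓝[>] 0, 0 < ε := self_mem_nhdsWithin
  have h1 := tendsto_enorm_fcalc_regFun hR₀ hu
  have h2 := (tendsto_fracPow (P1 h) (s / 2) u).enorm
  simp only [regPow_P1 hh hR] at h2
  constructor
  · refine le_of_tendsto_of_tendsto h2
      (ENNReal.Tendsto.const_mul h1 (Or.inr ENNReal.ofReal_ne_top)) ?_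
    filter_upwards [hpos] with ε h0
    exact enorm_le_ofReal_mul (zero_le_one.trans hC)
      (hR.norm_fcalc_le hR₀ hC (fun v => (hb v).1) (fun v => (hb v).2) h0 hs1 hs2 u)
  · refine le_of_tendsto_of_tendsto h1
      (ENNReal.Tendsto.const_mul h2 (Or.inr ENNReal.ofReal_ne_top)) ?_
    filter_upwards [hpos] with ε h0
    exact enorm_le_ofReal_mul (zero_le_one.trans hC)
      (hR₀.norm_fcalc_le hR hC (fun v => (hb v).2) (fun v => (hb v).1) h0 hs1 hs2 u)

end Sobolev

/-! ### Caccioppoli estimates for the resolvent. -/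

section Caccioppoli

theorem re_inner_self {E : Type*} [NormedAddCommGroup E] [InnerProductSpace ℂ E] (x : E) :
    (inner ℂ x x).re = ‖x‖ ^ 2 := inner_self_eq_norm_sq (𝕜 := ℂ) x

theorem re_inner_symm {E : Type*} [NormedAddCommGroup E] [InnerProductSpace ℂ E] (x y : E) :
    (inner ℂ x y).re = (inner ℂ y x).re := inner_re_symm (𝕜 := ℂ) x y

theorem isBddMul_mul {a b : R3 → ℝ} (ha : IsBddMul fun x => (a x : ℂ))
    (hb : IsBddMul fun x => (b x : ℂ)) : IsBddMul fun x => ((a x * b x : ℝ) : ℂ) := by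
  simpa only [Complex.ofReal_mul] using ha.mul hb

theorem rmul_mul_apply {a b : R3 → ℝ} (ha : IsBddMul fun x => (a x : ℂ))
    (hb : IsBddMul fun x => (b x : ℂ)) (u : L2R3) :
    rmul (fun x => a x * b x) u = rmul a (rmul b u) := by
  rw [← mulOp_mul_apply ha hb]
  simp only [rmul, Complex.ofReal_mul]

theorem rmul_comm {a b : R3 → ℝ} (ha : IsBddMul fun x => (a x : ℂ))
    (hb : IsBddMul fun x => (b x : ℂ)) (u : L2R3) : rmul a (rmul b u) = rmul b (rmul a u) := by
  rw [← rmul_mul_apply ha hb, ← rmul_mul_apply hb ha]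
  simp only [mul_comm]

/-- Multiplication of a vector field by a bounded real function. -/
def rmulV (a : R3 → ℝ) : V3 →L[ℂ] V3 := toV3 fun i => (rmul a).comp (compV3 i)

@[simp]
theorem rmulV_apply (a : R3 → ℝ) (G : V3) (i : Fin 3) : rmulV a G i = rmul a (G i) := rfl

theorem inner_rmulV_left {a : R3 → ℝ} (ha : IsBddMul fun x => (a x : ℂ)) (F G : V3) :
    inner ℂ (rmulV a F) G = inner ℂ F (rmulV a G) := by
  simp only [PiLp.inner_apply, rmulV_apply]
  exact Finset.sum_congr rfl fun i _ => inner_mulOp_ofReal_left ha _ _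

theorem matOp_rmulV {S : Fin 3 → Fin 3 → R3 → ℝ} (hS : ∀ a b, IsBddMul fun x => (S a b x : ℂ))
    {χ : R3 → ℝ} (hχ : IsBddMul fun x => (χ x : ℂ)) (G : V3) :
    matOp S (rmulV χ G) = rmulV χ (matOp S G) := by
  ext1 a
  rw [rmulV_apply, matOp_apply, matOp_apply, map_sum]
  exact Finset.sum_congr rfl fun b _ => rmul_comm (hS a b) hχ _

theorem sq_mul_norm_le_of_form {H K : Type*} [NormedAddCommGroup H] [InnerProductSpace ℂ H]
    [NormedAddCommGroup K] [InnerProductSpace ℂ K] {u w : H} {y : K} {t : ℝ}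
    (h : (t ^ 2 : ℂ) * inner ℂ u u + inner ℂ y y = inner ℂ u w) : t ^ 2 * ‖u‖ ≤ ‖w‖ := by
  have e1 := congrArg Complex.re h
  rw [Complex.add_re, ← Complex.ofReal_pow, Complex.re_ofReal_mul, re_inner_self,
    re_inner_self] at e1
  have e4 : (inner ℂ u w).re ≤ ‖u‖ * ‖w‖ := re_inner_le_norm (𝕜 := ℂ) u w
  rcases (norm_nonneg u).eq_or_lt with h | h
  · rw [← h, mul_zero]
    exact norm_nonneg _
  · have : ‖u‖ * (t ^ 2 * ‖u‖) ≤ ‖u‖ * ‖w‖ := by nlinarith [sq_nonneg ‖y‖]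
    exact le_of_mul_le_mul_left this h

variable {h : ℝ → ℝ}

/-- The commutator of `formMap h` with multiplication by `χ`. -/
def commOp (h : ℝ → ℝ) (χ : R3 → ℝ) : L2R3 →L[ℂ] V3 :=
  (matOp (coefS h)).comp (toV3 fun i => rmul fun x => h ‖x‖ * pd i χ x)

theorem formMap_smul (hh : IsRadialCoeff h) {χ : R3 → ℝ} (hχ : IsMultiplier χ) (v : H1) :
    formMap h (hχ.smul v) = rmulV χ (formMap h v) + commOp h χ (embL2 v) := by
  have hm := hh.isRadialMultiplier.isMultiplier
  change matOp (coefS h) (gradMul (fun x => h ‖x‖) (hχ.smul v)) =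
    rmulV χ (matOp (coefS h) (gradMul (fun x => h ‖x‖) v)) +
      matOp (coefS h) (toV3 (fun i => rmul fun x => h ‖x‖ * pd i χ x) (embL2 v))
  rw [← matOp_rmulV (isBddMul_coefS hh) hχ.bdd, ← map_add]
  congr 1
  ext1 i
  rw [PiLp.add_apply, rmulV_apply, gradMul_apply, gradMul_apply, toV3_apply,
    IsMultiplier.grad_smul, IsMultiplier.embL2_smul, map_add, map_add,
    rmul_mul_apply hm.bdd (hχ.bdd_pd i), rmul_comm hm.bdd hχ.bdd, rmul_comm (hm.bdd_pd i) hχ.bdd]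
  abel

theorem commOp_rmul (hh : IsRadialCoeff h) {χ : R3 → ℝ} (hχ : IsMultiplier χ) (u : L2R3) :
    commOp h χ (rmul χ u) = rmulV χ (commOp h χ u) := by
  have hm := hh.isRadialMultiplier.isMultiplier
  change matOp (coefS h) (toV3 (fun i => rmul fun x => h ‖x‖ * pd i χ x) (rmul χ u)) =
    rmulV χ (matOp (coefS h) (toV3 (fun i => rmul fun x => h ‖x‖ * pd i χ x) u))
  rw [← matOp_rmulV (isBddMul_coefS hh) hχ.bdd]
  congr 1
  ext1 i
  exact rmul_comm (isBddMul_mul hm.bdd (hχ.bdd_pd i)) hχ.bdd u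

/-- The commutator multiplies by `S (h ∇χ)` without differentiating `u`. The constant `6` covers `h
≤ 3/2`, three components and the factor `4` of `S` on squared norms: `4 * 3 * (3/2)² = 27 ≤ 36`. -/
theorem norm_commOp_le (hh : IsRadialCoeff h) {χ b : R3 → ℝ} (hχ : IsMultiplier χ)
    (hb : IsBddMul fun x => (b x : ℂ)) {M : ℝ} (hM : 0 ≤ M) (hle : ∀ i x, |pd i χ x| ≤ M * |b x|)
    (u : L2R3) : ‖commOp h χ u‖ ≤ 6 * M * ‖rmul b u‖ := by
  have hm := hh.isRadialMultiplier.isMultiplier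
  refine (sq_le_sq₀ (norm_nonneg _) (by positivity)).1 ?_
  have h1 := norm_sq_le_of_comp_le (G := toV3 (fun i => rmul fun x => h ‖x‖ * pd i χ x) u)
    (C := 3 / 2 * M * ‖rmul b u‖) fun i => by
      refine norm_rmul_le_of_le (isBddMul_mul hm.bdd (hχ.bdd_pd i)) hb (fun x => ?_) u
      rw [abs_mul, mul_assoc]
      have h2 := hh.half_le ‖x‖
      rw [abs_of_nonneg (by linarith : 0 ≤ h ‖x‖)]
      gcongr
      · exact hh.le _
      · exact hle i x
  refine (norm_matOp_coefS_sq_le hh _).trans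
    ((mul_le_mul_of_nonneg_left h1 (by norm_num)).trans ?_)
  nlinarith [sq_nonneg (M * ‖rmul b u‖)]

/-- The Caccioppoli identity for solutions of `(t² + A) v = w`, away from the support of `w`. -/
theorem caccioppoli (hh : IsRadialCoeff h) {χ : R3 → ℝ} (hχ : IsMultiplier χ) {v : H1} {w : L2R3}
    {t : ℝ} (hv : ∀ z, (t ^ 2 : ℂ) * inner ℂ (embL2 z) (embL2 v) +
      inner ℂ (formMap h z) (formMap h v) = inner ℂ (embL2 z) w) (hw : rmul χ w = 0) :
    t ^ 2 * ‖rmul χ (embL2 v)‖ ^ 2 + ‖formMap h (hχ.smul v)‖ ^ 2 = ‖commOp h χ (embL2 v)‖ ^ 2 := by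
  -- The equation is tested with `χ² v`.
  have h1 := hv (hχ.smul (hχ.smul v))
  rw [IsMultiplier.embL2_smul, inner_mulOp_ofReal_left hχ.bdd, inner_mulOp_ofReal_left hχ.bdd, hw,
    inner_zero_right, formMap_smul hh hχ (hχ.smul v), inner_add_left, inner_rmulV_left hχ.bdd,
    IsMultiplier.embL2_smul, commOp_rmul hh hχ, inner_rmulV_left hχ.bdd] at h1
  -- With `L = formMap h` and `Y` the commutator, the tested form becomes `⟨L (χ v) + Y v, L (χ v) -
  -- Y v⟩`, and the cross terms cancel in the real part.
  have h2 : rmulV χ (formMap h v) = formMap h (hχ.smul v) - commOp h χ (embL2 v) := by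
    rw [formMap_smul hh hχ, add_sub_cancel_right]
  rw [h2, inner_sub_right, inner_sub_right] at h1
  have h3 := congrArg Complex.re h1
  have h4 : (inner ℂ (commOp h χ (embL2 v)) (formMap h (hχ.smul v))).re =
      (inner ℂ (formMap h (hχ.smul v)) (commOp h χ (embL2 v))).re :=
    re_inner_symm _ _
  rw [← Complex.ofReal_pow] at h3
  simp only [Complex.add_re, Complex.sub_re, Complex.re_ofReal_mul, Complex.zero_re] at h3
  rw [re_inner_self, re_inner_self, re_inner_self, h4] at h3
  linarith

theorem IsMultiplier.mul {a b : R3 → ℝ} (ha : IsMultiplier a) (hb : IsMultiplier b) :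
    IsMultiplier fun x => a x * b x := by
  refine ⟨ha.contDiff.mul hb.contDiff, isBddMul_mul ha.bdd hb.bdd, fun i => ?_⟩
  have h1 := (isBddMul_mul ha.bdd (hb.bdd_pd i)).add (isBddMul_mul (ha.bdd_pd i) hb.bdd)
  convert! h1 using 2 with x
  rw [pd_mul_real (ha.contDiff.differentiable (by simp) x) (hb.contDiff.differentiable (by simp) x)]
  push_cast
  rfl

theorem IsMultiplier.pow {a : R3 → ℝ} (ha : IsMultiplier a) (n : ℕ) :
    IsMultiplier fun x => a x ^ (n + 1) := by
  induction n with
  | zero => simpa using ha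
  | succ n ih => simpa only [pow_succ] using ih.mul ha

theorem pd_pow {a : R3 → ℝ} {x : R3} (ha : DifferentiableAt ℝ a x) (n : ℕ) (i : Fin 3) :
    pd i (fun y => a y ^ (n + 1)) x = (n + 1) * a x ^ n * pd i a x := by
  unfold pd
  rw [(ha.hasFDerivAt.pow (n + 1)).fderiv]
  simp

theorem norm_rmul_pow_le {a : R3 → ℝ} (ha : IsMultiplier a) (h1 : ∀ x, |a x| ≤ 1) (n : ℕ)
    (u : L2R3) : ‖rmul (fun x => a x ^ (n + 1)) u‖ ≤ ‖u‖ := by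
  have := norm_rmul_le (ha.pow n).bdd (C := 1)
    (fun x => by rw [abs_pow]; exact pow_le_one₀ (abs_nonneg _) (h1 x)) u
  rwa [one_mul] at this

/-- Decay of the resolvent `(t² + A)⁻¹ w` at distance `ρ` from the support of `w`. -/
theorem exists_norm_formMap_cutoff_le (hh : IsRadialCoeff h) :
    ∃ A, 0 < A ∧ ∀ (t ρ : ℝ) (_ : 0 < t) (hρ : 0 < ρ) (v : H1) (w : L2R3),
      (∀ z, (t ^ 2 : ℂ) * inner ℂ (embL2 z) (embL2 v) +
        inner ℂ (formMap h z) (formMap h v) = inner ℂ (embL2 z) w) →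
      rmul (cutoff ρ) w = 0 →
      t ^ 2 * ((1 + (ρ * t) ^ 2) * ‖formMap h (((isMultiplier_cutoff hρ).pow 2).smul v)‖) ≤
        A / ρ * ‖w‖ := by
  obtain ⟨C, hC0, hC⟩ := exists_abs_pd_cutoff_le
  -- `18 = 6 * 3`: the constant of `norm_commOp_le` times the largest factor `n + 1` from
  -- differentiating `χ ^ (n + 1)`.
  set B := 18 * C with hB
  have hB0 : 0 < B := by positivity
  refine ⟨B * (1 + B ^ 2), by positivity, fun t ρ ht hρ v w hv hw => ?_⟩
  have hm := isMultiplier_cutoff hρ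
  have hw' : ∀ n, rmul (fun x => cutoff ρ x ^ (n + 1)) w = 0 := by
    intro n
    induction n with
    | zero => simpa using hw
    | succ n ih => simp only [pow_succ _ (n + 1), rmul_mul_apply (hm.pow n).bdd hm.bdd, hw, map_zero]
  -- Differentiating `χ ^ (n + 1)` leaves a factor `χ ^ n`, so the estimate iterates through `χ³`,
  -- `χ²`, `χ`, `1`. Each of the three steps costs `B / ρ`, and the last two also gain `1 / t`.
  have hY : ∀ n : ℕ, n ≤ 2 → ∀ u b, (b = fun x => cutoff ρ x ^ n) →
      IsBddMul (fun x => (b x : ℂ)) →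
      ‖commOp h (fun x => cutoff ρ x ^ (n + 1)) u‖ ≤ B / ρ * ‖rmul b u‖ := by
    rintro n hn u b rfl hb
    have h3 : ((n : ℝ) + 1) ≤ 3 := by
      have : (n : ℝ) ≤ 2 := by exact_mod_cast hn
      linarith
    refine (norm_commOp_le hh (hm.pow n) hb (M := 3 * (C / ρ)) (by positivity) ?_ u).trans
      (le_of_eq (by rw [hB]; ring))
    intro i x
    rw [pd_pow (hm.contDiff.differentiable (by simp) x), abs_mul, abs_mul]
    have h4 : |(n : ℝ) + 1| ≤ 3 := by rwa [abs_of_nonneg (by positivity)]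
    calc |(n : ℝ) + 1| * |cutoff ρ x ^ n| * |pd i (cutoff ρ) x|
        ≤ 3 * |cutoff ρ x ^ n| * (C / ρ) := by gcongr; exact hC ρ hρ i x
      _ = _ := by ring
  set u := embL2 v with hu
  have hc := fun n => caccioppoli hh (hm.pow n) hv (hw' n)
  have hb := fun n => (hm.pow n).bdd
  set F := ‖formMap h ((hm.pow 2).smul v)‖ with hF
  have hF1 : F ≤ B / ρ * ‖rmul (fun x => cutoff ρ x ^ 2) u‖ := by
    refine le_trans ?_ (hY 2 le_rfl u _ rfl (hb 1))
    refine (sq_le_sq₀ (norm_nonneg _) (norm_nonneg _)).1 ?_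
    rw [← hc 2]
    have : 0 ≤ t ^ 2 * ‖rmul (fun x => cutoff ρ x ^ (2 + 1)) u‖ ^ 2 := by positivity
    linarith
  have hstep : ∀ n, t * ‖rmul (fun x => cutoff ρ x ^ (n + 1)) u‖ ≤
      ‖commOp h (fun x => cutoff ρ x ^ (n + 1)) u‖ := by
    intro n
    refine (sq_le_sq₀ (by positivity) (norm_nonneg _)).1 ?_
    rw [← hc n, mul_pow]
    linarith [sq_nonneg ‖formMap h ((hm.pow n).smul v)‖]
  have h2 : t * ‖rmul (fun x => cutoff ρ x ^ 2) u‖ ≤ B / ρ * ‖rmul (cutoff ρ) u‖ :=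
    (hstep 1).trans (hY 1 (by norm_num) u _ (by simp) hm.bdd)
  have h1 : t * ‖rmul (cutoff ρ) u‖ ≤ B / ρ * ‖u‖ := by
    have e1 := hstep 0
    have e2 := hY 0 (by norm_num) u (fun _ => 1) (by simp) (IsBddMul.const _)
    have e3 : rmul (fun _ => 1) u = u := by
      have := mulOp_const_apply 1 u
      rw [one_smul] at this
      simpa [rmul] using this
    rw [e3] at e2
    simp only [zero_add, pow_one] at e1 e2
    exact e1.trans e2
  have h0 : ‖rmul (fun x => cutoff ρ x ^ 2) u‖ ≤ ‖u‖ :=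
    norm_rmul_pow_le hm (abs_cutoff_le_one ρ) 1 u
  have hw0 : t ^ 2 * ‖u‖ ≤ ‖w‖ := sq_mul_norm_le_of_form (hv v)
  have e1 : (ρ * t) ^ 2 * F ≤ B ^ 2 * (B / ρ * ‖u‖) := by
    calc (ρ * t) ^ 2 * F ≤ (ρ * t) ^ 2 * (B / ρ * ‖rmul (fun x => cutoff ρ x ^ 2) u‖) := by gcongr
      _ = ρ * t * B * (t * ‖rmul (fun x => cutoff ρ x ^ 2) u‖) := by field_simp
      _ ≤ ρ * t * B * (B / ρ * ‖rmul (cutoff ρ) u‖) := by gcongr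
      _ = B ^ 2 * (t * ‖rmul (cutoff ρ) u‖) := by field_simp
      _ ≤ _ := by gcongr
  have e2 : F ≤ B / ρ * ‖u‖ := hF1.trans (by gcongr)
  calc t ^ 2 * ((1 + (ρ * t) ^ 2) * F) = t ^ 2 * (F + (ρ * t) ^ 2 * F) := by ring
    _ ≤ t ^ 2 * (B / ρ * ‖u‖ + B ^ 2 * (B / ρ * ‖u‖)) := by gcongr
    _ = B * (1 + B ^ 2) / ρ * (t ^ 2 * ‖u‖) := by ring
    _ ≤ _ := by gcongr

end Caccioppoli

/-! ### Off-diagonal decay of the square root. -/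

section OffDiagonal

variable {h : ℝ → ℝ}

theorem abs_le_mul_hardyWeight {b : R3 → ℝ} (h1 : ∀ x, |b x| ≤ 1) {r : ℝ} (hr : 0 < r)
    (hs : ∀ x, b x ≠ 0 → ‖x‖ ≤ r) (x : R3) : |b x| ≤ 2 * r * |hardyWeight (r ^ 2) x| := by
  by_cases hb : b x = 0
  · rw [hb, abs_zero]
    positivity
  · refine (h1 x).trans ?_
    have hx := hs x hb
    have h2 : √(‖x‖ ^ 2 + r ^ 2) ≤ 2 * r := by
      refine Real.sqrt_le_iff.2 ⟨by positivity, ?_⟩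
      nlinarith [norm_nonneg x]
    have h3 : 0 < √(‖x‖ ^ 2 + r ^ 2) := Real.sqrt_pos.2 (by positivity)
    rw [hardyWeight, abs_of_pos (inv_pos.2 h3), ← div_eq_mul_inv, one_le_div h3]
    exact h2

/-- On `|x| ≤ r` one has `1 ≤ 2 r (|x|² + r²) ^ (-1/2)`, and Hardy's inequality contributes another
factor `2`. -/
theorem norm_rmul_embL2_le {b : R3 → ℝ} (hb : Measurable b) (h1 : ∀ x, |b x| ≤ 1) {r : ℝ}
    (hr : 0 < r) (hs : ∀ x, b x ≠ 0 → ‖x‖ ≤ r) (v : H1) :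
    ‖rmul b (embL2 v)‖ ≤ 4 * r * ‖grad v‖ := by
  have hr2 : 0 < r ^ 2 := by positivity
  refine (norm_rmul_le_of_le (IsBddMul.ofReal hb h1) (isBddMul_hardyWeight hr2)
    (abs_le_mul_hardyWeight h1 hr hs) _).trans ?_
  refine (mul_le_mul_of_nonneg_left (norm_rmul_hardyWeight_le hr2 v) (by positivity)).trans
    (le_of_eq ?_)
  ring

/-- The off-diagonal decay of the kernel of `A ^ (1/2)`. -/
theorem exists_norm_rmul_half_le (hh : IsRadialCoeff h) {R : L2R3 →L[ℂ] L2R3}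
    (hR : IsFormResolvent embL2 (formMap h) R) :
    ∃ A, 0 < A ∧ ∀ (ρ r : ℝ) (_ : 0 < ρ) (_ : 0 < r) (_ : r ≤ ρ) (b : R3 → ℝ) (_ : Measurable b)
      (_ : ∀ x, |b x| ≤ 1) (_ : ∀ x, b x ≠ 0 → ‖x‖ ≤ r) (w : H1),
      rmul (cutoff ρ) (embL2 w) = 0 →
      ‖rmul b (hR.half w)‖ ≤ A * (r / ρ ^ 2) * ‖embL2 w‖ := by
  obtain ⟨A, hA0, hA⟩ := exists_norm_formMap_cutoff_le hh
  obtain ⟨C, hC1, hC⟩ := exists_formMap_bounds hh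
  refine ⟨4 * C * A, by positivity, fun ρ r hρ hr hrρ b hb h1 hs w hw => ?_⟩
  have hbb : IsBddMul fun x => (b x : ℂ) := IsBddMul.ofReal hb h1
  have hm := isMultiplier_cutoff hρ
  set z := hR.half w with hz
  have hcut : ∀ x (n : ℕ), b x * cutoff ρ x ^ n = b x := by
    intro x n
    by_cases hx : b x = 0
    · rw [hx, zero_mul]
    · rw [cutoff_eq_one hρ ((hs x hx).trans hrρ), one_pow, mul_one]
  have hcut' : ∀ n u, rmul b (rmul (fun x => cutoff ρ x ^ (n + 1)) u) = rmul b u := by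
    intro n u
    rw [← rmul_mul_apply hbb (hm.pow n).bdd]
    simp only [hcut]
  have hbw : rmul b (embL2 w) = 0 := by
    rw [← hcut' 0]
    simp only [zero_add, pow_one, hw, map_zero]
  have hin : ∀ y, inner ℂ (rmul b (rmul b z)) y = inner ℂ (rmul b z) (rmul b y) := fun y =>
    inner_mulOp_ofReal_left hbb _ _
  -- Duality: `‖b z‖² = ⟨b² z, z⟩`. As `w` vanishes on the support of `b`, the vector `b² z` is
  -- orthogonal to it.
  have key := hR.norm_inner_le (hR.tendsto_half w) (g := rmul b (rmul b z))
    (by rw [hin, hbw, inner_zero_right]) (D := 4 * C * A * (r / ρ) * ‖embL2 w‖ * ‖rmul b z‖) hρ ?_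
  · rw [hin, inner_self_eq_norm_sq_to_K] at key
    have e : ‖((‖rmul b z‖ : ℂ)) ^ 2‖ = ‖rmul b z‖ * ‖rmul b z‖ := by
      rw [norm_pow, Complex.norm_real, norm_norm, sq]
    have key' : ‖rmul b z‖ * ‖rmul b z‖ ≤
        4 * C * A * (r / ρ ^ 2) * ‖embL2 w‖ * ‖rmul b z‖ := by
      rw [← e]
      refine key.trans (le_of_eq ?_)
      field_simp
    rcases (norm_nonneg (rmul b z)).eq_or_lt with h0 | h0
    · rw [← h0]
      positivity
    · exact le_of_mul_le_mul_right key' h0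
  · intro t ht
    obtain ⟨v, hv, hv'⟩ := hR.exists_resolvent ht (embL2 w)
    have e1 := hA t ρ ht hρ v (embL2 w) hv' hw
    rw [← hv, hin, le_div_iff₀ (by positivity)]
    -- On the support of `b` the factor `χ³` equals `1`. Hardy's inequality on the ball then gains
    -- `r`, and the gradient of `χ³ v` is controlled by its form.
    have e2 : ‖rmul b (embL2 v)‖ ≤ 4 * r * (C * ‖formMap h ((hm.pow 2).smul v)‖) := by
      rw [← hcut' 2, ← IsMultiplier.embL2_smul (hm.pow 2)]
      refine (norm_rmul_embL2_le hb h1 hr hs _).trans ?_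
      gcongr
      refine (sq_le_sq₀ (norm_nonneg _) (by positivity)).1 ((hC _).2.trans ?_)
      rw [mul_pow]
      exact mul_le_mul_of_nonneg_right (by nlinarith) (sq_nonneg _)
    have e3 := norm_inner_le_norm (𝕜 := ℂ) (rmul b z) (rmul b (embL2 v))
    set F := ‖formMap h ((hm.pow 2).smul v)‖ with hF
    calc t ^ 2 * ‖inner ℂ (rmul b z) (rmul b (embL2 v))‖ * (1 + (ρ * t) ^ 2)
        ≤ t ^ 2 * (‖rmul b z‖ * (4 * r * (C * F))) * (1 + (ρ * t) ^ 2) := by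
          gcongr
          exact e3.trans (by gcongr)
      _ = 4 * C * r * ‖rmul b z‖ * (t ^ 2 * ((1 + (ρ * t) ^ 2) * F)) := by ring
      _ ≤ 4 * C * r * ‖rmul b z‖ * (A / ρ * ‖embL2 w‖) := by gcongr
      _ = _ := by ring

end OffDiagonal

/-! ### Dyadic sums and the near region. -/

section Dyadic

variable {φ : ℕ → R3 → ℝ}

theorem IsDyadicPartition.abs_le_one (hφ : IsDyadicPartition φ) (j : ℕ) (x : R3) : |φ j x| ≤ 1 := by
  rw [← sq_le_one_iff_abs_le_one]
  exact le_hasSum (hφ.hasSum x) j fun i _ => sq_nonneg _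

theorem IsDyadicPartition.isBddMul (hφ : IsDyadicPartition φ) (j : ℕ) :
    IsBddMul fun x => (φ j x : ℂ) :=
  IsBddMul.ofReal (hφ.measurable j) (hφ.abs_le_one j)

theorem IsDyadicPartition.norm_le (hφ : IsDyadicPartition φ) {j : ℕ} {x : R3} (hx : φ j x ≠ 0) :
    ‖x‖ ≤ 2 ^ (j + 1) := by
  cases j with
  | zero => simpa using hφ.support_zero x hx
  | succ j => exact (hφ.support_succ j x hx).2

theorem IsDyadicPartition.sum_range (hφ : IsDyadicPartition φ) {k : ℕ} {x : R3}
    (hx : ‖x‖ < 2 ^ k) : ∑ i ∈ Finset.range (k + 1), φ i x ^ 2 = 1 := by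
  refine (hasSum_sum_of_ne_finset_zero fun i hi => ?_).unique (hφ.hasSum x)
  rw [Finset.mem_range, not_lt] at hi
  obtain ⟨l, rfl⟩ : ∃ l, i = l + 1 := ⟨i - 1, by omega⟩
  by_contra h
  have h1 := (hφ.support_succ l x fun h0 => h (by rw [h0]; simp)).1
  have h2 : (2 : ℝ) ^ k ≤ 2 ^ l := pow_le_pow_right₀ (by norm_num) (by omega)
  linarith

theorem IsDyadicPartition.norm_rmul_sq_le (hφ : IsDyadicPartition φ) {b : R3 → ℝ}
    (hb : IsBddMul fun x => (b x : ℂ)) {c : ℝ} (hc : ∀ x, |b x| ≤ c) {k : ℕ}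
    (hs : ∀ x, b x ≠ 0 → ‖x‖ < 2 ^ k) (u : L2R3) :
    ‖rmul b u‖ ^ 2 ≤ c ^ 2 * ∑ i ∈ Finset.range (k + 1), ‖rmul (φ i) u‖ ^ 2 := by
  simp only [norm_sq_eq_integral]
  rw [← integral_finsetSum _ fun i _ => integrable_norm_sq _, ← integral_const_mul]
  apply integral_mono_ae (integrable_norm_sq _)
    ((integrable_finsetSum _ fun i _ => integrable_norm_sq _).const_mul _)
  filter_upwards [coeFn_mulOp hb u, ae_all_iff.2 fun i => coeFn_mulOp (hφ.isBddMul i) u]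
    with x h1 h2
  simp only [h1, h2, norm_mul, Complex.norm_real, Real.norm_eq_abs, mul_pow, sq_abs]
  rw [← Finset.sum_mul, ← mul_assoc]
  refine mul_le_mul_of_nonneg_right ?_ (sq_nonneg _)
  by_cases hx : b x = 0
  · rw [hx]
    have : 0 ≤ ∑ i ∈ Finset.range (k + 1), φ i x ^ 2 := Finset.sum_nonneg fun i _ => sq_nonneg _
    rw [zero_pow two_ne_zero]
    exact mul_nonneg (sq_nonneg _) this
  · rw [hφ.sum_range (hs x hx), mul_one, ← sq_abs]
    exact pow_le_pow_left₀ (abs_nonneg _) (hc x) 2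

theorem IsDyadicPartition.norm_rmulV_sq_le (hφ : IsDyadicPartition φ) {b : R3 → ℝ}
    (hb : IsBddMul fun x => (b x : ℂ)) {c : ℝ} (hc : ∀ x, |b x| ≤ c) {k : ℕ}
    (hs : ∀ x, b x ≠ 0 → ‖x‖ < 2 ^ k) (G : V3) :
    ‖rmulV b G‖ ^ 2 ≤ c ^ 2 * ∑ i ∈ Finset.range (k + 1), ‖rmulV (φ i) G‖ ^ 2 := by
  simp only [PiLp.norm_sq_eq_of_L2, rmulV_apply]
  rw [Finset.sum_comm, Finset.mul_sum]
  exact Finset.sum_le_sum fun a _ => hφ.norm_rmul_sq_le hb hc hs (G a)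

theorem sum_range_pow_sq_le {p : ℝ} (hp : 2 ≤ p ^ 2) (k : ℕ) :
    ∑ i ∈ Finset.range (k + 1), (p ^ i) ^ 2 ≤ 2 * (p ^ k) ^ 2 := by
  induction k with
  | zero => norm_num
  | succ k ih =>
    rw [Finset.sum_range_succ]
    have : (p ^ (k + 1)) ^ 2 = p ^ 2 * (p ^ k) ^ 2 := by ring
    rw [this]
    nlinarith [sq_nonneg (p ^ k)]

/-- The growth `p² ≥ 2` makes the last shell dominate the sum. It is used with `p = √2` for
gradients and `p = √2 ^ 3` for the function. -/
theorem le_of_sq_le_sum_sq {a c N p : ℝ} {n : ℕ → ℝ} {k : ℕ} (hc : 0 ≤ c) (hN : 0 ≤ N) (hp0 : 0 ≤ p)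
    (hp : 2 ≤ p ^ 2) (hn0 : ∀ i, 0 ≤ n i) (hn : ∀ i, n i ≤ p ^ i * N)
    (ha : a ^ 2 ≤ c ^ 2 * ∑ i ∈ Finset.range (k + 1), n i ^ 2) : a ≤ c * (√2 * (p ^ k * N)) := by
  refine le_of_sq_le_sq ?_ (by positivity)
  refine ha.trans ?_
  have h1 : ∑ i ∈ Finset.range (k + 1), n i ^ 2 ≤ 2 * (p ^ k) ^ 2 * N ^ 2 := by
    refine le_trans (Finset.sum_le_sum fun i _ => pow_le_pow_left₀ (hn0 i) (hn i) 2) ?_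
    simp only [mul_pow]
    rw [← Finset.sum_mul]
    exact mul_le_mul_of_nonneg_right (by simpa only [mul_pow] using sum_range_pow_sq_le hp k)
      (sq_nonneg _)
  calc _ ≤ c ^ 2 * (2 * (p ^ k) ^ 2 * N ^ 2) := by gcongr
    _ = c ^ 2 * ((√2) ^ 2 * ((p ^ k) ^ 2 * N ^ 2)) := by
      rw [Real.sq_sqrt (by norm_num)]
      ring
    _ = _ := by ring

theorem cutoff_ne_zero {ρ : ℝ} (hρ : 0 < ρ) {x : R3} (h : cutoff ρ x ≠ 0) : ‖x‖ < 2 * ρ := by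
  by_contra h1
  exact h (cutoff_eq_zero hρ (not_lt.1 h1))

theorem isBddMul_sub {a b : R3 → ℝ} (ha : IsBddMul fun x => (a x : ℂ))
    (hb : IsBddMul fun x => (b x : ℂ)) : IsBddMul fun x => ((a x - b x : ℝ) : ℂ) := by
  have := ha.add ((IsBddMul.const (-1)).mul hb)
  convert! this using 2 with x
  push_cast
  ring

theorem rmul_sub_apply {a b : R3 → ℝ} (ha : IsBddMul fun x => (a x : ℂ))
    (hb : IsBddMul fun x => (b x : ℂ)) (u : L2R3) :
    rmul (fun x => a x - b x) u = rmul a u - rmul b u := by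
  rw [eq_sub_iff_add_eq, ← mulOp_add_apply (isBddMul_sub ha hb) hb]
  congr 1
  simp

variable {h : ℝ → ℝ}

/-- The contribution of the region `|x| ≲ 2 ^ m`. -/
theorem exists_norm_grad_cutoff_smul_le :
    ∃ A, 0 < A ∧ ∀ (φ : ℕ → R3 → ℝ) (_ : IsDyadicPartition φ) (v : H1) (N₁ N₂ : ℝ) (_ : 0 ≤ N₁)
      (_ : 0 ≤ N₂) (_ : ∀ i, ‖rmulV (φ i) (grad v)‖ ≤ √2 ^ i * N₁)
      (_ : ∀ i, ‖rmul (φ i) (embL2 v)‖ ≤ (√2 ^ 3) ^ i * N₂) (m : ℕ),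
      ‖grad ((isMultiplier_cutoff (ρ := 2 ^ m) (by positivity)).smul v)‖ ≤
        A * √2 ^ m * (N₁ + N₂) := by
  obtain ⟨C, hC0, hC⟩ := exists_abs_pd_cutoff_le
  have h2 : √2 ^ 2 = (2 : ℝ) := Real.sq_sqrt (by norm_num)
  refine ⟨8 + 64 * C, by positivity, fun φ hφ v N₁ N₂ hN1 hN2 h₁ h₂ m => ?_⟩
  have hρ : (0 : ℝ) < 2 ^ m := by positivity
  have hm := isMultiplier_cutoff hρ
  have h8 : (√2 ^ 3) ^ 2 = (8 : ℝ) := by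
    calc (√2 ^ 3) ^ 2 = (√2 ^ 2) ^ 3 := by ring
      _ = 8 := by rw [h2]; norm_num
  have hq : √2 ≤ 2 := by nlinarith [Real.sqrt_nonneg 2]
  have e : grad (hm.smul v) = rmulV (cutoff (2 ^ m)) (grad v) +
      toV3 (fun i => rmul (pd i (cutoff (2 ^ m)))) (embL2 v) := by
    ext1 i
    rfl
  have hpow : (2 : ℝ) * 2 ^ m < 2 ^ (m + 2) := by
    rw [pow_add]
    linarith
  -- The cutoff is supported in `|x| ≤ 2 ^ (m + 1) < 2 ^ (m + 2)`, so only shells up to `m + 2`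
  -- enter.
  have b1 : ‖rmulV (cutoff (2 ^ m)) (grad v)‖ ≤ 1 * (√2 * (√2 ^ (m + 2) * N₁)) :=
    le_of_sq_le_sum_sq zero_le_one hN1 (Real.sqrt_nonneg _) h2.ge (fun i => norm_nonneg _) h₁
      (hφ.norm_rmulV_sq_le hm.bdd (abs_cutoff_le_one _)
        (fun x hx => (cutoff_ne_zero hρ hx).trans hpow) _)
  have b2 : ∀ i, ‖rmul (pd i (cutoff (2 ^ m))) (embL2 v)‖ ≤
      C / 2 ^ m * (√2 * ((√2 ^ 3) ^ (m + 2) * N₂)) := fun i =>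
    le_of_sq_le_sum_sq (by positivity) hN2 (by positivity)
      (by rw [h8]; norm_num) (fun i => norm_nonneg _) h₂
      (hφ.norm_rmul_sq_le (hm.bdd_pd i) (hC _ hρ i) (fun x hx => by
        refine lt_of_le_of_lt ?_ hpow
        by_contra h1
        exact hx (pd_cutoff_eq_zero_of_gt hρ (not_le.1 h1) i)) _)
  -- The gradient of the cutoff gives `2 ^ (-m)` and the size of `v` gives `2 ^ (3m/2)`, which
  -- leaves `2 ^ (m/2)`.
  have e2 : C / 2 ^ m * (√2 * ((√2 ^ 3) ^ (m + 2) * N₂)) = 8 * C * √2 * √2 ^ m * N₂ := by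
    have : (2 : ℝ) ^ m = √2 ^ m * √2 ^ m := by
      rw [← mul_pow, ← sq, h2]
    rw [div_mul_eq_mul_div, div_eq_iff hρ.ne', this]
    have h8 : (√2 ^ 3) ^ (m + 2) = 8 * (√2 ^ m * √2 ^ m * √2 ^ m) := by
      calc (√2 ^ 3) ^ (m + 2) = (√2 ^ 2) ^ 3 * (√2 ^ m * √2 ^ m * √2 ^ m) := by ring
        _ = _ := by rw [h2]; norm_num
    rw [h8]
    ring
  have b3 : ‖toV3 (fun i => rmul (pd i (cutoff (2 ^ m)))) (embL2 v)‖ ≤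
      2 * (8 * C * √2 * √2 ^ m * N₂) := by
    refine le_of_sq_le_sq ?_ (by positivity)
    refine (norm_sq_le_of_comp_le (C := 8 * C * √2 * √2 ^ m * N₂) fun i => ?_).trans ?_
    · rw [← e2]
      exact b2 i
    · nlinarith [sq_nonneg (8 * C * √2 * √2 ^ m * N₂)]
  rw [e]
  refine (norm_add_le _ _).trans ((add_le_add b1 b3).trans ?_)
  have e3 : √2 ^ (m + 2) = 2 * √2 ^ m := by rw [pow_add, h2, mul_comm]
  rw [e3]
  have hQ : 0 < √2 ^ m := by positivity
  have e4 : √2 * (√2 ^ m * N₁) ≤ 2 * (√2 ^ m * N₁) := by gcongr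
  have e5 : √2 * (C * (√2 ^ m * N₂)) ≤ 2 * (C * (√2 ^ m * N₂)) := by gcongr
  have e6 : 0 ≤ √2 ^ m * N₁ := by positivity
  have e7 : 0 ≤ √2 ^ m * N₂ := by positivity
  have e8 : 0 ≤ C * (√2 ^ m * N₁) := by positivity
  have e9 : 0 ≤ C * (√2 ^ m * N₂) := by positivity
  linarith

end Dyadic

/-! ### The local estimate for the square root. -/

section Local

variable {h : ℝ → ℝ}

/-- A telescoping geometric series; `4 = 1 / (1 - 3/4)`. -/
theorem norm_sub_le_of_pow_decay {E : Type*} [NormedAddCommGroup E] {x : ℕ → E} {y : E} {m : ℕ}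
    {D p : ℝ} (hp0 : 0 ≤ p) (hp : p ≤ 3 / 4) (hD : 0 ≤ D) (hx : Tendsto x atTop (𝓝 y))
    (hstep : ∀ k, m ≤ k → ‖x (k + 1) - x k‖ ≤ D * p ^ k) : ‖y‖ ≤ ‖x m‖ + 4 * D * p ^ m := by
  have h1 : ∀ k, m ≤ k → ‖x k‖ ≤ ‖x m‖ + 4 * D * (p ^ m - p ^ k) := by
    intro k hk
    induction k, hk using Nat.le_induction with
    | base => simp
    | succ k hk ih =>
      have h2 := hstep k hk
      have h3 : ‖x (k + 1)‖ ≤ ‖x k‖ + ‖x (k + 1) - x k‖ := by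
        have := norm_add_le (x k) (x (k + 1) - x k)
        rwa [add_sub_cancel] at this
      have h4 : p ^ (k + 1) ≤ 3 / 4 * p ^ k := by
        rw [pow_succ, mul_comm]
        gcongr
      nlinarith [mul_le_mul_of_nonneg_left h4 hD]
  refine le_of_tendsto hx.norm ?_
  filter_upwards [eventually_ge_atTop m] with k hk
  refine (h1 k hk).trans ?_
  have : 0 ≤ D * p ^ k := by positivity
  linarith

theorem rmul_eq_zero {a : R3 → ℝ} (h : ∀ x, a x = 0) (u : L2R3) : rmul a u = 0 := by
  have : (fun x => (a x : ℂ)) = fun _ => 0 := by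
    ext x
    simp [h]
  rw [rmul, this, mulOp_const_apply, zero_smul]

theorem cutoff_mul_sub_eq_zero {ρ a b : ℝ} (hρ : 0 < ρ) (ha : 2 * ρ ≤ a) (hb : 2 * ρ ≤ b) (x : R3) :
    cutoff ρ x * (cutoff a x - cutoff b x) = 0 := by
  by_cases hx : 2 * ρ ≤ ‖x‖
  · rw [cutoff_eq_zero hρ hx, zero_mul]
  · rw [not_le] at hx
    rw [cutoff_eq_one (by linarith) (hx.le.trans ha), cutoff_eq_one (by linarith) (hx.le.trans hb),
      sub_self, mul_zero]

theorem cutoff_mul_one_sub_eq_zero {ρ b : ℝ} (hρ : 0 < ρ) (hb : 2 * ρ ≤ b) (x : R3) :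
    cutoff ρ x * (1 - cutoff b x) = 0 := by
  by_cases hx : 2 * ρ ≤ ‖x‖
  · rw [cutoff_eq_zero hρ hx, zero_mul]
  · rw [not_le] at hx
    rw [cutoff_eq_one (by linarith) (hx.le.trans hb), sub_self, mul_zero]

/-- The cutoff of `v` to `|x| ≲ 2 ^ k`. -/
def cutH1 (k : ℕ) (v : H1) : H1 := (isMultiplier_cutoff (ρ := 2 ^ k) (by positivity)).smul v

theorem embL2_cutH1_sub (k l : ℕ) (v : H1) : embL2 (cutH1 k v - cutH1 l v) =
    rmul (fun x => cutoff (2 ^ k) x - cutoff (2 ^ l) x) (embL2 v) := by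
  rw [rmul_sub_apply (isBddMul_cutoff _) (isBddMul_cutoff _), map_sub]
  rfl

theorem embL2_sub_cutH1 (k : ℕ) (v : H1) : embL2 (v - cutH1 k v) =
    rmul (fun x => 1 - cutoff (2 ^ k) x) (embL2 v) := by
  rw [rmul_sub_apply (a := fun _ => 1) (IsBddMul.const _) (isBddMul_cutoff _), map_sub]
  have : rmul (fun _ => 1) (embL2 v) = embL2 v := by
    have := mulOp_const_apply 1 (embL2 v)
    rw [one_smul] at this
    simpa [rmul] using this
  rw [this]
  rfl

theorem exists_norm_rmul_half_le_dyadic (hh : IsRadialCoeff h) {R : L2R3 →L[ℂ] L2R3}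
    (hR : IsFormResolvent embL2 (formMap h) R) :
    ∃ A, 0 < A ∧ ∀ (φ : ℕ → R3 → ℝ) (_ : IsDyadicPartition φ) (v : H1) (N₁ N₂ : ℝ) (_ : 0 ≤ N₁)
      (_ : 0 ≤ N₂) (_ : ∀ i, ‖rmulV (φ i) (grad v)‖ ≤ √2 ^ i * N₁)
      (_ : ∀ i, ‖rmul (φ i) (embL2 v)‖ ≤ (√2 ^ 3) ^ i * N₂) (j : ℕ),
      ‖rmul (φ j) (hR.half v)‖ ≤ A * √2 ^ j * (N₁ + N₂) := by
  obtain ⟨A₁, hA1, hnear⟩ := exists_norm_grad_cutoff_smul_le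
  obtain ⟨A₂, hA2, hfar⟩ := exists_norm_rmul_half_le hh hR
  obtain ⟨C, hC1, hC⟩ := exists_formMap_bounds hh
  have h2 : √2 ^ 2 = (2 : ℝ) := Real.sq_sqrt (by norm_num)
  have h8 : (√2 ^ 3) ^ 2 = (8 : ℝ) := by
    calc (√2 ^ 3) ^ 2 = (√2 ^ 2) ^ 3 := by ring
      _ = 8 := by rw [h2]; norm_num
  have hq0 : 0 < √2 := by positivity
  have hq : √2 ≤ 2 := by nlinarith
  have hp : (√2)⁻¹ ≤ 3 / 4 := by
    rw [inv_le_comm₀ hq0 (by norm_num)]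
    nlinarith
  refine ⟨4 * C * A₁ + 512 * A₂, by positivity, fun φ hφ v N₁ N₂ hN1 hN2 h₁ h₂ j => ?_⟩
  -- The term `k = j + 2` is the near part; the increments carry the contributions of the dyadic
  -- shells further out.
  set x : ℕ → L2R3 := fun k => rmul (φ j) (hR.half (cutH1 k v)) with hx
  have hr : (0 : ℝ) < 2 ^ (j + 1) := by positivity
  have hqj : ∀ k : ℕ, (2 : ℝ) ^ k = √2 ^ k * √2 ^ k := fun k => by rw [← mul_pow, ← sq, h2]
  -- Off-diagonal decay with `r = 2 ^ (j + 1)` and `ρ = 2 ^ (k - 1)`, so that `r / ρ² = 8 * 2 ^ j *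
  -- 2 ^ (-2k)`.
  have hest : ∀ k, j + 2 ≤ k → ∀ w : H1, (rmul (cutoff (2 ^ (k - 1))) (embL2 w) = 0) →
      ‖rmul (φ j) (hR.half w)‖ ≤ 8 * A₂ * 2 ^ j * ((2 ^ k) ^ 2)⁻¹ * ‖embL2 w‖ := by
    intro k hk w hw
    have hle : (2 : ℝ) ^ (j + 1) ≤ 2 ^ (k - 1) := pow_le_pow_right₀ (by norm_num) (by omega)
    refine (hfar (2 ^ (k - 1)) (2 ^ (j + 1)) (by positivity) hr hle (φ j) (hφ.measurable j)
      (hφ.abs_le_one j) (fun x => hφ.norm_le) w hw).trans (le_of_eq ?_)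
    obtain ⟨l, rfl⟩ : ∃ l, k = l + 1 := ⟨k - 1, by omega⟩
    rw [Nat.add_sub_cancel, pow_succ 2 l, pow_succ 2 j]
    field_simp
    ring
  have hρ : ∀ k l : ℕ, 1 ≤ k → k ≤ l → 2 * (2 : ℝ) ^ (k - 1) ≤ 2 ^ l := by
    intro k l hk hl
    rw [← pow_succ']
    exact pow_le_pow_right₀ (by norm_num) (by omega)
  -- The increment has norm of order `2 ^ (3k/2) N₂`, which against `2 ^ (-2k)` leaves the summable
  -- `2 ^ (-k/2)`.
  have hstep : ∀ k, j + 2 ≤ k → ‖x (k + 1) - x k‖ ≤ 128 * A₂ * √2 ^ j * √2 ^ j * N₂ * (√2)⁻¹ ^ k := by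
    intro k hk
    have e1 : x (k + 1) - x k = rmul (φ j) (hR.half (cutH1 (k + 1) v - cutH1 k v)) := by
      rw [map_sub, map_sub]
    have e2 : rmul (cutoff (2 ^ (k - 1))) (embL2 (cutH1 (k + 1) v - cutH1 k v)) = 0 := by
      rw [embL2_cutH1_sub, ← rmul_mul_apply (isBddMul_cutoff _)
        (isBddMul_sub (isBddMul_cutoff _) (isBddMul_cutoff _))]
      exact rmul_eq_zero (cutoff_mul_sub_eq_zero (by positivity) (hρ _ _ (by omega) (by omega))
        (hρ _ _ (by omega) (by omega))) _
    have e3 : ‖embL2 (cutH1 (k + 1) v - cutH1 k v)‖ ≤ 1 * (√2 * ((√2 ^ 3) ^ (k + 2) * N₂)) := by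
      rw [embL2_cutH1_sub]
      refine le_of_sq_le_sum_sq zero_le_one hN2 (by positivity) (by rw [h8]; norm_num)
        (fun i => norm_nonneg _) h₂ (hφ.norm_rmul_sq_le
          (isBddMul_sub (isBddMul_cutoff _) (isBddMul_cutoff _)) (fun x => ?_) (fun x hx => ?_) _)
      · rw [abs_le]
        have a1 := cutoff_nonneg (2 ^ k) x
        have a2 := cutoff_nonneg (2 ^ (k + 1)) x
        have a3 := cutoff_le_one (2 ^ k) x
        have a4 := cutoff_le_one (2 ^ (k + 1)) x
        constructor <;> linarith
      · by_contra h1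
        rw [not_lt] at h1
        have h3 : (0 : ℝ) < 2 ^ k := by positivity
        have h4 : (2 : ℝ) ^ (k + 2) = 4 * 2 ^ k := by ring
        have h5 : (2 : ℝ) ^ (k + 1) = 2 * 2 ^ k := by ring
        apply hx
        rw [cutoff_eq_zero (by positivity) (by linarith), cutoff_eq_zero h3 (by linarith), sub_self]
    rw [e1]
    refine (hest k hk _ e2).trans ((mul_le_mul_of_nonneg_left e3 (by positivity)).trans ?_)
    have e4 : (√2 ^ 3) ^ (k + 2) = 8 * (√2 ^ k * √2 ^ k * √2 ^ k) := by
      calc (√2 ^ 3) ^ (k + 2) = (√2 ^ 2) ^ 3 * (√2 ^ k * √2 ^ k * √2 ^ k) := by ring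
        _ = _ := by rw [h2]; norm_num
    have e5 : 8 * A₂ * 2 ^ j * ((2 ^ k) ^ 2)⁻¹ * (1 * (√2 * ((√2 ^ 3) ^ (k + 2) * N₂))) =
        √2 * (64 * A₂ * √2 ^ j * √2 ^ j * N₂ * (√2)⁻¹ ^ k) := by
      rw [e4, hqj k, hqj j, inv_pow]
      field_simp
      ring
    rw [e5]
    refine (mul_le_mul_of_nonneg_right hq (by positivity)).trans (le_of_eq ?_)
    ring
  -- Here the tail is bounded crudely by `‖v‖`; the factor `4 ^ (-k)` suffices, and no rate in terms
  -- of `N₁` and `N₂` is needed.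
  have hlim : Tendsto x atTop (𝓝 (rmul (φ j) (hR.half v))) := by
    rw [tendsto_iff_norm_sub_tendsto_zero]
    have hz : Tendsto (fun k : ℕ => 8 * A₂ * 2 ^ j * ((2 ^ k) ^ 2)⁻¹ * ‖embL2 v‖) atTop (𝓝 0) := by
      have h3 : Tendsto (fun k : ℕ => ((4 : ℝ)⁻¹) ^ k) atTop (𝓝 0) :=
        tendsto_pow_atTop_nhds_zero_of_lt_one (by norm_num) (by norm_num)
      have h4 := (h3.const_mul (8 * A₂ * 2 ^ j)).mul_const ‖embL2 v‖
      rw [mul_zero, zero_mul] at h4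
      refine h4.congr fun k => ?_
      rw [inv_pow, ← pow_mul, mul_comm k 2, pow_mul]
      norm_num
    refine squeeze_zero' (Eventually.of_forall fun k => norm_nonneg _) ?_ hz
    filter_upwards [eventually_ge_atTop (j + 2)] with k hk
    rw [norm_sub_rev]
    have e1 : rmul (φ j) (hR.half v) - x k = rmul (φ j) (hR.half (v - cutH1 k v)) := by
      rw [map_sub, map_sub]
    have hb1 := isBddMul_sub (a := fun _ => 1) (IsBddMul.const _) (isBddMul_cutoff (2 ^ k))
    rw [e1]
    refine (hest k hk _ ?_).trans ?_
    · rw [embL2_sub_cutH1, ← rmul_mul_apply (isBddMul_cutoff _) hb1]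
      exact rmul_eq_zero
        (cutoff_mul_one_sub_eq_zero (by positivity) (hρ _ _ (by omega) (by omega))) _
    · gcongr
      rw [embL2_sub_cutH1]
      refine (norm_rmul_le hb1 (C := 1) (fun x => ?_) _).trans (one_mul _).le
      have a1 := cutoff_nonneg (2 ^ k) x
      have a3 := cutoff_le_one (2 ^ k) x
      rw [abs_le]
      constructor <;> linarith
  have hmain := norm_sub_le_of_pow_decay (by positivity) hp (by positivity) hlim hstep
  -- For the near part the localization `φ j` is dropped and the global bound of the square root by
  -- the form is used.
  have hfirst : ‖x (j + 2)‖ ≤ C * (A₁ * √2 ^ (j + 2) * (N₁ + N₂)) := by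
    have e1 : ‖x (j + 2)‖ ≤ 1 * ‖hR.half (cutH1 (j + 2) v)‖ :=
      norm_rmul_le (hφ.isBddMul j) (hφ.abs_le_one j) _
    rw [one_mul] at e1
    refine e1.trans ((hR.norm_half_le _).trans ?_)
    refine le_trans (b := C * ‖grad (cutH1 (j + 2) v)‖) ?_ ?_
    · refine (sq_le_sq₀ (norm_nonneg _) (by positivity)).1 ((hC _).1.trans ?_)
      rw [mul_pow]
      exact mul_le_mul_of_nonneg_right (by nlinarith) (sq_nonneg _)
    · exact mul_le_mul_of_nonneg_left (hnear φ hφ v N₁ N₂ hN1 hN2 h₁ h₂ (j + 2)) (by positivity)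
  refine hmain.trans ((add_le_add_left hfirst _).trans ?_)
  have e1 : √2 ^ (j + 2) = 2 * √2 ^ j := by rw [pow_add, h2, mul_comm]
  have e2 : 4 * (128 * A₂ * √2 ^ j * √2 ^ j * N₂) * (√2)⁻¹ ^ (j + 2) = 256 * A₂ * √2 ^ j * N₂ := by
    rw [inv_pow, e1]
    field_simp
    ring
  rw [e1, e2]
  have e3 : 0 ≤ C * A₁ * √2 ^ j * (N₁ + N₂) := by positivity
  have e4 : 0 ≤ A₂ * √2 ^ j * N₁ := by positivity
  have e5 : 0 ≤ A₂ * √2 ^ j * N₂ := by positivity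
  nlinarith

end Local

/-! ### Translation to the norms of the theorem. -/

section Main

theorem eLpNorm_smul_eq {φ : R3 → ℝ} (hφ : IsBddMul fun x => (φ x : ℂ)) (u : L2R3) :
    eLpNorm (fun x => φ x • u x) 2 volume = ENNReal.ofReal ‖rmul φ u‖ := by
  rw [ofReal_norm, Lp.enorm_def]
  apply eLpNorm_congr_ae
  filter_upwards [coeFn_mulOp hφ u] with x hx
  rw [hx, Complex.real_smul]

theorem eLpNorm_smul_vec_eq {φ : R3 → ℝ} (hφ : IsBddMul fun x => (φ x : ℂ)) (G : V3) :
    eLpNorm (fun x => φ x • (WithLp.toLp 2 fun i => G i x : EuclideanSpace ℂ (Fin 3))) 2 volume =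
      ENNReal.ofReal ‖rmulV φ G‖ := by
  rw [eLpNorm_eq_lintegral_rpow_enorm_toReal two_ne_zero ENNReal.ofNat_ne_top]
  have h1 : ∀ᵐ x, ‖φ x • (WithLp.toLp 2 fun i => G i x : EuclideanSpace ℂ (Fin 3))‖ₑ ^
      (2 : ℝ≥0∞).toReal = ENNReal.ofReal (∑ i, ‖rmulV φ G i x‖ ^ 2) := by
    filter_upwards [ae_all_iff.2 fun i => coeFn_mulOp hφ (G i)] with x hx
    rw [← ofReal_norm, ENNReal.toReal_ofNat, ENNReal.rpow_ofNat,
      ← ENNReal.ofReal_pow (norm_nonneg _), EuclideanSpace.norm_sq_eq]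
    congr 1
    refine Finset.sum_congr rfl fun i _ => ?_
    rw [rmulV_apply, hx i, ← Complex.real_smul]
    rfl
  rw [lintegral_congr_ae h1, ← ofReal_integral_eq_lintegral_ofReal
    (integrable_finsetSum _ fun i _ => integrable_norm_sq _)
    (ae_of_all _ fun x => Finset.sum_nonneg fun i _ => sq_nonneg _), ← norm_sq_V3,
    ENNReal.ofReal_rpow_of_nonneg (sq_nonneg _) (by positivity)]
  congr 1
  rw [ENNReal.toReal_ofNat, ← Real.sqrt_eq_rpow, Real.sqrt_sq (norm_nonneg _)]

theorem two_rpow_neg_half (j : ℕ) : (2 : ℝ) ^ ((j : ℝ) * (-1 / 2)) = (√2 ^ j)⁻¹ := by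
  have e : (j : ℝ) * (-1 / 2) = -(1 / 2 * j) := by ring
  rw [e, Real.rpow_neg (by norm_num), Real.rpow_mul (by norm_num), Real.rpow_natCast,
    ← Real.sqrt_eq_rpow]

theorem two_rpow_neg_three_half (j : ℕ) :
    (2 : ℝ) ^ ((j : ℝ) * (-3 / 2)) = ((√2 ^ 3) ^ j)⁻¹ := by
  have e : (j : ℝ) * (-3 / 2) = -(1 / 2 * (3 * j : ℕ)) := by
    push_cast
    ring
  rw [e, Real.rpow_neg (by norm_num), Real.rpow_mul (by norm_num), Real.rpow_natCast,
    ← Real.sqrt_eq_rpow, pow_mul]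

theorem le_mul_toReal {a q : ℝ} {N : ℝ≥0∞} (hN : N ≠ ⊤) (ha : 0 ≤ a) (hq : 0 < q)
    (h : ENNReal.ofReal q⁻¹ * ENNReal.ofReal a ≤ N) : a ≤ q * N.toReal := by
  rw [← ENNReal.ofReal_mul (by positivity)] at h
  have h1 := ENNReal.toReal_mono hN h
  rw [ENNReal.toReal_ofReal (by positivity), inv_mul_le_iff₀ hq] at h1
  exact h1

theorem exists_locNorm_half_le {h : ℝ → ℝ} (hh : IsRadialCoeff h) {R : L2R3 →L[ℂ] L2R3}
    (hR : IsFormResolvent embL2 (formMap h) R) :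
    ∃ A, 0 < A ∧ ∀ (v : H1) (φ : ℕ → R3 → ℝ), IsDyadicPartition φ →
      locNorm φ (-1 / 2) (hR.half v) ≤ ENNReal.ofReal A *
        (locNorm φ (-1 / 2) (fun x => (WithLp.toLp 2 fun i => grad v i x :
          EuclideanSpace ℂ (Fin 3))) + locNorm φ (-3 / 2) (embL2 v)) := by
  obtain ⟨A, hA0, hA⟩ := exists_norm_rmul_half_le_dyadic hh hR
  refine ⟨A, hA0, fun v φ hφ => ?_⟩
  set N₁ := locNorm φ (-1 / 2) (fun x => (WithLp.toLp 2 fun i => grad v i x :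
    EuclideanSpace ℂ (Fin 3))) with hN1
  set N₂ := locNorm φ (-3 / 2) (embL2 v) with hN2
  have hA' : ENNReal.ofReal A ≠ 0 := by simpa using hA0
  by_cases h1 : N₁ = ⊤
  · rw [h1, top_add, ENNReal.mul_top hA']
    exact le_top
  by_cases h2 : N₂ = ⊤
  · rw [h2, add_top, ENNReal.mul_top hA']
    exact le_top
  have b1 : ∀ i, ‖rmulV (φ i) (grad v)‖ ≤ √2 ^ i * N₁.toReal := by
    intro i
    refine le_mul_toReal h1 (norm_nonneg _) (by positivity) ?_
    rw [← two_rpow_neg_half, ← eLpNorm_smul_vec_eq (hφ.isBddMul i)]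
    exact le_iSup (fun j : ℕ => ENNReal.ofReal ((2 : ℝ) ^ ((j : ℝ) * (-1 / 2))) *
      eLpNorm (fun x => φ j x • (WithLp.toLp 2 fun i => grad v i x :
        EuclideanSpace ℂ (Fin 3))) 2 volume) i
  have b2 : ∀ i, ‖rmul (φ i) (embL2 v)‖ ≤ (√2 ^ 3) ^ i * N₂.toReal := by
    intro i
    refine le_mul_toReal h2 (norm_nonneg _) (by positivity) ?_
    rw [← two_rpow_neg_three_half, ← eLpNorm_smul_eq (hφ.isBddMul i)]
    exact le_iSup (fun j : ℕ => ENNReal.ofReal ((2 : ℝ) ^ ((j : ℝ) * (-3 / 2))) *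
      eLpNorm (fun x => φ j x • embL2 v x) 2 volume) i
  rw [← ENNReal.ofReal_toReal h1, ← ENNReal.ofReal_toReal h2,
    ← ENNReal.ofReal_add ENNReal.toReal_nonneg ENNReal.toReal_nonneg, ← ENNReal.ofReal_mul hA0.le]
  refine iSup_le fun j => ?_
  rw [eLpNorm_smul_eq (hφ.isBddMul j), two_rpow_neg_half, ← ENNReal.ofReal_mul (by positivity)]
  apply ENNReal.ofReal_le_ofReal
  rw [inv_mul_le_iff₀ (by positivity)]
  refine (hA φ hφ v _ _ ENNReal.toReal_nonneg ENNReal.toReal_nonneg b1 b2 j).trans (le_of_eq ?_)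
  ring

end Main

theorem lemma5p4 (B : ℝ) :
    ∃ K₀ : ℝ, ∀ K : ℝ, K₀ ≤ K → ∀ M : ℝ, 0 < M →
      ∀ ψ : ℝ → ℝ, ContDiff ℝ ∞ ψ → (∀ r, |ψ r| ≤ B) →
        (∀ r, r < K * M / 2 → ψ r = 1) → (∀ r, K * M < r → ψ r = 0) →
      IsSelfAdjoint (P1 (hFun M ψ)) ∧
      ∃ C : ℝ, 0 < C ∧
        (∀ (v : L2R3) (G : Fin 3 → L2R3), IsWeakGrad v G →
          ∃ hv : v ∈ (fracPow (P1 (hFun M ψ)) (1 / 2)).domain,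
            ∀ φ : ℕ → R3 → ℝ, IsDyadicPartition φ →
              locNorm φ (-1 / 2) (fracPow (P1 (hFun M ψ)) (1 / 2) ⟨v, hv⟩ : L2R3) ≤
                ENNReal.ofReal C *
                  (locNorm φ (-1 / 2) (fun x => (WithLp.toLp 2 fun i => G i x :
                      EuclideanSpace ℂ (Fin 3))) +
                    locNorm φ (-3 / 2) v)) ∧
        (∀ s : ℝ, -1 ≤ s → s ≤ 1 →
          (∀ u : L2R3, u ∈ (fracPow (P1 (hFun M ψ)) (s / 2)).domain ↔ hDotNorm s u < ⊤) ∧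
          ∀ u : (fracPow (P1 (hFun M ψ)) (s / 2)).domain,
            ‖fracPow (P1 (hFun M ψ)) (s / 2) u‖ₑ ≤ ENNReal.ofReal C * hDotNorm s (u : L2R3) ∧
            hDotNorm s (u : L2R3) ≤
              ENNReal.ofReal C * ‖fracPow (P1 (hFun M ψ)) (s / 2) u‖ₑ) := by
  refine ⟨8 * (1 + B) + 16, fun K hK M hM ψ hψ hB h1 h0 => ?_⟩
  have hh := isRadialCoeff_hFun hK hM hψ hB h1 h0
  obtain ⟨R, hR⟩ := exists_isFormResolvent_formMap hh
  obtain ⟨A, hA0, hA⟩ := exists_locNorm_half_le hh hR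
  obtain ⟨C, hC1, hC⟩ := exists_formMap_bounds hh
  have hAm : ENNReal.ofReal A ≤ ENNReal.ofReal (max A C) :=
    ENNReal.ofReal_le_ofReal (le_max_left _ _)
  have hCm : ENNReal.ofReal C ≤ ENNReal.ofReal (max A C) :=
    ENNReal.ofReal_le_ofReal (le_max_right _ _)
  -- A single constant serves both parts: `A` for the local estimate and `C` for the Sobolev norms.
  refine ⟨isSelfAdjoint_P1 hh hR, max A C, lt_max_of_lt_left hA0, fun v G hG => ?_,
    fun s hs1 hs2 => ⟨mem_fracPow_P1 hh hC1 hC hs1 hs2, fun u => ?_⟩⟩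
  · have ht := hR.tendsto_half hG.toH1
    rw [hG.embL2_toH1] at ht
    have hv : v ∈ (fracPow (P1 (hFun M ψ)) (1 / 2)).domain := by
      simp only [mem_fracPow_domain, regPow_P1 hh hR]
      exact ⟨_, ht⟩
    refine ⟨hv, fun φ hφ => ?_⟩
    have e : fracPow (P1 (hFun M ψ)) (1 / 2) ⟨v, hv⟩ = hR.half hG.toH1 := by
      have h2 := tendsto_fracPow (P1 (hFun M ψ)) (1 / 2) ⟨v, hv⟩
      simp only [regPow_P1 hh hR] at h2
      exact tendsto_nhds_unique h2 ht
    rw [e]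
    exact (hA hG.toH1 φ hφ).trans (mul_le_mul_left hAm _)
  · obtain ⟨h2, h3⟩ := enorm_fracPow_P1 hh hC1 hC hs1 hs2 u
    exact ⟨h2.trans (mul_le_mul_left hCm _), h3.trans (mul_le_mul_left hCm _)⟩
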